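/- Let $L$ be a lattice of full rank in a finite-dimensional Euclidean space $V$. Suppose that $L$ is a root lattice (that is, $L$ is integral and is generated over $\mathbb{Z}$ by its vectors of squared norm $2$, its roots) and that $L$ is indecomposable (not an orthogonal sum of two nonzero sublattices). Let $c\in V$ be a deep hole of $L$, i.e. a point at which the function $z\mapsto\min_{x\in L}\|x-z\|$ attains its maximum over $V$. Notation: $O(L)$ is the group of linear isometries of $V$ mapping $L$ onto $L$; $W(L)\subseteq O(L)$ is the Weyl group, generated by the reflections in the hyperplanes orthogonal to the roots; $\mathrm{Iso}(L)$ is the group of affine isometries of $V$ mapping $L$ onto $L$; and $\mathrm{Iso}(L)_c$ is the stabilizer of $c$ in it. The standard root lattices are $$A_n=\Big\{x\in\mathbb{Z}^{n+1}:\sum_i x_i=0\Big\}\ (n\ge 1),\qquad D_n=\Big\{x\in\mathbb{Z}^{n}:\sum_i x_i\in 2\mathbb{Z}\Big\}\ (n\ge 4),$$ $$E_8=D_8\cup\big(\tfrac12(1,\dots,1)+D_8\big),\qquad E_7=\Big\{x\in E_8:\sum_i x_i=0\Big\},\qquad E_6=\{x\in E_7:x_1+x_8=0\},$$ and $L$ is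 of type $X$ if it is isometric to the standard lattice $X$. Let $O'(D_4)$ be the group of isometries of $\mathbb{R}^4$ generated by $W(D_4)$ and the sign change of the last coordinate. Then the following hold, where $\cong$ denotes isomorphism of groups. 1. If $L$ is of type $A_n$ with $n\ge 1$, then $\mathrm{Iso}(L)_c\cong W(L)$ if $n$ is even, and $\mathrm{Iso}(L)_c\cong O(L)$ if $n$ is odd. 2. If $L$ is of type $D_4$, then $\mathrm{Iso}(L)_c\cong O'(D_4)$. Here $W(D_4)\subseteq O'(D_4)\subseteq O(D_4)$, with $[O'(D_4):W(D_4)]=2$ and $[O(D_4):O'(D_4)]=3$. If $L$ is of type $D_n$ with $n\ge 5$, then $\mathrm{Iso}(L)_c\cong W(L)$. 3. If $L$ is of type $E_6$ or $E_7$, then $\mathrm{Iso}(L)_c\cong W(L)$; moreover $O(L)\cong W(L)$ if $L$ is of type $E_7$. If $L$ is of type $E_8$, then $\mathrm{Iso}(L)_c\cong W(D_8)$, the Weyl group of the lattice $D_8$. -/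

import Mathlib

noncomputable section

open scoped InnerProductSpace

namespace RootLattice

section General

variable {E : Type*} [NormedAddCommGroup E] [InnerProductSpace ℝ E]

/-- A lattice is a root lattice if it is integral and is generated over `ℤ` by the set `L(2)` of
its vectors of squared norm `2`. -/
structure IsRootLattice (L : Submodule ℤ E) : Prop where
  integral : ∀ x ∈ L, ∀ y ∈ L, ∃ k : ℤ, ⟪x, y⟫_ℝ = k
  generated : Submodule.span ℤ {x : E | x ∈ L ∧ ‖x‖ ^ 2 = 2} = L

/-- A lattice is indecomposable if it is not the orthogonal sum of two nonzero sublattices. -/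
def IsIndecomposable (L : Submodule ℤ E) : Prop :=
  ∀ L₁ L₂ : Submodule ℤ E, (∀ x ∈ L₁, ∀ y ∈ L₂, ⟪x, y⟫_ℝ = 0) → L₁ ⊔ L₂ = L →
    L₁ = ⊥ ∨ L₂ = ⊥

/-- Two lattices are isometric if there is an isomorphism of abelian groups between them that
preserves the inner product. -/
def Isometric {F : Type*} [NormedAddCommGroup F] [InnerProductSpace ℝ F]
    (L : Submodule ℤ E) (M : Submodule ℤ F) : Prop :=
  ∃ f : L ≃+ M, ∀ x y : L, ⟪(f x : F), (f y : F)⟫_ℝ = ⟪(x : E), (y : E)⟫_ℝ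

/-- A deep hole of `L` is a point that maximizes the distance to the nearest lattice point. -/
def IsDeepHole (L : Submodule ℤ E) (c : E) : Prop :=
  ∀ z : E, Metric.infDist z (L : Set E) ≤ Metric.infDist c (L : Set E)

/-- The orthogonal group `O(L)` of a lattice `L` of full rank: all linear isometries of the ambient
space that map `L` onto itself. -/
def orthogonalGroup (L : Submodule ℤ E) : Subgroup (E ≃ₗᵢ[ℝ] E) where
  carrier := {f | ∀ x, f x ∈ L ↔ x ∈ L}
  mul_mem' := fun {f g} hf hg x => (hf (g x)).trans (hg x)
  one_mem' := fun _ => Iff.rfl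
  inv_mem' := fun {f} hf x => by
    have h := hf (f.symm x)
    rw [LinearIsometryEquiv.apply_symm_apply] at h
    exact h.symm

/-- The affine isometry group of a lattice `L`: all affine isometries of the ambient space
that map `L` onto itself. -/
def affineIsometryGroup (L : Submodule ℤ E) : Subgroup (E ≃ᵃⁱ[ℝ] E) where
  carrier := {f | ∀ x, f x ∈ L ↔ x ∈ L}
  mul_mem' := fun {f g} hf hg x => (hf (g x)).trans (hg x)
  one_mem' := fun _ => Iff.rfl
  inv_mem' := fun {f} hf x => by
    have h := hf (f.symm x)
    rw [AffineIsometryEquiv.apply_symm_apply] at h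
    exact h.symm

/-- The stabilizer of the point `c` in the affine isometry group of `L`. -/
def affineStabilizer (L : Submodule ℤ E) (c : E) : Subgroup (E ≃ᵃⁱ[ℝ] E) where
  carrier := {f | f ∈ affineIsometryGroup L ∧ f c = c}
  mul_mem' := fun {f g} hf hg =>
    ⟨mul_mem hf.1 hg.1, (congrArg f hg.2).trans hf.2⟩
  one_mem' := ⟨one_mem _, rfl⟩
  inv_mem' := fun {f} hf => ⟨inv_mem hf.1, by
    have h := congrArg f.symm hf.2
    rw [AffineIsometryEquiv.symm_apply_apply] at h
    exact h.symm⟩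

/-- The Weyl group `W(L)`, generated by the reflections in the hyperplanes orthogonal to the
vectors of squared norm `2` of `L`. -/
def weylGroup (L : Submodule ℤ E) : Subgroup (E ≃ₗᵢ[ℝ] E) :=
  Subgroup.closure {f | ∃ r ∈ L, ‖r‖ ^ 2 = 2 ∧ f = (ℝ ∙ r)ᗮ.reflection}

end General

/-- `A_n`: the integer vectors of length `n + 1` with coordinate sum zero. -/
def latticeA (n : ℕ) : Submodule ℤ (EuclideanSpace ℝ (Fin (n + 1))) where
  carrier := {x | (∀ i, ∃ k : ℤ, x i = k) ∧ ∑ i, x i = 0}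
  zero_mem' := ⟨fun _ => ⟨0, by simp⟩, by simp⟩
  add_mem' := by
    rintro x y ⟨hx, hx'⟩ ⟨hy, hy'⟩
    refine ⟨fun i => ?_, by simp [Finset.sum_add_distrib, hx', hy']⟩
    obtain ⟨a, ha⟩ := hx i
    obtain ⟨b, hb⟩ := hy i
    exact ⟨a + b, by simp [ha, hb]⟩
  smul_mem' := by
    rintro m x ⟨hx, hx'⟩
    refine ⟨fun i => ?_, by simp [← Finset.mul_sum, hx']⟩
    obtain ⟨a, ha⟩ := hx i
    exact ⟨m * a, by simp [ha]⟩

/-- `D_n`: the integer vectors of length `n` with even coordinate sum. -/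
def latticeD (n : ℕ) : Submodule ℤ (EuclideanSpace ℝ (Fin n)) where
  carrier := {x | (∀ i, ∃ k : ℤ, x i = k) ∧ ∃ m : ℤ, ∑ i, x i = 2 * m}
  zero_mem' := ⟨fun _ => ⟨0, by simp⟩, 0, by simp⟩
  add_mem' := by
    rintro x y ⟨hx, p, hp⟩ ⟨hy, q, hq⟩
    refine ⟨fun i => ?_, p + q, by simp [Finset.sum_add_distrib, hp, hq, mul_add]⟩
    obtain ⟨a, ha⟩ := hx i
    obtain ⟨b, hb⟩ := hy i
    exact ⟨a + b, by simp [ha, hb]⟩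
  smul_mem' := by
    rintro m x ⟨hx, p, hp⟩
    refine ⟨fun i => ?_, m * p, by simp [← Finset.mul_sum, hp]; ring⟩
    obtain ⟨a, ha⟩ := hx i
    exact ⟨m * a, by simp [ha]⟩

/-- The vector `(1/2, …, 1/2)` of length `8`. -/
def halfOnes : EuclideanSpace ℝ (Fin 8) := WithLp.toLp 2 fun _ => (1 / 2 : ℝ)

lemma two_halfOnes_mem : halfOnes + halfOnes ∈ latticeD 8 :=
  ⟨fun _ => ⟨1, by simp [halfOnes]; norm_num⟩, 4, by simp [halfOnes]; norm_num⟩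

/-- `E_8 = D_8 ∪ ((1/2, …, 1/2) + D_8)`. -/
def latticeE8 : Submodule ℤ (EuclideanSpace ℝ (Fin 8)) where
  carrier := {x | x ∈ latticeD 8 ∨ x - halfOnes ∈ latticeD 8}
  zero_mem' := Or.inl (zero_mem _)
  add_mem' := by
    rintro x y (hx | hx) (hy | hy)
    · exact Or.inl (add_mem hx hy)
    · exact Or.inr (by simpa [add_sub_assoc] using add_mem hx hy)
    · exact Or.inr (by simpa [add_sub_right_comm] using add_mem hx hy)
    · refine Or.inl ?_
      have h := add_mem (add_mem hx hy) two_halfOnes_mem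
      have e : x - halfOnes + (y - halfOnes) + (halfOnes + halfOnes) = x + y := by abel
      rwa [e] at h
  smul_mem' := by
    rintro m x (hx | hx)
    · exact Or.inl (Submodule.smul_mem _ m hx)
    · have h := Submodule.smul_mem _ m hx
      rcases Int.even_or_odd' m with ⟨k, rfl | rfl⟩
      · refine Or.inl ?_
        have h' := add_mem h (Submodule.smul_mem _ k two_halfOnes_mem)
        have e : (2 * k) • (x - halfOnes) + k • (halfOnes + halfOnes) = (2 * k) • x := by
          module
        rwa [e] at h'
      · refine Or.inr ?_
        have h' := add_mem h (Submodule.smul_mem _ k two_halfOnes_mem)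
        have e : (2 * k + 1) • (x - halfOnes) + k • (halfOnes + halfOnes)
            = (2 * k + 1) • x - halfOnes := by
          module
        rwa [e] at h'

/-- `E_7`: the vectors of `E_8` orthogonal to the root `(1/2, …, 1/2)`. -/
def latticeE7 : Submodule ℤ (EuclideanSpace ℝ (Fin 8)) where
  carrier := {x | x ∈ latticeE8 ∧ ∑ i, x i = 0}
  zero_mem' := ⟨zero_mem _, by simp⟩
  add_mem' := fun {x y} hx hy =>
    ⟨add_mem hx.1 hy.1, by simp [Finset.sum_add_distrib, hx.2, hy.2]⟩
  smul_mem' := fun m x hx =>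
    ⟨Submodule.smul_mem _ m hx.1, by simp [← Finset.mul_sum, hx.2]⟩

/-- `E_6`: the vectors of `E_8` orthogonal to the two roots `(1/2, …, 1/2)` and `e_1 + e_8`, which
span a copy of `A_2`. -/
def latticeE6 : Submodule ℤ (EuclideanSpace ℝ (Fin 8)) where
  carrier := {x | x ∈ latticeE7 ∧ x 0 + x 7 = 0}
  zero_mem' := ⟨zero_mem _, by simp⟩
  add_mem' := fun {x y} hx hy =>
    ⟨add_mem hx.1 hy.1, by
      have h : x 0 + x 7 + (y 0 + y 7) = 0 := by rw [hx.2, hy.2, add_zero]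
      simpa using (by linarith : x 0 + y 0 + (x 7 + y 7) = 0)⟩
  smul_mem' := fun m x hx =>
    ⟨Submodule.smul_mem _ m hx.1, by simp [← mul_add, hx.2]⟩

/-- `O'(D_4)`: the group generated by the Weyl group of `D_4` and the sign change of the last
coordinate, that is, the reflection in the hyperplane orthogonal to the last unit vector. -/
def orthogonalGroupD4' : Subgroup (EuclideanSpace ℝ (Fin 4) ≃ₗᵢ[ℝ] EuclideanSpace ℝ (Fin 4)) :=
  weylGroup (latticeD 4) ⊔
    Subgroup.closure {(ℝ ∙ (EuclideanSpace.single 3 1 : EuclideanSpace ℝ (Fin 4)))ᗮ.reflection}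

end RootLattice

end

noncomputable section

open scoped InnerProductSpace

namespace RootLattice

/-! ### Affine stabilizers as stabilizers of a class modulo the lattice -/

section General

variable {E : Type*} [NormedAddCommGroup E] [InnerProductSpace ℝ E]

/-! An affine isometry fixing c is determined by its linear part g, and g occurs exactly when g ∈
O(L) and g c − c ∈ L (`nonempty_affineStabilizer_mulEquiv`). So the group sought is the stabilizer
in O(L) of the class of c modulo L; up to isomorphism it survives translating c by L and moving c by
O(L).

Locating c. Translate so that 0 is a nearest lattice point. Then ⟪c, r⟫ ≤ 1 for all roots r, and
‖c‖² ≥ R as soon as some explicit c₀ has squared distance at least R from L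
(`IsDeepHole.exists_translate`). With the right c₀ few points remain. For A_n and D_n they are found
in coordinates. For E_n the Weyl group first moves c into the fundamental alcove: c = ∑ aᵢωᵢ with
fundamental weights ωᵢ, aᵢ ≥ 0, and pairing ∑ mᵢaᵢ ≤ 1 with the highest root. There R(∑ mᵢaᵢ)² −
‖c‖² has no negative coefficient, which forces c to be a specific vertex.

Computing the stabilizer. Except for E_8, c lies in the dual lattice, so reflections move it by
multiples of roots and W(L) fixes its class (`weylGroup_le_linearStabilizer`). What else fixes it?
A_n, n odd: all deep holes form one class, so everything in O(L) does. A_n, n even: twice the class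
is ± a generator of L*/L. The shortest vectors of that generating class are the vertices of a
simplex, and W(L) realizes all its permutations. D_n, n ≥ 5: O(L) consists of signed permutations,
and a spinor class detects the parity of the sign changes. For D_4, O(L) permutes the three nonzero
classes of L*/L transitively, and the stabilizer of one of them is O'(D_4). E_6, E_7: modulo W(L) an
isometry permutes the simple roots (`IsSimpleSystem.exists_permutes`). The diagram of E_7 has no
symmetry, and that of E_6 has one, which moves the class. E_8: c is equivalent to the last unit
vector e, outside the dual. Its stabilizer permutes the norm-one vectors ±eᵢ of e + E_8, and
preserving E_8 then leaves only W(D_8). -/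

lemma reflection_root_apply {r : E} (hr : ‖r‖ ^ 2 = 2) (x : E) :
    (ℝ ∙ r)ᗮ.reflection x = x - ⟪r, x⟫_ℝ • r := by
  rw [Submodule.reflection_orthogonal_apply, Submodule.reflection_singleton_apply]
  have : ((‖r‖ : ℝ) : ℝ) ^ 2 = 2 := hr
  simp only [RCLike.ofReal_real_eq_id, id_eq, this]
  module

/-- The linear parts of the affine isometries of `L` that fix `c`. -/
def linearStabilizer (L : Submodule ℤ E) (c : E) : Subgroup (E ≃ₗᵢ[ℝ] E) where
  carrier := {g | g ∈ orthogonalGroup L ∧ g c - c ∈ L}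
  mul_mem' := fun {f g} hf hg => ⟨mul_mem hf.1 hg.1, by
    have h := add_mem ((hf.1 _).2 hg.2) hf.2
    rwa [map_sub, sub_add_sub_cancel] at h⟩
  one_mem' := ⟨one_mem _, by simp⟩
  inv_mem' := fun {f} hf => ⟨inv_mem hf.1, by
    have h := neg_mem (((inv_mem hf.1 : f⁻¹ ∈ orthogonalGroup L) _).2 hf.2)
    rw [map_sub, neg_sub] at h
    have e : f⁻¹ (f c) = c := f.symm_apply_apply c
    rwa [e] at h⟩

lemma mem_linearStabilizer {L : Submodule ℤ E} {c : E} {g : E ≃ₗᵢ[ℝ] E} :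
    g ∈ linearStabilizer L c ↔ (∀ x, g x ∈ L ↔ x ∈ L) ∧ g c - c ∈ L := Iff.rfl

lemma affine_apply_eq (f : E ≃ᵃⁱ[ℝ] E) (x y : E) :
    f x = f.linearIsometryEquiv (x - y) + f y := by
  have h := f.map_vadd y (x - y)
  simpa using h

/-- Taking linear parts identifies the stabilizer of `c` with `linearStabilizer L c`. -/
lemma nonempty_affineStabilizer_mulEquiv (L : Submodule ℤ E) (c : E) :
    Nonempty (affineStabilizer L c ≃* linearStabilizer L c) := by
  let F : affineStabilizer L c →* linearStabilizer L c :=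
    { toFun := fun f => ⟨f.1.linearIsometryEquiv, by
        obtain ⟨f, hf, hc⟩ := f
        have hf' : ∀ x, f x ∈ L ↔ x ∈ L := hf
        have h0 : f 0 ∈ L := (hf' 0).2 L.zero_mem
        have key : ∀ x, f x = f.linearIsometryEquiv x + f 0 := fun x => by
          simpa using affine_apply_eq f x 0
        refine ⟨fun x => ?_, ?_⟩
        · rw [← hf' x, key x]
          exact (Submodule.add_mem_iff_left L h0).symm
        · have h := key c
          rw [hc] at h
          have : f.linearIsometryEquiv c - c = - f 0 := by
            nth_rewrite 2 [h]; abel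
          change f.linearIsometryEquiv c - c ∈ L
          rw [this]
          exact L.neg_mem h0⟩
      map_one' := rfl
      map_mul' := fun f g => rfl }
  refine ⟨MulEquiv.ofBijective F ⟨?_, ?_⟩⟩
  · rintro ⟨f, hf⟩ ⟨g, hg⟩ h
    have h' : f.linearIsometryEquiv = g.linearIsometryEquiv := congrArg Subtype.val h
    refine Subtype.ext (AffineIsometryEquiv.ext fun x => ?_)
    change f x = g x
    rw [affine_apply_eq f x c, affine_apply_eq g x c, h', hf.2, hg.2]
  · rintro ⟨g, hg, hc⟩
    -- The unique affine isometry with linear part g fixing c; its translation part c − g c lies in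
    -- L.
    let f : E ≃ᵃⁱ[ℝ] E :=
      g.toAffineIsometryEquiv.trans (AffineIsometryEquiv.constVAdd ℝ E (c - g c))
    have hfx : ∀ x, f x = (c - g c) + g x := fun x => rfl
    refine ⟨⟨f, fun x => ?_, ?_⟩, ?_⟩
    · rw [hfx, ← hg x]
      refine Submodule.add_mem_iff_right L ?_
      rw [← neg_sub]
      exact L.neg_mem hc
    · rw [hfx]; abel
    · refine Subtype.ext (LinearIsometryEquiv.ext fun x => ?_)
      change f.linearIsometryEquiv x = g x
      have := affine_apply_eq f x 0
      rw [hfx, hfx, map_zero, sub_zero] at this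
      rw [add_comm] at this
      simpa using this.symm

/-- Elements of O(L) move the difference c − c' within L, so only the class of c modulo L matters.
-/
lemma linearStabilizer_congr {L : Submodule ℤ E} {c c' : E} (h : c - c' ∈ L) :
    linearStabilizer L c = linearStabilizer L c' := by
  have key : ∀ {a b : E}, a - b ∈ L → linearStabilizer L a ≤ linearStabilizer L b := by
    intro a b hab g hg
    refine ⟨hg.1, ?_⟩
    have h1 := sub_mem (add_mem hg.2 hab) ((hg.1 _).2 hab)
    rw [map_sub] at h1
    convert h1 using 1
    abel
  refine le_antisymm (key h) (key ?_)
  rw [← neg_sub]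
  exact L.neg_mem h

/-! ### Transport of the groups and of deep holes along isometries -/

section Transport

variable {F : Type*} [NormedAddCommGroup F] [InnerProductSpace ℝ F]

/-- Conjugation by a linear isometry. -/
def conjIsometry (φ : E ≃ₗᵢ[ℝ] F) : (E ≃ₗᵢ[ℝ] E) ≃* (F ≃ₗᵢ[ℝ] F) where
  toFun f := φ.symm.trans (f.trans φ)
  invFun f := φ.trans (f.trans φ.symm)
  left_inv f := by ext x; simp
  right_inv f := by ext x; simp
  map_mul' f g := by
    ext x
    change φ (f (g (φ.symm x))) = φ (f (φ.symm (φ (g (φ.symm x)))))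
    rw [LinearIsometryEquiv.symm_apply_apply]

@[simp] lemma conjIsometry_apply (φ : E ≃ₗᵢ[ℝ] F) (f : E ≃ₗᵢ[ℝ] E) (x : F) :
    conjIsometry φ f x = φ (f (φ.symm x)) := rfl

lemma nonempty_mulEquiv_of_conj (φ : E ≃ₗᵢ[ℝ] F) {H : Subgroup (E ≃ₗᵢ[ℝ] E)}
    {K : Subgroup (F ≃ₗᵢ[ℝ] F)} (h : ∀ g, conjIsometry φ g ∈ K ↔ g ∈ H) :
    Nonempty (H ≃* K) := by
  have e : H.map (conjIsometry φ : (E ≃ₗᵢ[ℝ] E) →* (F ≃ₗᵢ[ℝ] F)) = K := by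
    ext k
    constructor
    · rintro ⟨g, hg, rfl⟩
      exact (h g).2 hg
    · intro hk
      refine ⟨(conjIsometry φ).symm k, (h _).1 ?_, ?_⟩
      · simpa using hk
      · simp
  exact ⟨((conjIsometry φ).subgroupMap H).trans (MulEquiv.subgroupCongr e)⟩

variable {L : Submodule ℤ E} {M : Submodule ℤ F}

lemma conj_mem_linearStabilizer_iff (φ : E ≃ₗᵢ[ℝ] F) (h : ∀ x, φ x ∈ M ↔ x ∈ L) (c : E)
    (g : E ≃ₗᵢ[ℝ] E) :
    conjIsometry φ g ∈ linearStabilizer M (φ c) ↔ g ∈ linearStabilizer L c := by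
  rw [mem_linearStabilizer, mem_linearStabilizer]
  refine and_congr ?_ ?_
  · constructor
    · intro H x
      simpa [h] using H (φ x)
    · intro H y
      obtain ⟨x, rfl⟩ := φ.surjective y
      simpa [h] using H x
  · simp [← map_sub, h]

lemma nonempty_linearStabilizer_mulEquiv (φ : E ≃ₗᵢ[ℝ] F) (h : ∀ x, φ x ∈ M ↔ x ∈ L) (c : E) :
    Nonempty (linearStabilizer L c ≃* linearStabilizer M (φ c)) :=
  nonempty_mulEquiv_of_conj φ (conj_mem_linearStabilizer_iff φ h c)

lemma conjIsometry_reflection (φ : E ≃ₗᵢ[ℝ] F) {r : E} (hr : ‖r‖ ^ 2 = 2) :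
    conjIsometry φ (ℝ ∙ r)ᗮ.reflection = (ℝ ∙ φ r)ᗮ.reflection := by
  ext x
  rw [conjIsometry_apply, reflection_root_apply hr, reflection_root_apply (by simpa using hr)]
  rw [map_sub, map_smul, LinearIsometryEquiv.apply_symm_apply]
  congr 2
  rw [← φ.inner_map_map, LinearIsometryEquiv.apply_symm_apply]

lemma nonempty_weylGroup_mulEquiv (φ : E ≃ₗᵢ[ℝ] F) (h : ∀ x, φ x ∈ M ↔ x ∈ L) :
    Nonempty (weylGroup L ≃* weylGroup M) := by
  have e : (weylGroup L).map (conjIsometry φ : (E ≃ₗᵢ[ℝ] E) →* (F ≃ₗᵢ[ℝ] F)) = weylGroup M := by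
    rw [weylGroup, MonoidHom.map_closure, weylGroup]
    congr 1
    ext f
    constructor
    · rintro ⟨_, ⟨r, hr, hr2, rfl⟩, rfl⟩
      exact ⟨φ r, (h r).2 hr, by simpa using hr2, conjIsometry_reflection φ hr2⟩
    · rintro ⟨r, hr, hr2, rfl⟩
      obtain ⟨r, rfl⟩ := φ.surjective r
      rw [LinearIsometryEquiv.norm_map] at hr2
      exact ⟨_, ⟨r, (h r).1 hr, hr2, rfl⟩, conjIsometry_reflection φ hr2⟩
  exact ⟨((conjIsometry φ).subgroupMap _).trans (MulEquiv.subgroupCongr e)⟩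

lemma IsDeepHole.map (φ : E ≃ₗᵢ[ℝ] F) (h : ∀ x, φ x ∈ M ↔ x ∈ L) {c : E}
    (hc : IsDeepHole L c) : IsDeepHole M (φ c) := by
  have hM : (M : Set F) = φ '' (L : Set E) := by
    ext y
    constructor
    · intro hy
      obtain ⟨x, rfl⟩ := φ.surjective y
      exact ⟨x, (h x).1 hy, rfl⟩
    · rintro ⟨x, hx, rfl⟩
      exact (h x).2 hx
  intro z
  obtain ⟨z, rfl⟩ := φ.surjective z
  rw [hM, Metric.infDist_image φ.isometry, Metric.infDist_image φ.isometry]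
  exact hc z

/-- An isometry between a full lattice `L` and `M` extends to the ambient spaces. -/
lemma Isometric.exists_linearIsometry [FiniteDimensional ℝ E] [DiscreteTopology L]
    [IsZLattice ℝ L] (h : Isometric L M) :
    ∃ φ : E →ₗᵢ[ℝ] F, (∀ x, φ x ∈ M ↔ x ∈ L) ∧ ∀ y ∈ M, ∃ x ∈ L, φ x = y := by
  obtain ⟨f, hf⟩ := h
  have : Module.Free ℤ L := ZLattice.module_free ℝ L
  let b := Module.Free.chooseBasis ℤ L
  let B := b.ofZLatticeBasis ℝ L
  let T : E →ₗ[ℝ] F := B.constr ℝ (fun i => (f (b i) : F))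
  have hB : ∀ i, B i = b i := fun i => b.ofZLatticeBasis_apply ℝ L i
  have hTb : ∀ i, T (B i) = f (b i) := fun i => B.constr_basis ℝ _ i
  have hT : ∀ x : L, T x = f x := by
    intro x
    have e : (T.restrictScalars ℤ).comp L.subtype = M.subtype.comp f.toIntLinearEquiv.toLinearMap :=
      b.ext fun i => by simpa [hB] using hTb i
    exact LinearMap.congr_fun e x
  have hin : ∀ x y, ⟪T x, T y⟫_ℝ = ⟪x, y⟫_ℝ := by
    have e : (innerₗ F).compl₁₂ T T = innerₗ E := by
      refine LinearMap.ext_basis B B fun i j => ?_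
      have := hf (b i) (b j)
      rw [← hTb, ← hTb] at this
      simpa [hB] using this
    intro x y
    exact LinearMap.congr_fun (LinearMap.congr_fun e x) y
  -- Only an embedding is obtained: A_n, E_6 and E_7 span proper subspaces of their coordinate
  -- spaces.
  refine ⟨T.isometryOfInner hin, fun x => ⟨fun hx => ?_, fun hx => ?_⟩, fun y hy => ?_⟩
  · have h1 : T (f.symm ⟨_, hx⟩ : L) = T x := by
      rw [hT]; simp
    have := (T.isometryOfInner hin).injective h1
    rw [← this]
    exact (f.symm _).2
  · have := hT ⟨x, hx⟩
    change T x ∈ M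
    rw [this]
    exact (f _).2
  · refine ⟨f.symm ⟨y, hy⟩, (f.symm _).2, ?_⟩
    change T _ = y
    rw [hT]; simp

end Transport

/-! ### Root lattices -/

/-- A root lattice is even: the generators have squared norm 2, and each addition contributes an
even cross term 2⟪x, y⟫. -/
lemma IsRootLattice.exists_norm_sq_eq {L : Submodule ℤ E} (h : IsRootLattice L) {x : E}
    (hx : x ∈ L) : ∃ k : ℤ, ‖x‖ ^ 2 = 2 * k := by
  -- Membership in L is carried along the induction because integrality of the cross term needs it.
  have key : x ∈ L ∧ ∃ k : ℤ, ‖x‖ ^ 2 = 2 * k := by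
    rw [← h.generated] at hx
    induction hx using Submodule.span_induction with
    | mem x hx => exact ⟨hx.1, 1, by simpa using hx.2⟩
    | zero => exact ⟨L.zero_mem, 0, by simp⟩
    | add x y _ _ hx hy =>
      obtain ⟨hx, k, hk⟩ := hx
      obtain ⟨hy, l, hl⟩ := hy
      obtain ⟨m, hm⟩ := h.integral x hx y hy
      refine ⟨add_mem hx hy, k + l + m, ?_⟩
      rw [norm_add_sq_real, hk, hl, hm]; push_cast; ring
    | smul a x _ hx =>
      obtain ⟨hx, k, hk⟩ := hx
      refine ⟨L.smul_mem a hx, a ^ 2 * k, ?_⟩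
      rw [← Int.cast_smul_eq_zsmul ℝ, norm_smul, mul_pow, hk]
      simp; ring
  exact key.2

/-- Evenness makes the roots the shortest nonzero vectors. -/
lemma IsRootLattice.two_le_norm_sq {L : Submodule ℤ E} (h : IsRootLattice L) {x : E}
    (hx : x ∈ L) (h0 : x ≠ 0) : 2 ≤ ‖x‖ ^ 2 := by
  obtain ⟨k, hk⟩ := h.exists_norm_sq_eq hx
  have : 0 < ‖x‖ ^ 2 := by positivity
  rw [hk] at this ⊢
  have hk0 : 0 < k := by
    by_contra hn
    have : (k : ℝ) ≤ 0 := by exact_mod_cast not_lt.1 hn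
    linarith
  have : (1 : ℝ) ≤ k := by exact_mod_cast hk0
  linarith

lemma reflection_root_mem {L : Submodule ℤ E}
    (h : ∀ x ∈ L, ∀ y ∈ L, ∃ k : ℤ, ⟪x, y⟫_ℝ = k) {r : E}
    (hr : r ∈ L) (hr2 : ‖r‖ ^ 2 = 2) : (ℝ ∙ r)ᗮ.reflection ∈ orthogonalGroup L := by
  have key : ∀ x ∈ L, (ℝ ∙ r)ᗮ.reflection x ∈ L := by
    intro x hx
    obtain ⟨k, hk⟩ := h r hr x hx
    rw [reflection_root_apply hr2, hk, Int.cast_smul_eq_zsmul]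
    exact sub_mem hx (L.smul_mem k hr)
  intro x
  refine ⟨fun hx => ?_, key x⟩
  have := key _ hx
  rwa [Submodule.reflection_reflection] at this

lemma reflection_mem_weylGroup {L : Submodule ℤ E} {r : E} (hr : r ∈ L)
    (hr2 : ‖r‖ ^ 2 = 2) : (ℝ ∙ r)ᗮ.reflection ∈ weylGroup L :=
  Subgroup.subset_closure ⟨r, hr, hr2, rfl⟩

lemma weylGroup_le_orthogonalGroup {L : Submodule ℤ E}
    (h : ∀ x ∈ L, ∀ y ∈ L, ∃ k : ℤ, ⟪x, y⟫_ℝ = k) :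
    weylGroup L ≤ orthogonalGroup L := by
  rw [weylGroup, Subgroup.closure_le]
  rintro _ ⟨r, hr, hr2, rfl⟩
  exact reflection_root_mem h hr hr2

/-- The Weyl group acts trivially on the discriminant group. -/
lemma weylGroup_le_linearStabilizer {L : Submodule ℤ E}
    (h : ∀ x ∈ L, ∀ y ∈ L, ∃ k : ℤ, ⟪x, y⟫_ℝ = k)
    {c : E} (hc : ∀ r ∈ L, ∃ k : ℤ, ⟪r, c⟫_ℝ = k) : weylGroup L ≤ linearStabilizer L c := by
  rw [weylGroup, Subgroup.closure_le]
  rintro _ ⟨r, hr, hr2, rfl⟩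
  refine ⟨reflection_root_mem h hr hr2, ?_⟩
  obtain ⟨k, hk⟩ := hc r hr
  rw [reflection_root_apply hr2, hk, Int.cast_smul_eq_zsmul, sub_sub_cancel_left]
  exact L.neg_mem (L.smul_mem k hr)

lemma IsDeepHole.map_orthogonal {L : Submodule ℤ E} {c : E} (hc : IsDeepHole L c)
    {g : E ≃ₗᵢ[ℝ] E} (hg : g ∈ orthogonalGroup L) : IsDeepHole L (g c) :=
  hc.map g hg

/-- Translating a deep hole so that `0` becomes a nearest lattice point. -/
lemma IsDeepHole.exists_translate [FiniteDimensional ℝ E] {L : Submodule ℤ E}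
    [DiscreteTopology L] {c : E}
    (hc : IsDeepHole L c) {c₀ : E} {R : ℝ} (hR : ∀ x ∈ L, R ≤ ‖x - c₀‖ ^ 2) :
    ∃ t ∈ L, R ≤ ‖c - t‖ ^ 2 ∧ ∀ r ∈ L, ‖r‖ ^ 2 = 2 → ⟪c - t, r⟫_ℝ ≤ 1 := by
  have hcl : IsClosed (L : Set E) := by
    have : DiscreteTopology L.toAddSubgroup := ‹DiscreteTopology L›
    exact AddSubgroup.isClosed_of_discrete (H := L.toAddSubgroup)
  obtain ⟨t, ht, hdt⟩ := hcl.exists_infDist_eq_dist ⟨0, L.zero_mem⟩ c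
  obtain ⟨t₀, ht₀, hdt₀⟩ := hcl.exists_infDist_eq_dist ⟨0, L.zero_mem⟩ c₀
  refine ⟨t, ht, ?_, fun r hr hr2 => ?_⟩
  -- A deep hole is at least as far from L as the test point c₀.
  · have h1 := hR t₀ ht₀
    have h2 := hc c₀
    rw [hdt, hdt₀, dist_eq_norm, dist_eq_norm, norm_sub_rev] at h2
    exact h1.trans (pow_le_pow_left₀ (norm_nonneg _) h2 2)
  -- The point t is at least as near to c as t + r. Expanding ‖c − t − r‖² with ‖r‖² = 2 gives the
  -- half-space inequality of the Voronoi cell.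
  · have h1 : Metric.infDist c L ≤ dist c (t + r) :=
      Metric.infDist_le_dist_of_mem (add_mem ht hr)
    rw [hdt, dist_eq_norm, dist_eq_norm, ← sub_sub] at h1
    have h2 := pow_le_pow_left₀ (norm_nonneg _) h1 2
    rw [norm_sub_sq_real (c - t) r, hr2] at h2
    linarith

end General

/-! ### Simple systems: dominance and reduction of O(L) to diagram automorphisms -/

section SimpleRoots

variable {E : Type*} [NormedAddCommGroup E] [InnerProductSpace ℝ E]

/-- `α` is a system of simple roots of `L`, and `ρ` is the sum of the positive roots. -/
structure IsSimpleSystem (L : Submodule ℤ E) {ι : Type*} [Fintype ι] (α : ι → E) (ρ : E) :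
    Prop where
  mem : ∀ i, α i ∈ L
  norm_sq : ∀ i, ‖α i‖ ^ 2 = 2
  inner_nonpos : ∀ i j, i ≠ j → ⟪α i, α j⟫_ℝ ≤ 0
  rho_mem : ρ ∈ L
  inner_rho : ∀ i, ⟪α i, ρ⟫_ℝ = 2
  rho_eq : ∃ c : ι → ℝ, (∀ i, 0 ≤ c i) ∧ ρ = ∑ i, c i • α i
  span : ∀ x ∈ L, ∃ n : ι → ℤ, x = ∑ i, (n i : ℝ) • α i

variable [FiniteDimensional ℝ E] {L : Submodule ℤ E} [DiscreteTopology L]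
  {ι : Type*} [Fintype ι] {α : ι → E} {ρ : E}

/-- Every orbit of the Weyl group meets the closed dominant chamber. -/
lemma exists_weylGroup_dominant (hL : IsRootLattice L) (hmem : ∀ i, α i ∈ L)
    (hnorm : ∀ i, ‖α i‖ ^ 2 = 2) (hρ : ρ ∈ L) (hαρ : ∀ i, 0 < ⟪α i, ρ⟫_ℝ) (z : E) :
    ∃ w ∈ weylGroup L, ∀ i, 0 ≤ ⟪α i, w z⟫_ℝ := by
  have hcl : IsClosed (L : Set E) := by
    have : DiscreteTopology L.toAddSubgroup := ‹DiscreteTopology L›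
    exact AddSubgroup.isClosed_of_discrete (H := L.toAddSubgroup)
  -- The orbit of ρ lies in L and in a ball, hence is finite.
  have hfin : ((fun w : E ≃ₗᵢ[ℝ] E => w ρ) '' (weylGroup L : Set (E ≃ₗᵢ[ℝ] E))).Finite := by
    refine (Metric.finite_isBounded_inter_isClosed (K := Metric.closedBall 0 ‖ρ‖) (s := (L : Set E))
      (isDiscrete_iff_discreteTopology.2 ‹_›) Metric.isBounded_closedBall hcl).subset ?_
    rintro _ ⟨w, hw, rfl⟩
    refine ⟨by simp, ?_⟩
    exact (weylGroup_le_orthogonalGroup hL.integral hw ρ).2 hρ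
  -- Choose w maximizing ⟪z, w ρ⟫. Passing from w to w sᵢ, with sᵢ the reflection in αᵢ, subtracts
  -- ⟪αᵢ, ρ⟫⟪z, w αᵢ⟫, which therefore cannot be negative.
  obtain ⟨_, ⟨w, hw, rfl⟩, hmax⟩ := Set.exists_max_image _ (fun v => ⟪z, v⟫_ℝ) hfin
    ⟨_, 1, one_mem _, rfl⟩
  refine ⟨w⁻¹, inv_mem hw, fun i => ?_⟩
  have h1 := hmax _ ⟨w * (ℝ ∙ α i)ᗮ.reflection,
    mul_mem hw (reflection_mem_weylGroup (hmem i) (hnorm i)), rfl⟩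
  change ⟪z, w ((ℝ ∙ α i)ᗮ.reflection ρ)⟫_ℝ ≤ ⟪z, w ρ⟫_ℝ at h1
  rw [reflection_root_apply (hnorm i), map_sub, map_smul, inner_sub_right,
    inner_smul_right] at h1
  have h2 : ⟪α i, w⁻¹ z⟫_ℝ = ⟪z, w (α i)⟫_ℝ := by
    rw [real_inner_comm, ← w.inner_map_map (w⁻¹ z) (α i)]
    congr 1
    exact w.apply_symm_apply z
  rw [h2]
  have h3 : 0 ≤ ⟪α i, ρ⟫_ℝ * ⟪z, w (α i)⟫_ℝ := by linarith
  exact nonneg_of_mul_nonneg_right h3 (hαρ i)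

omit [FiniteDimensional ℝ E] [DiscreteTopology L] in
/-- Every root is a nonnegative or a nonpositive combination of the simple roots. -/
lemma IsSimpleSystem.exists_nat (hL : IsRootLattice L) (hα : IsSimpleSystem L α ρ) {r : E}
    (hr : r ∈ L) (hr2 : ‖r‖ ^ 2 = 2) :
    (∃ n : ι → ℕ, r = ∑ i, (n i : ℝ) • α i) ∨ ∃ n : ι → ℕ, -r = ∑ i, (n i : ℝ) • α i := by
  obtain ⟨n, hn⟩ := hα.span r hr
  have hmem : ∀ m : ι → ℕ, ∑ i, (m i : ℝ) • α i ∈ L := fun m =>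
    sum_mem fun i _ => by
      have := L.smul_mem (m i : ℤ) (hα.mem i)
      rwa [← Int.cast_smul_eq_zsmul ℝ, Int.cast_natCast] at this
  -- P and N are the positive and negative parts of r. Their supports are disjoint, so ⟪P, N⟫ ≤ 0;
  -- were both nonzero, ‖r‖² = ‖P − N‖² would be at least 2 + 2.
  set P := ∑ i, ((n i).toNat : ℝ) • α i with hP
  set N := ∑ i, ((-n i).toNat : ℝ) • α i with hN
  have hPN : r = P - N := by
    rw [hn, hP, hN, ← Finset.sum_sub_distrib]
    refine Finset.sum_congr rfl fun i _ => ?_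
    rw [← sub_smul]
    congr 1
    have := Int.toNat_sub_toNat_neg (n i)
    exact_mod_cast this.symm
  have hin : ⟪P, N⟫_ℝ ≤ 0 := by
    rw [hP, hN, sum_inner]
    refine Finset.sum_nonpos fun i _ => ?_
    rw [inner_sum]
    refine Finset.sum_nonpos fun j _ => ?_
    rw [inner_smul_left, inner_smul_right]
    by_cases hij : i = j
    · subst hij
      rcases le_total (n i) 0 with h | h
      · simp [Int.toNat_of_nonpos h]
      · simp [Int.toNat_of_nonpos (neg_nonpos.2 h)]
    · exact mul_nonpos_of_nonneg_of_nonpos (by simp)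
        (mul_nonpos_of_nonneg_of_nonpos (by simp) (hα.inner_nonpos i j hij))
  by_cases hP0 : P = 0
  · exact Or.inr ⟨_, by rw [hPN, hP0, zero_sub, neg_neg]⟩
  by_cases hN0 : N = 0
  · exact Or.inl ⟨_, by rw [hPN, hN0, sub_zero]⟩
  have h1 := hL.two_le_norm_sq (hmem _) hP0
  have h2 := hL.two_le_norm_sq (hmem _) hN0
  rw [hPN, norm_sub_sq_real] at hr2
  linarith

omit [FiniteDimensional ℝ E] [DiscreteTopology L] in
lemma IsSimpleSystem.inner_sum_rho (hα : IsSimpleSystem L α ρ) (n : ι → ℕ) :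
    ⟪∑ i, (n i : ℝ) • α i, ρ⟫_ℝ = 2 * (∑ i, n i : ℕ) := by
  rw [sum_inner]
  simp only [inner_smul_left, hα.inner_rho]
  simp [Finset.mul_sum, mul_comm]

omit [FiniteDimensional ℝ E] [DiscreteTopology L] in
/-- The roots of height one are the simple roots. -/
lemma IsSimpleSystem.eq_simple (hL : IsRootLattice L) (hα : IsSimpleSystem L α ρ) {r : E}
    (hr : r ∈ L) (hr2 : ‖r‖ ^ 2 = 2) (hρ : ⟪r, ρ⟫_ℝ = 2) : ∃ j, r = α j := by
  classical
  rcases hα.exists_nat hL hr hr2 with ⟨n, hn⟩ | ⟨n, hn⟩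
  · have h1 := hα.inner_sum_rho n
    rw [← hn, hρ] at h1
    have h2 : ∑ i, n i = 1 := by
      have : ((∑ i, n i : ℕ) : ℝ) = 1 := by linarith
      exact_mod_cast this
    have h3 : ∃ j, n j ≠ 0 := by
      by_contra! h
      simp [h] at h2
    obtain ⟨j, hj⟩ := h3
    have h4 : n j + ∑ i ∈ Finset.univ.erase j, n i = 1 := by
      rw [Finset.add_sum_erase _ _ (Finset.mem_univ j), h2]
    have h5 : ∑ i ∈ Finset.univ.erase j, n i = 0 := by omega
    have h6 : n j = 1 := by omega
    rw [Finset.sum_eq_zero_iff] at h5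
    refine ⟨j, ?_⟩
    rw [hn, Finset.sum_eq_single j]
    · simp [h6]
    · intro i _ hi
      simp [h5 i (by simp [hi])]
    · simp
  · have h1 := hα.inner_sum_rho n
    rw [← hn, inner_neg_left, hρ] at h1
    have : (0 : ℝ) ≤ (∑ i, n i : ℕ) := Nat.cast_nonneg _
    linarith

/-- Modulo the Weyl group every element of `O(L)` permutes the simple roots. -/
lemma IsSimpleSystem.exists_permutes (hL : IsRootLattice L) (hα : IsSimpleSystem L α ρ)
    {g : E ≃ₗᵢ[ℝ] E} (hg : g ∈ orthogonalGroup L) :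
    ∃ w ∈ weylGroup L, ∃ σ : ι → ι, ∀ i, (w * g) (α i) = α (σ i) := by
  obtain ⟨w, hw, hdom⟩ := exists_weylGroup_dominant hL hα.mem hα.norm_sq
    hα.rho_mem (fun i => by rw [hα.inner_rho]; norm_num) (g ρ)
  have hh : w * g ∈ orthogonalGroup L := mul_mem (weylGroup_le_orthogonalGroup hL.integral hw) hg
  set h := w * g with hdef
  have hdom' : ∀ i, 0 ≤ ⟪α i, h ρ⟫_ℝ := hdom
  -- This pairing is twice the height of the root h⁻¹ αᵢ. It is nonnegative by dominance, and a root
  -- has nonzero height, so it is at least 2.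
  have hge : ∀ i, 2 ≤ ⟪α i, h ρ⟫_ℝ := by
    intro i
    have hmem : h.symm (α i) ∈ L := by
      rw [← hh, LinearIsometryEquiv.apply_symm_apply]
      exact hα.mem i
    have e : ⟪α i, h ρ⟫_ℝ = ⟪h.symm (α i), ρ⟫_ℝ := by
      rw [← h.inner_map_map (h.symm (α i)), LinearIsometryEquiv.apply_symm_apply]
    have hn2 : ‖h.symm (α i)‖ ^ 2 = 2 := by rw [LinearIsometryEquiv.norm_map, hα.norm_sq]
    have hne : ∀ n : ι → ℕ, ∑ i, (n i : ℝ) • α i ≠ 0 → 2 ≤ ⟪∑ i, (n i : ℝ) • α i, ρ⟫_ℝ := by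
      intro n hn
      rw [hα.inner_sum_rho]
      have : 1 ≤ ∑ i, n i := by
        by_contra hlt
        have h0 : ∑ i, n i = 0 := by omega
        rw [Finset.sum_eq_zero_iff] at h0
        exact hn (Finset.sum_eq_zero fun i hi => by simp [h0 i hi])
      have : (1 : ℝ) ≤ (∑ i, n i : ℕ) := by exact_mod_cast this
      linarith
    have hn0 : h.symm (α i) ≠ 0 := by
      intro h0
      rw [h0] at hn2
      norm_num at hn2
    have hd := hdom' i
    rw [e] at hd ⊢
    rcases hα.exists_nat hL hmem hn2 with ⟨n, hn⟩ | ⟨n, hn⟩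
    · have := hne n (by rwa [← hn])
      rwa [← hn] at this
    · have := hne n (by rw [← hn]; exact neg_ne_zero.2 hn0)
      rw [← hn, inner_neg_left] at this
      linarith
  -- The difference ν = h ρ − ρ is dominant, so ⟪ρ, ν⟫ ≥ 0 because ρ is a nonnegative combination of
  -- simple roots. Equality of ‖ρ + ν‖ and ‖ρ‖ then forces ν = 0.
  have hfix : h ρ = ρ := by
    set ν := h ρ - ρ with hν
    obtain ⟨c, hc, hcρ⟩ := hα.rho_eq
    have h1 : 0 ≤ ⟪ρ, ν⟫_ℝ := by
      nth_rewrite 1 [hcρ]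
      rw [sum_inner]
      refine Finset.sum_nonneg fun i _ => ?_
      rw [inner_smul_left, hν, inner_sub_right, hα.inner_rho]
      exact mul_nonneg (by simpa using hc i) (by linarith [hge i])
    have h2 : ‖h ρ‖ ^ 2 = ‖ρ‖ ^ 2 := by rw [LinearIsometryEquiv.norm_map]
    have h3 : h ρ = ρ + ν := by rw [hν]; abel
    rw [h3, norm_add_sq_real] at h2
    have h4 : ‖ν‖ = 0 := by
      rw [← sq_eq_zero_iff]
      nlinarith [sq_nonneg ‖ν‖]
    rw [h3, norm_eq_zero.1 h4, add_zero]
  -- Fixing ρ, h preserves heights and so permutes the roots of height one.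
  have hσ : ∀ i, ∃ j, h (α i) = α j := by
    intro i
    refine hα.eq_simple hL ((hh _).2 (hα.mem i)) ?_ ?_
    · rw [LinearIsometryEquiv.norm_map, hα.norm_sq]
    · rw [← hα.inner_rho i]
      nth_rewrite 1 [← hfix]
      rw [LinearIsometryEquiv.inner_map_map]
  choose σ hσ using hσ
  exact ⟨w, hw, σ, hσ⟩

end SimpleRoots

/-! ### Standard coordinates and integral unit vectors -/

section Coordinates

variable {n : ℕ}

/-- The standard unit vectors. -/
abbrev stdVec (i : Fin n) : EuclideanSpace ℝ (Fin n) := EuclideanSpace.single i (1 : ℝ)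

lemma inner_stdVec (i : Fin n) (x : EuclideanSpace ℝ (Fin n)) : ⟪stdVec i, x⟫_ℝ = x i := by
  rw [EuclideanSpace.inner_single_left]
  simp

lemma inner_eq_sum (x y : EuclideanSpace ℝ (Fin n)) : ⟪x, y⟫_ℝ = ∑ i, x i * y i := by
  rw [PiLp.inner_apply]
  exact Finset.sum_congr rfl fun i _ => by simp [mul_comm]

lemma sum_stdVec (i : Fin n) : ∑ j, stdVec i j = (1 : ℝ) := by
  simp [stdVec]

lemma ext_stdVec {f g : EuclideanSpace ℝ (Fin n) ≃ₗᵢ[ℝ] EuclideanSpace ℝ (Fin n)}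
    (h : ∀ i, f (stdVec i) = g (stdVec i)) : f = g := by
  have e : f.toLinearEquiv.toLinearMap = g.toLinearEquiv.toLinearMap :=
    (EuclideanSpace.basisFun (Fin n) ℝ).toBasis.ext fun i => by simpa using h i
  exact LinearIsometryEquiv.ext fun x => LinearMap.congr_fun e x

lemma eq_stdVec_of_norm_one {x : EuclideanSpace ℝ (Fin n)} (hx : ∀ i, ∃ k : ℤ, x i = k)
    (h1 : ‖x‖ = 1) : ∃ j, x = stdVec j ∨ x = -stdVec j := by
  choose k hk using hx
  have hs : ∑ i, k i ^ 2 = 1 := by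
    have := EuclideanSpace.real_norm_sq_eq x
    rw [h1] at this
    simp only [hk] at this
    have h2 : ((∑ i, k i ^ 2 : ℤ) : ℝ) = 1 := by push_cast; linarith
    exact_mod_cast h2
  have hne : ∃ j, k j ≠ 0 := by
    by_contra! h
    simp [h] at hs
  obtain ⟨j, hj⟩ := hne
  rw [← Finset.add_sum_erase _ _ (Finset.mem_univ j)] at hs
  have h3 : 0 ≤ ∑ i ∈ Finset.univ.erase j, k i ^ 2 := Finset.sum_nonneg fun i _ => sq_nonneg _
  have h4 : 0 < k j ^ 2 := by positivity
  have h5 : ∑ i ∈ Finset.univ.erase j, k i ^ 2 = 0 := by omega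
  have h6 : k j ^ 2 = 1 := by omega
  rw [Finset.sum_eq_zero_iff_of_nonneg (fun i _ => sq_nonneg _)] at h5
  have h7 : ∀ i, i ≠ j → x i = 0 := fun i hi => by
    have := h5 i (by simp [hi])
    rw [hk, pow_eq_zero_iff (by norm_num)] at *
    simp [this]
  refine ⟨j, ?_⟩
  rw [sq, mul_self_eq_one_iff] at h6
  refine h6.imp (fun h => ?_) fun h => ?_
  all_goals
    ext i
    by_cases hi : i = j
    · subst hi
      simp [hk, h]
    · simp [hi, h7 i hi]

end Coordinates

lemma reflection_unit_apply {E : Type*} [NormedAddCommGroup E] [InnerProductSpace ℝ E]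
    {r : E} (hr : ‖r‖ ^ 2 = 1) (x : E) :
    (ℝ ∙ r)ᗮ.reflection x = x - (2 * ⟪r, x⟫_ℝ) • r := by
  rw [Submodule.reflection_orthogonal_apply, Submodule.reflection_singleton_apply]
  have : ((‖r‖ : ℝ) : ℝ) ^ 2 = 1 := hr
  simp only [RCLike.ofReal_real_eq_id, id_eq, this]
  module

/-- Orbit–stabilizer without an action: the fibres of f are the left cosets of H. -/
lemma index_eq_ncard_range {G X : Type*} [Group G] (H : Subgroup G) (f : G → X)
    (hf : ∀ a b, f a = f b ↔ a⁻¹ * b ∈ H) : H.index = (Set.range f).ncard := by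
  rw [Subgroup.index, ← Nat.card_coe_set_eq]
  let F : G ⧸ H → Set.range f := Quotient.lift (fun a => ⟨f a, a, rfl⟩) fun a b hab =>
    Subtype.ext ((hf a b).2 (QuotientGroup.leftRel_apply.1 hab))
  refine Nat.card_congr (Equiv.ofBijective F ⟨?_, ?_⟩)
  · intro a b
    induction a using QuotientGroup.induction_on
    induction b using QuotientGroup.induction_on
    intro h
    exact QuotientGroup.eq.2 ((hf _ _).1 (congrArg Subtype.val h))
  · rintro ⟨_, a, rfl⟩
    exact ⟨a, rfl⟩

/-! ### Signed permutations and the Weyl group of D_n -/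

section TypeD

variable {n : ℕ}

lemma mem_latticeD {x : EuclideanSpace ℝ (Fin n)} :
    x ∈ latticeD n ↔ (∀ i, ∃ k : ℤ, x i = k) ∧ ∃ m : ℤ, ∑ i, x i = 2 * m := Iff.rfl

lemma latticeD_integral (x : EuclideanSpace ℝ (Fin n)) (hx : x ∈ latticeD n)
    (y : EuclideanSpace ℝ (Fin n)) (hy : y ∈ latticeD n) : ∃ k : ℤ, ⟪x, y⟫_ℝ = k := by
  choose a ha using hx.1
  choose b hb using hy.1
  refine ⟨∑ i, a i * b i, ?_⟩
  rw [inner_eq_sum]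
  push_cast
  exact Finset.sum_congr rfl fun i _ => by rw [ha, hb]

lemma stdVec_int (i j : Fin n) : ∃ k : ℤ, stdVec i j = (k : ℝ) :=
  ⟨if j = i then 1 else 0, by by_cases h : j = i <;> simp [h]⟩

lemma stdVec_sub_mem (i j : Fin n) : stdVec i - stdVec j ∈ latticeD n := by
  refine ⟨fun l => ?_, 0, ?_⟩
  · obtain ⟨a, ha⟩ := stdVec_int i l
    obtain ⟨b, hb⟩ := stdVec_int j l
    exact ⟨a - b, by rw [PiLp.sub_apply, ha, hb]; push_cast; rfl⟩
  · simp only [PiLp.sub_apply, Finset.sum_sub_distrib, sum_stdVec]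
    simp

lemma two_stdVec_mem (i : Fin n) : stdVec i + stdVec i ∈ latticeD n := by
  refine ⟨fun l => ?_, 1, ?_⟩
  · obtain ⟨a, ha⟩ := stdVec_int i l
    exact ⟨a + a, by rw [PiLp.add_apply, ha]; push_cast; rfl⟩
  · simp only [PiLp.add_apply, Finset.sum_add_distrib, sum_stdVec]
    norm_num

lemma stdVec_add_mem (i j : Fin n) : stdVec i + stdVec j ∈ latticeD n := by
  have := add_mem (stdVec_sub_mem i j) (two_stdVec_mem j)
  convert this using 1
  abel

lemma inner_stdVec_stdVec {i j : Fin n} (h : i ≠ j) : ⟪stdVec i, stdVec j⟫_ℝ = 0 := by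
  rw [inner_stdVec]
  simp [h]

lemma inner_stdVec_self (i : Fin n) : ⟪stdVec i, stdVec i⟫_ℝ = 1 := by
  rw [inner_stdVec]
  simp

lemma norm_stdVec_sub {i j : Fin n} (h : i ≠ j) : ‖stdVec i - stdVec j‖ ^ 2 = 2 := by
  rw [norm_sub_sq_real, inner_stdVec_stdVec h]
  simp; norm_num

lemma norm_stdVec_add {i j : Fin n} (h : i ≠ j) : ‖stdVec i + stdVec j‖ ^ 2 = 2 := by
  rw [norm_add_sq_real, inner_stdVec_stdVec h]
  simp; norm_num

lemma reflection_sub_stdVec {i j : Fin n} (h : i ≠ j) (l : Fin n) :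
    (ℝ ∙ (stdVec i - stdVec j))ᗮ.reflection (stdVec l) = stdVec (Equiv.swap i j l) := by
  rw [reflection_root_apply (norm_stdVec_sub h), inner_sub_left]
  by_cases hi : l = i
  · subst hi
    rw [inner_stdVec_self, inner_stdVec_stdVec h.symm, Equiv.swap_apply_left]
    simp
  by_cases hj : l = j
  · subst hj
    rw [inner_stdVec_self, inner_stdVec_stdVec h, Equiv.swap_apply_right]
    simp
  rw [Equiv.swap_apply_of_ne_of_ne hi hj, inner_stdVec_stdVec (Ne.symm hi),
    inner_stdVec_stdVec (Ne.symm hj)]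
  simp

lemma reflection_add_stdVec {i j : Fin n} (h : i ≠ j) (l : Fin n) :
    (ℝ ∙ (stdVec i + stdVec j))ᗮ.reflection (stdVec l) =
      if l = i ∨ l = j then -stdVec (Equiv.swap i j l) else stdVec l := by
  rw [reflection_root_apply (norm_stdVec_add h), inner_add_left]
  by_cases hi : l = i
  · subst hi
    rw [inner_stdVec_self, inner_stdVec_stdVec h.symm, Equiv.swap_apply_left]
    simp
  by_cases hj : l = j
  · subst hj
    rw [inner_stdVec_self, inner_stdVec_stdVec h, Equiv.swap_apply_right]
    simp
  rw [inner_stdVec_stdVec (Ne.symm hi), inner_stdVec_stdVec (Ne.symm hj)]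
  simp [hi, hj]

/-- Transpositions are the reflections in the roots eᵢ − eⱼ, and they generate all permutations. -/
lemma exists_weylGroup_perm (σ : Equiv.Perm (Fin n)) :
    ∃ w ∈ weylGroup (latticeD n), ∀ i, w (stdVec i) = stdVec (σ i) := by
  induction σ using Equiv.Perm.swap_induction_on with
  | one => exact ⟨1, one_mem _, fun i => rfl⟩
  | swap_mul f x y hxy ih =>
    obtain ⟨w, hw, hwe⟩ := ih
    refine ⟨_ * w, mul_mem (reflection_mem_weylGroup (stdVec_sub_mem x y) (norm_stdVec_sub hxy)) hw,
      fun i => ?_⟩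
    change (ℝ ∙ (stdVec x - stdVec y))ᗮ.reflection (w (stdVec i)) = _
    rw [hwe, reflection_sub_stdVec hxy]
    rfl

/-- Reflecting in e_x + e_y and then in e_x − e_y negates precisely the coordinates x and y; an even
set is exhausted by such pairs. -/
lemma exists_weylGroup_sign (S : Finset (Fin n)) (hS : Even S.card) :
    ∃ w ∈ weylGroup (latticeD n), ∀ i, w (stdVec i) = if i ∈ S then -stdVec i else stdVec i := by
  induction hk : S.card using Nat.strong_induction_on generalizing S with
  | _ k ih =>
    rcases S.eq_empty_or_nonempty with rfl | hne
    · exact ⟨1, one_mem _, fun i => by simp⟩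
    have h1 : 1 < S.card := by
      have := hne.card_pos
      obtain ⟨l, hl⟩ := hS
      omega
    obtain ⟨x, hx, y, hy, hxy⟩ := Finset.one_lt_card.1 h1
    have hy' : y ∈ S.erase x := Finset.mem_erase.2 ⟨hxy.symm, hy⟩
    have hc : ((S.erase x).erase y).card = S.card - 2 := by
      rw [Finset.card_erase_of_mem hy', Finset.card_erase_of_mem hx]
      omega
    obtain ⟨w, hw, hwe⟩ := ih _ (by omega) ((S.erase x).erase y)
      (by rw [hc]; exact (Nat.even_sub (by omega)).2 (by simp [hS])) hc
    refine ⟨_ * _ * w, mul_mem (mul_mem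
      (reflection_mem_weylGroup (stdVec_sub_mem x y) (norm_stdVec_sub hxy))
      (reflection_mem_weylGroup (stdVec_add_mem x y) (norm_stdVec_add hxy))) hw, fun i => ?_⟩
    change (ℝ ∙ (stdVec x - stdVec y))ᗮ.reflection
      ((ℝ ∙ (stdVec x + stdVec y))ᗮ.reflection (w (stdVec i))) = _
    rw [hwe]
    by_cases hix : i = x
    · subst hix
      simp [reflection_add_stdVec hxy, reflection_sub_stdVec hxy, hx]
    by_cases hiy : i = y
    · subst hiy
      simp [reflection_add_stdVec hxy, reflection_sub_stdVec hxy, hy]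
    have hr : (ℝ ∙ (stdVec x - stdVec y))ᗮ.reflection
      ((ℝ ∙ (stdVec x + stdVec y))ᗮ.reflection (stdVec i)) = stdVec i := by
      rw [reflection_add_stdVec hxy, if_neg (by tauto), reflection_sub_stdVec hxy,
        Equiv.swap_apply_of_ne_of_ne hix hiy]
    by_cases hiS : i ∈ S
    · rw [if_pos (by simp [hix, hiy, hiS]), if_pos hiS, map_neg, map_neg, hr]
    · rw [if_neg (by simp [hiS]), if_neg hiS, hr]

/-- All coordinates are `±1/2`. -/
def IsHalfVec (z : EuclideanSpace ℝ (Fin n)) : Prop := ∀ i, z i = 1 / 2 ∨ z i = -(1 / 2)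

/-- Half vectors lie in the dual of D_n: ⟪r, z⟫ is half the even number ∑ rᵢ, minus the integers rᵢ
at the places where z is −1/2. -/
lemma IsHalfVec.inner_int {z : EuclideanSpace ℝ (Fin n)} (hz : IsHalfVec z)
    (r : EuclideanSpace ℝ (Fin n)) (hr : r ∈ latticeD n) : ∃ k : ℤ, ⟪r, z⟫_ℝ = k := by
  obtain ⟨h1, m, hm⟩ := hr
  choose a ha using h1
  refine ⟨m - ∑ i, if z i = 1 / 2 then 0 else a i, ?_⟩
  rw [inner_eq_sum]
  push_cast
  have : (m : ℝ) = ∑ i, r i * (1 / 2) := by rw [← Finset.sum_mul, hm]; ring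
  rw [this, ← Finset.sum_sub_distrib]
  refine Finset.sum_congr rfl fun i _ => ?_
  rcases hz i with h | h
  · rw [if_pos h, h]; ring
  · rw [if_neg (by rw [h]; norm_num), h, ha]; ring

lemma weylGroup_le_of_isHalfVec {z : EuclideanSpace ℝ (Fin n)} (hz : IsHalfVec z) :
    weylGroup (latticeD n) ≤ linearStabilizer (latticeD n) z :=
  weylGroup_le_linearStabilizer latticeD_integral hz.inner_int

/-- A signed permutation that fixes a spinor class lies in the Weyl group of `D_n`. -/
lemma mem_weylGroup_of_signed {z : EuclideanSpace ℝ (Fin n)} (hz : IsHalfVec z)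
    {g : EuclideanSpace ℝ (Fin n) ≃ₗᵢ[ℝ] EuclideanSpace ℝ (Fin n)}
    (hg : ∀ i, ∃ j, g (stdVec i) = stdVec j ∨ g (stdVec i) = -stdVec j)
    (hgz : g z - z ∈ latticeD n) : g ∈ weylGroup (latticeD n) := by
  choose σ hσ using hg
  have hinj : Function.Injective σ := by
    intro i j hij
    by_contra hne
    have h0 : ⟪g (stdVec i), g (stdVec j)⟫_ℝ = 0 := by
      rw [g.inner_map_map, inner_stdVec_stdVec hne]
    rcases hσ i with h | h <;> rcases hσ j with h' | h' <;> rw [h, h', hij] at h0 <;> simp at h0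
  -- Dividing by the underlying permutation, which lies in the Weyl group and fixes the class of z,
  -- leaves a pure sign change f.
  obtain ⟨w, hw, hwe⟩ := exists_weylGroup_perm
    (Equiv.ofBijective σ (Finite.injective_iff_bijective.1 hinj))
  have hwz := weylGroup_le_of_isHalfVec hz (inv_mem hw)
  set f := w⁻¹ * g with hf
  have hfz : f z - z ∈ latticeD n := by
    have h1 := add_mem ((hwz.1 _).2 hgz) hwz.2
    rw [map_sub, sub_add_sub_cancel] at h1
    exact h1
  have hwi : ∀ i, w⁻¹ (stdVec (σ i)) = stdVec i := fun i => by
    have := hwe i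
    rw [Equiv.ofBijective_apply] at this
    rw [← this]
    exact w.symm_apply_apply _
  have hfi : ∀ i, f (stdVec i) = stdVec i ∨ f (stdVec i) = -stdVec i := by
    intro i
    change w⁻¹ (g (stdVec i)) = _ ∨ w⁻¹ (g (stdVec i)) = _
    rcases hσ i with h | h
    · left; rw [h, hwi]
    · right; rw [h, map_neg, hwi]
  classical
  let S : Finset (Fin n) := Finset.univ.filter fun i => f (stdVec i) = -stdVec i
  have hfS : ∀ i, f (stdVec i) = if i ∈ S then -stdVec i else stdVec i := by
    intro i
    by_cases h : i ∈ S
    · rw [if_pos h]; simpa [S] using h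
    · rw [if_neg h]
      exact (hfi i).resolve_right fun h' => h (by simpa [S] using h')
  have hcoord : ∀ i, (f z - z) i = if i ∈ S then -2 * z i else 0 := by
    intro i
    have h1 : f z i = (if i ∈ S then -1 else 1) * z i := by
      have h2 : ⟪f (stdVec i), f z⟫_ℝ = z i := by rw [f.inner_map_map, inner_stdVec]
      rw [hfS] at h2
      by_cases h : i ∈ S
      · rw [if_pos h, inner_neg_left, inner_stdVec] at h2
        rw [if_pos h]; linarith
      · rw [if_neg h, inner_stdVec] at h2
        rw [if_neg h]; linarith
    rw [PiLp.sub_apply, h1]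
    split_ifs <;> ring
  -- f z − z equals −2 zᵢ = ±1 on the flipped set S and 0 elsewhere, so its coordinate sum has the
  -- parity of |S|.
  have hS : Even S.card := by
    obtain ⟨-, m, hm⟩ := hfz
    simp only [hcoord] at hm
    rw [← Finset.sum_filter, Finset.filter_mem_eq_inter, Finset.univ_inter] at hm
    have h3 : ∑ i ∈ S, -2 * z i = ∑ i ∈ S, ((1 : ℝ) - 2 * (if z i = 1 / 2 then 1 else 0 : ℤ)) :=
      Finset.sum_congr rfl fun i _ => by
        rcases hz i with h | h
        · rw [if_pos h, h]; norm_num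
        · rw [if_neg (by rw [h]; norm_num), h]; norm_num
    rw [h3, Finset.sum_sub_distrib, ← Finset.mul_sum, Finset.sum_const, nsmul_eq_mul, mul_one,
      ← Int.cast_sum] at hm
    have h4 : (S.card : ℤ) = 2 * (m + ∑ i ∈ S, if z i = 1 / 2 then 1 else 0) := by
      have : (S.card : ℝ) = 2 * (m + (∑ i ∈ S, if z i = 1 / 2 then 1 else 0 : ℤ)) := by linarith
      exact_mod_cast this
    rw [← Int.even_coe_nat, h4]
    exact even_two_mul _
  obtain ⟨v, hv, hve⟩ := exists_weylGroup_sign S hS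
  have hfv : f = v := ext_stdVec fun i => by rw [hfS, hve]
  have : g = w * v := by rw [← hfv, hf, mul_inv_cancel_left]
  rw [this]
  exact mul_mem hw hv

end TypeD

/-! ### Deep holes of D_n, the dual vectors of norm one, and triality reflections -/

section TypeD

variable {n : ℕ}

lemma inner_stdVec_right (x : EuclideanSpace ℝ (Fin n)) (i : Fin n) : ⟪x, stdVec i⟫_ℝ = x i := by
  rw [real_inner_comm, inner_stdVec]

/-- The vector `(1/2, …, 1/2)`. -/
def halfVec (n : ℕ) : EuclideanSpace ℝ (Fin n) := WithLp.toLp 2 fun _ => (1 / 2 : ℝ)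

lemma halfVec_apply (i : Fin n) : halfVec n i = 1 / 2 := rfl

lemma isHalfVec_halfVec : IsHalfVec (halfVec n) := fun _ => Or.inl rfl

/-- An integer is at distance at least 1/2 from 1/2. This supplies the bound R = n/4 for D_n. -/
lemma norm_sq_sub_halfVec_ge {x : EuclideanSpace ℝ (Fin n)} (hx : x ∈ latticeD n) :
    (n : ℝ) / 4 ≤ ‖x - halfVec n‖ ^ 2 := by
  rw [EuclideanSpace.real_norm_sq_eq]
  have : ∑ _i : Fin n, (1 / 4 : ℝ) ≤ ∑ i, (x - halfVec n) i ^ 2 := by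
    refine Finset.sum_le_sum fun i _ => ?_
    obtain ⟨k, hk⟩ := hx.1 i
    rw [PiLp.sub_apply, hk, halfVec_apply]
    have : 0 ≤ k * (k - 1) := by
      rcases le_or_gt k 0 with h | h <;> nlinarith
    have : (0 : ℝ) ≤ k * (k - 1) := by exact_mod_cast this
    nlinarith
  simp only [Finset.sum_const, Finset.card_univ, Fintype.card_fin, nsmul_eq_mul] at this
  linarith

lemma abs_add_abs_le {z : EuclideanSpace ℝ (Fin n)}
    (hz : ∀ r ∈ latticeD n, ‖r‖ ^ 2 = 2 → ⟪z, r⟫_ℝ ≤ 1) {i j : Fin n} (hij : i ≠ j) :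
    |z i| + |z j| ≤ 1 := by
  have h1 := hz _ (stdVec_sub_mem i j) (norm_stdVec_sub hij)
  have h2 := hz _ (stdVec_sub_mem j i) (norm_stdVec_sub hij.symm)
  have h3 := hz _ (stdVec_add_mem i j) (norm_stdVec_add hij)
  have h4 := hz _ (neg_mem (stdVec_add_mem i j)) (by rw [norm_neg, norm_stdVec_add hij])
  simp only [inner_sub_right, inner_add_right, inner_neg_right, inner_stdVec_right]
    at h1 h2 h3 h4
  rcases abs_cases (z i) with ⟨h, -⟩ | ⟨h, -⟩ <;> rcases abs_cases (z j) with ⟨h', -⟩ | ⟨h', -⟩ <;>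
    rw [h, h'] <;> linarith

/-- The points of maximal norm of the Voronoi cell of `D_n`. -/
lemma isHalfVec_or_of_norm_sq_ge (hn : 4 ≤ n) {z : EuclideanSpace ℝ (Fin n)}
    (hz : ∀ r ∈ latticeD n, ‖r‖ ^ 2 = 2 → ⟪z, r⟫_ℝ ≤ 1) (hR : (n : ℝ) / 4 ≤ ‖z‖ ^ 2) :
    IsHalfVec z ∨ n = 4 ∧ ∃ i, z = stdVec i ∨ z = -stdVec i := by
  have hab := fun {i j : Fin n} (h : i ≠ j) => abs_add_abs_le hz h
  rw [EuclideanSpace.real_norm_sq_eq] at hR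
  -- If no coordinate exceeds 1/2 in absolute value, the squares sum to at most n/4, with equality
  -- only for half vectors. Otherwise one large coordinate forces all others to be small.
  by_cases hle : ∀ i, |z i| ≤ 1 / 2
  · left
    have hq : ∀ i, 0 ≤ 1 / 4 - z i ^ 2 := fun i => by
      have := hle i
      rw [← sq_abs]
      nlinarith [abs_nonneg (z i)]
    have hs : ∑ i, (1 / 4 - z i ^ 2) = 0 := by
      refine le_antisymm ?_ (Finset.sum_nonneg fun i _ => hq i)
      rw [Finset.sum_sub_distrib]
      simp only [Finset.sum_const, Finset.card_univ, Fintype.card_fin, nsmul_eq_mul]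
      linarith
    rw [Finset.sum_eq_zero_iff_of_nonneg fun i _ => hq i] at hs
    intro i
    have h1 := hs i (Finset.mem_univ i)
    have h2 : (z i - 1 / 2) * (z i + 1 / 2) = 0 := by linarith
    rcases mul_eq_zero.1 h2 with h | h
    · left; linarith
    · right; linarith
  · right
    push Not at hle
    obtain ⟨i, hi⟩ := hle
    have hle1 : |z i| ≤ 1 := by
      have : Nontrivial (Fin n) := Fin.nontrivial_iff_two_le.2 (by omega)
      obtain ⟨j, hj⟩ := exists_ne i
      linarith [hab hj, abs_nonneg (z j)]
    rw [← Finset.add_sum_erase _ _ (Finset.mem_univ i)] at hR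
    have hs : ∑ j ∈ Finset.univ.erase i, z j ^ 2 ≤
        ∑ _j ∈ Finset.univ.erase i, (1 - |z i|) ^ 2 := by
      refine Finset.sum_le_sum fun j hj => ?_
      rw [← sq_abs]
      exact pow_le_pow_left₀ (abs_nonneg _) (by linarith [hab (Finset.ne_of_mem_erase hj)]) 2
    rw [Finset.sum_const, nsmul_eq_mul, Finset.card_erase_of_mem (Finset.mem_univ i),
      Finset.card_univ, Fintype.card_fin, Nat.cast_sub (by omega), Nat.cast_one] at hs
    have hn' : (4 : ℝ) ≤ n := by exact_mod_cast hn
    rw [← sq_abs] at hR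
    set a := |z i| with ha
    -- With t = a − 1/2 the bound a² + (n − 1)(1 − a)² ≥ n/4 reads t(nt − (n − 2)) ≥ 0. As 0 < t ≤
    -- 1/2, this forces n ≤ 4, and then a = 1.
    have hkey : 0 ≤ (a - 1 / 2) * (n * (a - 1 / 2) - (n - 2)) := by nlinarith
    have h2 : (n : ℝ) - 2 ≤ n * (a - 1 / 2) := by
      by_contra hlt
      push Not at hlt
      nlinarith [mul_pos (sub_pos.2 hi) (sub_pos.2 hlt)]
    have hn4 : (n : ℝ) ≤ 4 := by nlinarith
    have hn4' : n = 4 := le_antisymm (by exact_mod_cast hn4) hn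
    have ha1 : a = 1 := by
      have : (n : ℝ) = 4 := by exact_mod_cast hn4'
      rw [this] at h2
      linarith
    refine ⟨hn4', i, ?_⟩
    have h0 : ∀ j, j ≠ i → z j = 0 := fun j hj => by
      have := hab hj
      rw [← ha, ha1] at this
      exact abs_eq_zero.1 (le_antisymm (by linarith) (abs_nonneg _))
    refine ((abs_eq zero_le_one).1 ha1).imp (fun h => ?_) fun h => ?_
    all_goals
      ext j
      by_cases hj : j = i
      · subst hj
        simp [h]
      · simp [hj, h0 j hj]

/-- Vectors of norm one in the dual lattice of `D_n`. -/
lemma eq_stdVec_or_isHalfVec (hn : 4 ≤ n) {v : EuclideanSpace ℝ (Fin n)}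
    (hv : ∀ r ∈ latticeD n, ∃ k : ℤ, ⟪r, v⟫_ℝ = k) (h1 : ‖v‖ = 1) :
    (∃ j, v = stdVec j ∨ v = -stdVec j) ∨ n = 4 ∧ IsHalfVec v := by
  by_cases hint : ∀ i, ∃ k : ℤ, v i = k
  · exact Or.inl (eq_stdVec_of_norm_one hint h1)
  right
  push Not at hint
  obtain ⟨i, hi⟩ := hint
  -- Pairing with 2eᵢ and with eⱼ − eᵢ shows that one nonintegral coordinate makes all of them
  -- half-odd. Each square is then at least 1/4, so norm one allows only n = 4.
  have hodd : ∀ j, ∃ k : ℤ, v j = k + 1 / 2 := by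
    obtain ⟨k, hk⟩ := hv _ (stdVec_add_mem i i)
    rw [inner_add_left, inner_stdVec] at hk
    have hodd : ∃ l : ℤ, v i = l + 1 / 2 := by
      rcases Int.even_or_odd' k with ⟨l, rfl | rfl⟩
      · exact absurd (by push_cast at hk; linarith) (hi l)
      · exact ⟨l, by push_cast at hk; linarith⟩
    obtain ⟨l, hl⟩ := hodd
    intro j
    obtain ⟨m, hm⟩ := hv _ (stdVec_sub_mem j i)
    rw [inner_sub_left, inner_stdVec, inner_stdVec] at hm
    exact ⟨m + l, by push_cast; linarith⟩
  have hq : ∀ j, 0 ≤ v j ^ 2 - 1 / 4 := fun j => by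
    obtain ⟨k, hk⟩ := hodd j
    have : 0 ≤ k * (k + 1) := by
      rcases le_or_gt 0 k with h | h <;> nlinarith
    have : (0 : ℝ) ≤ k * (k + 1) := by exact_mod_cast this
    rw [hk]
    nlinarith
  have hs : ∑ j, (v j ^ 2 - 1 / 4) = 1 - (n : ℝ) / 4 := by
    rw [Finset.sum_sub_distrib, ← EuclideanSpace.real_norm_sq_eq, h1]
    simp only [Finset.sum_const, Finset.card_univ, Fintype.card_fin, nsmul_eq_mul]
    ring
  have hn' : (4 : ℝ) ≤ n := by exact_mod_cast hn
  have hs0 := Finset.sum_nonneg fun j (_ : j ∈ Finset.univ) => hq j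
  have hn4 : (n : ℝ) = 4 := by linarith
  refine ⟨by exact_mod_cast hn4, fun j => ?_⟩
  rw [hn4, div_self (by norm_num), sub_self, Finset.sum_eq_zero_iff_of_nonneg fun j _ => hq j] at hs
  have h2 := hs j (Finset.mem_univ j)
  have h3 : (v j - 1 / 2) * (v j + 1 / 2) = 0 := by linarith
  rcases mul_eq_zero.1 h3 with h | h
  · left; linarith
  · right; linarith

lemma inner_apply_int {E : Type*} [NormedAddCommGroup E] [InnerProductSpace ℝ E]
    {L : Submodule ℤ E} {g : E ≃ₗᵢ[ℝ] E} (hg : g ∈ orthogonalGroup L) {v : E}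
    (hv : ∀ r ∈ L, ∃ k : ℤ, ⟪r, v⟫_ℝ = k) (r : E) (hr : r ∈ L) : ∃ k : ℤ, ⟪r, g v⟫_ℝ = k := by
  obtain ⟨k, hk⟩ := hv (g.symm r) ((hg _).1 (by rwa [LinearIsometryEquiv.apply_symm_apply]))
  exact ⟨k, by rw [← hk, ← g.inner_map_map (g.symm r), LinearIsometryEquiv.apply_symm_apply]⟩

lemma inner_stdVec_int (i : Fin n) (r : EuclideanSpace ℝ (Fin n)) (hr : r ∈ latticeD n) :
    ∃ k : ℤ, ⟪r, stdVec i⟫_ℝ = k := by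
  rw [inner_stdVec_right]
  exact hr.1 i

/-- For n ≥ 5 the only norm-one vectors of the dual are ±eⱼ. Isometries preserve the dual, so they
are signed permutations, to which `mem_weylGroup_of_signed` applies. -/
lemma linearStabilizer_latticeD_eq (hn : 5 ≤ n) {z : EuclideanSpace ℝ (Fin n)}
    (hz : IsHalfVec z) : linearStabilizer (latticeD n) z = weylGroup (latticeD n) := by
  refine le_antisymm (fun g hg => mem_weylGroup_of_signed hz (fun i => ?_) hg.2)
    (weylGroup_le_of_isHalfVec hz)
  rcases eq_stdVec_or_isHalfVec (by omega) (inner_apply_int hg.1 (inner_stdVec_int i))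
    (by simp) with h | h
  · exact h
  · omega

/-- The classes of `c` and `-c` have the same stabilizer. -/
lemma linearStabilizer_neg {E : Type*} [NormedAddCommGroup E] [InnerProductSpace ℝ E]
    (L : Submodule ℤ E) (c : E) : linearStabilizer L (-c) = linearStabilizer L c := by
  ext g
  rw [mem_linearStabilizer, mem_linearStabilizer, map_neg, ← neg_add', ← sub_eq_add_neg, neg_mem_iff]

lemma norm_isHalfVec {v : EuclideanSpace ℝ (Fin 4)} (hv : IsHalfVec v) : ‖v‖ ^ 2 = 1 := by
  rw [EuclideanSpace.real_norm_sq_eq]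
  have : ∀ i, v i ^ 2 = 1 / 4 := fun i => by
    rcases hv i with h | h <;> rw [h] <;> norm_num
  simp only [this]
  norm_num

/-- Here ⟪v, x⟫ is an integer and 2v ∈ D_4, so x − 2⟪v, x⟫v stays in D_4. These triality reflections
move the vector class to a spinor class, which no signed permutation does. -/
lemma reflection_isHalfVec_mem {v : EuclideanSpace ℝ (Fin 4)} (hv : IsHalfVec v) :
    (ℝ ∙ v)ᗮ.reflection ∈ orthogonalGroup (latticeD 4) := by
  have h1 := norm_isHalfVec hv
  have hodd : ∀ i, ∃ a : ℤ, v i = a + 1 / 2 := fun i => by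
    rcases hv i with h | h
    · exact ⟨0, by rw [h]; norm_num⟩
    · exact ⟨-1, by rw [h]; norm_num⟩
  choose a ha using hodd
  have hvv : v + v ∈ latticeD 4 := by
    refine ⟨fun i => ⟨2 * a i + 1, ?_⟩, ∑ i, a i + 2, ?_⟩
    · rw [PiLp.add_apply, ha]; push_cast; ring
    · simp only [PiLp.add_apply, ha, Fin.sum_univ_four]; push_cast; ring
  have key : ∀ x ∈ latticeD 4, (ℝ ∙ v)ᗮ.reflection x ∈ latticeD 4 := by
    intro x hx
    obtain ⟨k, hk⟩ := hv.inner_int x hx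
    rw [reflection_unit_apply h1, real_inner_comm, hk]
    have e : (2 * (k : ℝ)) • v = k • (v + v) := by
      rw [← Int.cast_smul_eq_zsmul ℝ]
      module
    rw [e]
    exact sub_mem hx ((latticeD 4).smul_mem k hvv)
  intro x
  refine ⟨fun hx => ?_, key x⟩
  have := key _ hx
  rwa [Submodule.reflection_reflection] at this

/-- Up to sign, a half vector is the image of a unit vector under an isometry of `D_4`. -/
lemma exists_map_stdVec {z : EuclideanSpace ℝ (Fin 4)} (hz : IsHalfVec z) :
    ∃ g ∈ orthogonalGroup (latticeD 4), g (stdVec 3) = z ∨ g (stdVec 3) = -z := by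
  have key : ∀ z : EuclideanSpace ℝ (Fin 4), IsHalfVec z → z 3 = 1 / 2 →
      ∃ g ∈ orthogonalGroup (latticeD 4), g (stdVec 3) = z := by
    intro z hz h3
    -- Both e₃ and z are unit vectors, so the reflection in their difference exchanges them; z₃ =
    -- 1/2 makes the difference a half vector.
    have hv : IsHalfVec (stdVec 3 - z) := fun i => by
      by_cases hi : i = 3
      · subst hi
        left; rw [PiLp.sub_apply, h3]; simp; norm_num
      · rw [PiLp.sub_apply]
        simpa [hi, neg_eq_iff_eq_neg, or_comm] using hz i
    refine ⟨_, reflection_isHalfVec_mem hv, ?_⟩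
    rw [reflection_unit_apply (norm_isHalfVec hv), inner_sub_left, inner_stdVec_self,
      inner_stdVec_right, h3]
    module
  rcases hz 3 with h | h
  · obtain ⟨g, hg, hgz⟩ := key z hz h
    exact ⟨g, hg, Or.inl hgz⟩
  · obtain ⟨g, hg, hgz⟩ := key (-z) (fun i => by
      simpa [neg_eq_iff_eq_neg, or_comm] using hz i) (by simp [h])
    exact ⟨g, hg, Or.inr hgz⟩

end TypeD

/-! ### The group O'(D_4), its indices, and the stabilizers in type D -/

section TypeD

variable {n : ℕ}

lemma mem_latticeD_iff_even {x : EuclideanSpace ℝ (Fin n)} (hx : ∀ i, ∃ k : ℤ, x i = k) {m : ℤ}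
    (hm : ∑ i, x i = m) : x ∈ latticeD n ↔ Even m := by
  rw [mem_latticeD, hm]
  constructor
  · rintro ⟨-, k, hk⟩
    have : m = 2 * k := by exact_mod_cast hk
    exact this ▸ even_two_mul k
  · rintro ⟨k, hk⟩
    exact ⟨hx, k, by rw [hk]; push_cast; ring⟩

lemma exists_sum_int {x : EuclideanSpace ℝ (Fin n)} (hx : ∀ i, ∃ k : ℤ, x i = k) :
    ∃ m : ℤ, ∑ i, x i = m := by
  choose k hk using hx
  exact ⟨∑ i, k i, by push_cast; exact Finset.sum_congr rfl fun i _ => hk i⟩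

/-- An isometry that fixes the vector class of `D_n` is a signed permutation. -/
lemma exists_signed {k : Fin n} {g : EuclideanSpace ℝ (Fin n) ≃ₗᵢ[ℝ] EuclideanSpace ℝ (Fin n)}
    (hg : g ∈ linearStabilizer (latticeD n) (stdVec k)) (i : Fin n) :
    ∃ j, g (stdVec i) = stdVec j ∨ g (stdVec i) = -stdVec j := by
  refine eq_stdVec_of_norm_one (fun l => ?_) (by simp)
  have h := add_mem ((hg.1 _).2 (stdVec_sub_mem i k)) hg.2
  rw [map_sub, sub_add_sub_cancel] at h
  obtain ⟨a, ha⟩ := h.1 l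
  obtain ⟨b, hb⟩ := stdVec_int k l
  exact ⟨a + b, by rw [PiLp.sub_apply] at ha; push_cast; linarith⟩

lemma int_sub_of_isHalfVec {z z' : EuclideanSpace ℝ (Fin n)} (hz : IsHalfVec z)
    (hz' : IsHalfVec z') (i : Fin n) : ∃ k : ℤ, (z - z') i = k := by
  rw [PiLp.sub_apply]
  rcases hz i with h | h <;> rcases hz' i with h' | h' <;> rw [h, h']
  · exact ⟨0, by norm_num⟩
  · exact ⟨1, by norm_num⟩
  · exact ⟨-1, by norm_num⟩
  · exact ⟨0, by norm_num⟩

lemma isHalfVec_map {z : EuclideanSpace ℝ (Fin n)} (hz : IsHalfVec z)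
    {g : EuclideanSpace ℝ (Fin n) ≃ₗᵢ[ℝ] EuclideanSpace ℝ (Fin n)}
    (hg : ∀ i, ∃ j, g.symm (stdVec i) = stdVec j ∨ g.symm (stdVec i) = -stdVec j) :
    IsHalfVec (g z) := by
  intro i
  have e : g z i = ⟪g.symm (stdVec i), z⟫_ℝ := by
    rw [← g.inner_map_map, LinearIsometryEquiv.apply_symm_apply, inner_stdVec]
  rw [e]
  obtain ⟨j, h | h⟩ := hg i
  · rw [h, inner_stdVec]; exact hz j
  · rw [h, inner_neg_left, inner_stdVec]
    rcases hz j with h' | h' <;> rw [h']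
    · right; rfl
    · left; norm_num

/-- The sign change of the last coordinate. -/
abbrev signChange : EuclideanSpace ℝ (Fin 4) ≃ₗᵢ[ℝ] EuclideanSpace ℝ (Fin 4) :=
  (ℝ ∙ (stdVec 3 : EuclideanSpace ℝ (Fin 4)))ᗮ.reflection

lemma signChange_apply (x : EuclideanSpace ℝ (Fin 4)) :
    signChange x = x - (2 * x 3) • stdVec 3 := by
  rw [signChange, reflection_unit_apply (by simp), inner_stdVec]

lemma signChange_mem : signChange ∈ linearStabilizer (latticeD 4) (stdVec 3) := by
  have hsmul : ∀ k : ℤ, (2 * (k : ℝ)) • (stdVec 3 : EuclideanSpace ℝ (Fin 4)) ∈ latticeD 4 := by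
    intro k
    have := (latticeD 4).smul_mem k (two_stdVec_mem 3)
    rw [← Int.cast_smul_eq_zsmul ℝ] at this
    convert this using 1
    module
  have key : ∀ x ∈ latticeD 4, signChange x ∈ latticeD 4 := by
    intro x hx
    obtain ⟨k, hk⟩ := hx.1 3
    rw [signChange_apply, hk]
    exact sub_mem hx (hsmul k)
  refine ⟨fun x => ⟨fun hx => ?_, key x⟩, ?_⟩
  · have := key _ hx
    rwa [Submodule.reflection_reflection] at this
  · rw [signChange_apply, sub_sub_cancel_left]
    have := neg_mem (hsmul 1)
    simpa using this

lemma mem_weylGroup_latticeD_four_iff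
    {g : EuclideanSpace ℝ (Fin 4) ≃ₗᵢ[ℝ] EuclideanSpace ℝ (Fin 4)}
    (hg : g ∈ linearStabilizer (latticeD 4) (stdVec 3)) :
    g ∈ weylGroup (latticeD 4) ↔ g (halfVec 4) - halfVec 4 ∈ latticeD 4 :=
  ⟨fun h => (weylGroup_le_of_isHalfVec isHalfVec_halfVec h).2,
    mem_weylGroup_of_signed isHalfVec_halfVec (exists_signed hg)⟩

/-- The sign change sends the all-halves vector h to h − e₃, so composing with it changes g h − h by
g e₃ = ±eⱼ. This flips the parity of the coordinate sum, which decides membership in the Weyl group.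
-/
lemma xor_mem_weylGroup {g : EuclideanSpace ℝ (Fin 4) ≃ₗᵢ[ℝ] EuclideanSpace ℝ (Fin 4)}
    (hg : g ∈ linearStabilizer (latticeD 4) (stdVec 3)) :
    Xor (g * signChange ∈ weylGroup (latticeD 4)) (g ∈ weylGroup (latticeD 4)) := by
  rw [mem_weylGroup_latticeD_four_iff hg, mem_weylGroup_latticeD_four_iff (mul_mem hg signChange_mem)]
  have e : (g * signChange) (halfVec 4) - halfVec 4 = g (halfVec 4) - halfVec 4 - g (stdVec 3) := by
    change g (signChange (halfVec 4)) - _ = _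
    rw [signChange_apply, halfVec_apply, map_sub, mul_one_div_cancel two_ne_zero, one_smul]
    abel
  have hint := int_sub_of_isHalfVec (isHalfVec_map isHalfVec_halfVec
    (fun i => exists_signed (inv_mem hg) i)) isHalfVec_halfVec (z := g (halfVec 4))
  obtain ⟨m, hm⟩ := exists_sum_int hint
  have h3 : ∃ l : ℤ, Odd l ∧ ∑ i, g (stdVec 3) i = l ∧ ∀ i, ∃ k : ℤ, g (stdVec 3) i = k := by
    obtain ⟨j, h | h⟩ := exists_signed hg 3
    · exact ⟨1, odd_one, by rw [h, sum_stdVec]; simp, fun i => by rw [h]; exact stdVec_int j i⟩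
    · refine ⟨-1, by decide, ?_, fun i => ?_⟩
      · rw [h]
        simp only [PiLp.neg_apply, Finset.sum_neg_distrib, sum_stdVec]
        simp
      · obtain ⟨k, hk⟩ := stdVec_int j i
        exact ⟨-k, by rw [h, PiLp.neg_apply, hk]; simp⟩
  obtain ⟨l, hlo, hl, hlint⟩ := h3
  have hint' : ∀ i, ∃ k : ℤ, (g (halfVec 4) - halfVec 4 - g (stdVec 3)) i = k := fun i => by
    obtain ⟨a, ha⟩ := hint i
    obtain ⟨b, hb⟩ := hlint i
    exact ⟨a - b, by rw [PiLp.sub_apply, ha, hb]; simp⟩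
  have hm' : ∑ i, (g (halfVec 4) - halfVec 4 - g (stdVec 3)) i = ((m - l : ℤ) : ℝ) := by
    have : ∀ i, (g (halfVec 4) - halfVec 4 - g (stdVec 3)) i =
      (g (halfVec 4) - halfVec 4) i - g (stdVec 3) i := fun i => rfl
    simp only [this]
    rw [Finset.sum_sub_distrib, hm, hl]
    push_cast; rfl
  rw [e, mem_latticeD_iff_even hint hm, mem_latticeD_iff_even hint' hm']
  rw [Int.even_sub, ← Int.not_odd_iff_even (n := l)]
  simp only [Xor, hlo]
  tauto

lemma weylGroup_le_stabilizer_stdVec (i : Fin n) :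
    weylGroup (latticeD n) ≤ linearStabilizer (latticeD n) (stdVec i) :=
  weylGroup_le_linearStabilizer latticeD_integral (inner_stdVec_int i)

/-- The group given by generators is recognized as the stabilizer of the vector class: any g fixing
that class lies in the Weyl group either itself or after one sign change. -/
lemma orthogonalGroupD4'_eq : orthogonalGroupD4' = linearStabilizer (latticeD 4) (stdVec 3) := by
  have hW : weylGroup (latticeD 4) ≤ orthogonalGroupD4' := le_sup_left
  have ha : signChange ∈ orthogonalGroupD4' :=
    (le_sup_right : _ ≤ orthogonalGroupD4') (Subgroup.subset_closure rfl)
  refine le_antisymm (sup_le (weylGroup_le_stabilizer_stdVec 3) ?_) fun g hg => ?_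
  · rw [Subgroup.closure_le]
    rintro _ rfl
    exact signChange_mem
  · rcases (xor_mem_weylGroup hg).or with h | h
    · have : g = g * signChange * signChange⁻¹ := by group
      rw [this]
      exact mul_mem (hW h) (inv_mem ha)
    · exact hW h

lemma relIndex_weylGroup_D4 : (weylGroup (latticeD 4)).relIndex orthogonalGroupD4' = 2 := by
  rw [orthogonalGroupD4'_eq, Subgroup.relIndex, Subgroup.index_eq_two_iff]
  exact ⟨⟨signChange, signChange_mem⟩, fun ⟨g, hg⟩ => xor_mem_weylGroup hg⟩

/-- O'(D_4) is a stabilizer, so its index is the size of the orbit of the vector class. That orbit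
consists of the vector class and the two spinor classes. -/
lemma relIndex_orthogonalGroupD4' :
    orthogonalGroupD4'.relIndex (orthogonalGroup (latticeD 4)) = 3 := by
  rw [orthogonalGroupD4'_eq, Subgroup.relIndex]
  let q : EuclideanSpace ℝ (Fin 4) → EuclideanSpace ℝ (Fin 4) ⧸ latticeD 4 :=
    fun x => Submodule.Quotient.mk x
  have hq : ∀ x y, q x = q y ↔ x - y ∈ latticeD 4 := fun x y => Submodule.Quotient.eq _
  rw [index_eq_ncard_range _ (fun g : orthogonalGroup (latticeD 4) => q (g.1 (stdVec 3)))]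
  swap
  · rintro ⟨a, ha⟩ ⟨b, hb⟩
    rw [hq, Subgroup.mem_subgroupOf]
    have e : ((⟨a, ha⟩ : orthogonalGroup (latticeD 4))⁻¹ * ⟨b, hb⟩).1 = a⁻¹ * b := rfl
    rw [e]
    have h1 : a (stdVec 3) - b (stdVec 3) ∈ latticeD 4 ↔
        (a⁻¹ * b) (stdVec 3) - stdVec 3 ∈ latticeD 4 := by
      rw [← ha ((a⁻¹ * b) (stdVec 3) - stdVec 3), map_sub, ← neg_sub, neg_mem_iff]
      have : a ((a⁻¹ * b) (stdVec 3)) = b (stdVec 3) := a.apply_symm_apply _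
      rw [this]
    exact h1.trans ⟨fun h => ⟨mul_mem (inv_mem ha) hb, h⟩, fun h => h.2⟩
  have hs := isHalfVec_halfVec (n := 4)
  have hs' : IsHalfVec (halfVec 4 - stdVec 3) := fun i => by
    rw [PiLp.sub_apply, halfVec_apply]
    by_cases hi : i = 3
    · subst hi; right; simp; norm_num
    · left; simp [hi]
  -- Two half vectors differ by an integer vector, so the parity of its coordinate sum leaves just
  -- two classes.
  have hhalf : ∀ z : EuclideanSpace ℝ (Fin 4), IsHalfVec z →
      q z = q (halfVec 4) ∨ q z = q (halfVec 4 - stdVec 3) := by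
    intro z hz
    obtain ⟨m, hm⟩ := exists_sum_int (int_sub_of_isHalfVec hz hs)
    have hm' : ∑ i : Fin 4, (z - (halfVec 4 - stdVec 3) : EuclideanSpace ℝ (Fin 4)) i = ((m + 1 : ℤ) : ℝ) := by
      have : ∀ i : Fin 4, (z - (halfVec 4 - stdVec 3) : EuclideanSpace ℝ (Fin 4)) i =
          (z - halfVec 4) i + stdVec (3 : Fin 4) i := fun i => by
        simp; ring
      simp only [this]
      rw [Finset.sum_add_distrib, hm, sum_stdVec]
      push_cast; rfl
    rw [hq, hq, mem_latticeD_iff_even (int_sub_of_isHalfVec hz hs) hm,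
      mem_latticeD_iff_even (int_sub_of_isHalfVec hz hs') hm']
    exact (Int.even_or_odd m).imp_right fun h => h.add_one
  have hneg : ∀ z : EuclideanSpace ℝ (Fin 4), IsHalfVec z → q (-z) = q z := by
    intro z hz
    have hz' : IsHalfVec (-z) := fun i => by
      simpa [neg_eq_iff_eq_neg, or_comm] using hz i
    rw [hq, ← neg_mem_iff, neg_sub, sub_neg_eq_add]
    refine ⟨fun i => by simpa using int_sub_of_isHalfVec hz hz' i, ?_⟩
    have : ∀ i, ∃ k : ℤ, z i = k + 1 / 2 := fun i => by
      rcases hz i with h | h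
      · exact ⟨0, by rw [h]; norm_num⟩
      · exact ⟨-1, by rw [h]; norm_num⟩
    choose k hk using this
    refine ⟨∑ i, k i + 2, ?_⟩
    simp only [PiLp.add_apply, hk, Fin.sum_univ_four]
    push_cast; ring
  have hrange : Set.range (fun g : orthogonalGroup (latticeD 4) => q (g.1 (stdVec 3))) =
      {q (stdVec 3), q (halfVec 4), q (halfVec 4 - stdVec 3)} := by
    ext y
    constructor
    · rintro ⟨⟨g, hg⟩, rfl⟩
      change q (g (stdVec 3)) ∈ _
      rcases eq_stdVec_or_isHalfVec le_rfl (inner_apply_int hg (inner_stdVec_int 3)) (by simp)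
        with ⟨j, h | h⟩ | ⟨-, h⟩
      · left
        rw [h, hq]; exact stdVec_sub_mem j 3
      · left
        rw [h, hq, ← neg_add']; exact neg_mem (stdVec_add_mem j 3)
      · right; exact hhalf _ h
    -- The triality reflections reach both spinor classes; the sign left open by `exists_map_stdVec`
    -- is harmless since z and −z are congruent.
    · have hz : ∀ z : EuclideanSpace ℝ (Fin 4), IsHalfVec z →
          q z ∈ Set.range (fun g : orthogonalGroup (latticeD 4) => q (g.1 (stdVec 3))) := by
        intro z hz
        obtain ⟨g, hg, h | h⟩ := exists_map_stdVec hz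
        · exact ⟨⟨g, hg⟩, congrArg q h⟩
        · exact ⟨⟨g, hg⟩, (congrArg q h).trans (hneg z hz)⟩
      rintro (rfl | rfl | rfl)
      · exact ⟨1, rfl⟩
      · exact hz _ hs
      · exact hz _ hs'
  have hnot : ∀ z : EuclideanSpace ℝ (Fin 4), IsHalfVec z → q (stdVec 3) ≠ q z := by
    intro z hz h
    rw [hq] at h
    obtain ⟨k, hk⟩ := h.1 0
    have h0 : stdVec (3 : Fin 4) 0 = (0 : ℝ) := by simp
    rw [PiLp.sub_apply, h0] at hk
    rcases hz 0 with h | h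
    · have : (2 * k : ℤ) = -1 := by
        have : (2 * k : ℝ) = -1 := by linarith
        exact_mod_cast this
      omega
    · have : (2 * k : ℤ) = 1 := by
        have : (2 * k : ℝ) = 1 := by linarith
        exact_mod_cast this
      omega
  have hss : q (halfVec 4) ≠ q (halfVec 4 - stdVec 3) := by
    intro h
    rw [hq, sub_sub_cancel, mem_latticeD_iff_even (m := 1) (stdVec_int 3) (by rw [sum_stdVec]; simp)]
      at h
    exact absurd h (by decide)
  rw [hrange, Set.ncard_eq_three]
  exact ⟨_, _, _, hnot _ hs, hnot _ hs', hss, rfl⟩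

variable {E : Type*} [NormedAddCommGroup E] [InnerProductSpace ℝ E] [FiniteDimensional ℝ E]
  {L : Submodule ℤ E} [DiscreteTopology L] [IsZLattice ℝ L]

omit [FiniteDimensional ℝ E] [DiscreteTopology L] [IsZLattice ℝ L] in
-- The image of φ is a real subspace containing every 2eᵢ.
lemma surjective_of_stdVec {M : Submodule ℤ (EuclideanSpace ℝ (Fin n))}
    (φ : E →ₗᵢ[ℝ] EuclideanSpace ℝ (Fin n)) (h : ∀ y ∈ M, ∃ x ∈ L, φ x = y)
    (hM : ∀ i, stdVec i + stdVec i ∈ M) : Function.Surjective φ := by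
  rw [← LinearIsometry.coe_toLinearMap, ← LinearMap.range_eq_top, eq_top_iff,
    ← (EuclideanSpace.basisFun (Fin n) ℝ).toBasis.span_eq, Submodule.span_le]
  rintro _ ⟨i, rfl⟩
  obtain ⟨x, -, hx⟩ := h _ (hM i)
  refine ⟨(1 / 2 : ℝ) • x, ?_⟩
  have : φ ((1 / 2 : ℝ) • x) = stdVec i := by
    rw [map_smul, hx]
    module
  simpa using this

lemma IsDeepHole.exists_latticeD (hn : 4 ≤ n) {c : E} (hc : IsDeepHole L c)
    (h : Isometric L (latticeD n)) : ∃ (φ : E ≃ₗᵢ[ℝ] EuclideanSpace ℝ (Fin n))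
      (z : EuclideanSpace ℝ (Fin n)), (∀ x, φ x ∈ latticeD n ↔ x ∈ L) ∧
      linearStabilizer (latticeD n) (φ c) = linearStabilizer (latticeD n) z ∧
      (IsHalfVec z ∨ n = 4 ∧ ∃ i, z = stdVec i ∨ z = -stdVec i) := by
  obtain ⟨φ, hφ, hφ'⟩ := h.exists_linearIsometry
  let ψ := LinearIsometryEquiv.ofSurjective φ (surjective_of_stdVec φ hφ' two_stdVec_mem)
  have hψ : ∀ x, ψ x ∈ latticeD n ↔ x ∈ L := hφ
  obtain ⟨t, ht, hR, hr⟩ := hc.exists_translate (c₀ := ψ.symm (halfVec n)) (R := n / 4) fun x hx => by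
    have := norm_sq_sub_halfVec_ge ((hψ x).2 hx)
    rwa [← ψ.norm_map, map_sub, ψ.apply_symm_apply]
  refine ⟨ψ, ψ (c - t), hψ, linearStabilizer_congr ?_, isHalfVec_or_of_norm_sq_ge hn ?_ ?_⟩
  · rw [← map_sub, hψ, sub_sub_cancel]
    exact ht
  · intro r hr' hr2
    obtain ⟨r, rfl⟩ := ψ.surjective r
    rw [ψ.inner_map_map]
    exact hr r ((hψ r).1 hr') (by simpa using hr2)
  · rwa [ψ.norm_map]

/-- Modulo D_4 the hole is a vector or spinor class. O(D_4) acts transitively on these, so all the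
stabilizers are conjugate to that of e₃. -/
lemma stabilizer_typeD_four {c : E} (hc : IsDeepHole L c) (h : Isometric L (latticeD 4)) :
    Nonempty (affineStabilizer L c ≃* orthogonalGroupD4') := by
  obtain ⟨φ, z, hφ, hz, hz'⟩ := hc.exists_latticeD le_rfl h
  obtain ⟨e₁⟩ := nonempty_affineStabilizer_mulEquiv L c
  obtain ⟨e₂⟩ := nonempty_linearStabilizer_mulEquiv φ hφ c
  rw [hz] at e₂
  have hfin : Nonempty (orthogonalGroupD4' ≃* linearStabilizer (latticeD 4) z) := by
    rw [orthogonalGroupD4'_eq]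
    rcases hz' with hz' | ⟨-, i, rfl | rfl⟩
    · obtain ⟨g, hg, h | h⟩ := exists_map_stdVec hz'
      · rw [← h]
        exact nonempty_linearStabilizer_mulEquiv g hg (stdVec 3)
      · rw [← linearStabilizer_neg _ z, ← h]
        exact nonempty_linearStabilizer_mulEquiv g hg (stdVec 3)
    · rw [linearStabilizer_congr (stdVec_sub_mem 3 i)]
      exact ⟨MulEquiv.refl _⟩
    · rw [linearStabilizer_neg, linearStabilizer_congr (stdVec_sub_mem 3 i)]
      exact ⟨MulEquiv.refl _⟩
  exact ⟨(e₁.trans e₂).trans hfin.some.symm⟩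

lemma stabilizer_typeD (hn : 5 ≤ n) {c : E} (hc : IsDeepHole L c)
    (h : Isometric L (latticeD n)) : Nonempty (affineStabilizer L c ≃* weylGroup L) := by
  obtain ⟨φ, z, hφ, hz, hz'⟩ := hc.exists_latticeD (by omega) h
  obtain ⟨e₁⟩ := nonempty_affineStabilizer_mulEquiv L c
  obtain ⟨e₂⟩ := nonempty_linearStabilizer_mulEquiv φ hφ c
  obtain ⟨e₃⟩ := nonempty_weylGroup_mulEquiv φ hφ
  rw [hz, linearStabilizer_latticeD_eq hn (hz'.resolve_right (by omega))] at e₂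
  exact ⟨(e₁.trans e₂).trans e₃.symm⟩

end TypeD

/-! ### Type A: the Voronoi cell and the simplex of a generating class -/

/-- On the unit cube the convex function `∑ vᵢ² - (∑ vᵢ)² / N` is maximal at vertices only. -/
lemma cube_le_of_vertices {N : ℕ} (hN : 2 ≤ N) {R : ℝ}
    (hR : ∀ j : ℕ, j ≤ N → (j : ℝ) - (j : ℝ) ^ 2 / N ≤ R) {v : Fin N → ℝ}
    (hv : ∀ i, 0 ≤ v i ∧ v i ≤ 1) :
    ∑ i, v i ^ 2 - (∑ i, v i) ^ 2 / N ≤ R ∧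
      ((∃ i, v i ≠ 0 ∧ v i ≠ 1) → ∑ i, v i ^ 2 - (∑ i, v i) ^ 2 / N < R) := by
  classical
  -- Induction on the number of coordinates that are neither 0 nor 1; pushing one of them to an end
  -- point lowers it.
  induction hd : (Finset.univ.filter fun i => v i ≠ 0 ∧ v i ≠ 1).card generalizing v with
  | zero =>
    rw [Finset.card_eq_zero, Finset.filter_eq_empty_iff] at hd
    have hd' : ∀ i, v i ≠ 0 → v i = 1 := fun i h => by
      by_contra h'
      exact hd (Finset.mem_univ i) ⟨h, h'⟩
    refine ⟨?_, fun ⟨i, hi⟩ => absurd hi (hd (Finset.mem_univ i))⟩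
    have h1 : ∀ i, v i = if v i ≠ 0 then 1 else 0 := fun i => by
      by_cases h : v i = 0
      · simp [h]
      · rw [if_pos h, hd' i h]
    have h2 : ∀ i, v i ^ 2 = v i := fun i => by
      by_cases h : v i = 0
      · simp [h]
      · simp [hd' i h]
    have h3 : ∑ i, v i = ((Finset.univ.filter fun i => v i ≠ 0).card : ℝ) := by
      rw [Finset.card_filter]
      push_cast
      exact Finset.sum_congr rfl fun i _ => h1 i
    simp only [h2]
    rw [h3]
    refine hR _ ((Finset.card_filter_le _ _).trans ?_)
    simp
  | succ d ih =>
    have hne : (Finset.univ.filter fun i => v i ≠ 0 ∧ v i ≠ 1).Nonempty := by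
      rw [← Finset.card_pos]; omega
    obtain ⟨i, hi⟩ := hne
    have hi' : v i ≠ 0 ∧ v i ≠ 1 := by simpa using hi
    have hupd : ∀ a : ℝ, a = 0 ∨ a = 1 →
        ∑ j, Function.update v i a j ^ 2 - (∑ j, Function.update v i a j) ^ 2 / N ≤ R := by
      intro a ha
      refine (ih (v := Function.update v i a) (fun j => ?_) ?_).1
      · by_cases hj : j = i
        · subst hj
          rw [Function.update_self]
          rcases ha with rfl | rfl <;> norm_num
        · rw [Function.update_of_ne hj]; exact hv j
      · have e : (Finset.univ.filter fun j => Function.update v i a j ≠ 0 ∧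
            Function.update v i a j ≠ 1) =
            (Finset.univ.filter fun i => v i ≠ 0 ∧ v i ≠ 1).erase i := by
          ext j
          by_cases hj : j = i
          · subst hj
            simp only [Finset.mem_filter, Finset.mem_univ, true_and, Function.update_self,
              Finset.mem_erase]
            tauto
          · simp [hj]
        rw [e, Finset.card_erase_of_mem hi, hd]
        rfl
    have hsum : ∀ a : ℝ, ∑ j, Function.update v i a j = a + ∑ j ∈ Finset.univ.erase i, v j := by
      intro a
      rw [← Finset.add_sum_erase _ _ (Finset.mem_univ i), Function.update_self]
      congr 1
      exact Finset.sum_congr rfl fun j hj => Function.update_of_ne (Finset.ne_of_mem_erase hj) _ _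
    have hsum2 : ∀ a : ℝ, ∑ j, Function.update v i a j ^ 2 =
        a ^ 2 + ∑ j ∈ Finset.univ.erase i, v j ^ 2 := by
      intro a
      rw [← Finset.add_sum_erase _ _ (Finset.mem_univ i), Function.update_self]
      congr 1
      exact Finset.sum_congr rfl fun j hj => by
        rw [Function.update_of_ne (Finset.ne_of_mem_erase hj)]
    have h0 := hupd 0 (Or.inl rfl)
    have h1 := hupd 1 (Or.inr rfl)
    rw [hsum, hsum2] at h0 h1
    have hlt : ∑ i, v i ^ 2 - (∑ i, v i) ^ 2 / N < R := by
      rw [← Finset.add_sum_erase _ _ (Finset.mem_univ i),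
        ← Finset.add_sum_erase _ v (Finset.mem_univ i)]
      set B := ∑ j ∈ Finset.univ.erase i, v j
      set A := ∑ j ∈ Finset.univ.erase i, v j ^ 2
      set x := v i
      have hx0 : 0 < x := lt_of_le_of_ne (hv i).1 (Ne.symm hi'.1)
      have hx1 : x < 1 := lt_of_le_of_ne (hv i).2 hi'.2
      have hN' : (2 : ℝ) ≤ N := by exact_mod_cast hN
      have hs : (N : ℝ)⁻¹ ≤ 2⁻¹ := inv_anti₀ (by norm_num) hN'
      rw [div_eq_mul_inv] at h0 h1 ⊢
      set s := (N : ℝ)⁻¹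
      have h2 := mul_le_mul_of_nonneg_left h0 (sub_nonneg.2 hx1.le)
      have h3 := mul_le_mul_of_nonneg_left h1 hx0.le
      -- As a function of one coordinate x this is a quadratic with leading coefficient 1 − 1/N > 0,
      -- so it lies below its chord on [0, 1] by exactly (1 − 1/N)x(1 − x).
      have h4 : 0 < (1 - s) * (x * (1 - x)) :=
        mul_pos (by linarith) (mul_pos hx0 (sub_pos.2 hx1))
      nlinarith
    exact ⟨hlt.le, fun _ => hlt⟩

lemma sum_smul_stdVec {N : ℕ} (y : EuclideanSpace ℝ (Fin N)) : ∑ i, y i • stdVec i = y := by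
  simpa using (EuclideanSpace.basisFun (Fin N) ℝ).sum_repr y

section TypeA

variable {n : ℕ}

lemma stdVec_sub_mem_latticeA (i j : Fin (n + 1)) : stdVec i - stdVec j ∈ latticeA n := by
  refine ⟨(stdVec_sub_mem i j).1, ?_⟩
  simp only [PiLp.sub_apply, Finset.sum_sub_distrib, sum_stdVec]
  simp

/-- The maximum of `j * (N - j)` over the integers. -/
lemma sub_sq_div_le {N k j : ℕ} (hN : N = 2 * k ∨ N = 2 * k + 1) (hN0 : 0 < N) :
    (j : ℝ) - (j : ℝ) ^ 2 / N ≤ k - (k : ℝ) ^ 2 / N := by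
  have hN' : (0 : ℝ) < N := by exact_mod_cast hN0
  -- k and N − k are equal or consecutive, so no integer j lies strictly between them.
  have h : 0 ≤ ((k : ℤ) - j) * ((N : ℤ) - k - j) := by
    rcases hN with rfl | rfl
    · push_cast
      nlinarith [sq_nonneg ((k : ℤ) - j)]
    · push_cast
      rcases le_or_gt (j : ℤ) k with h | h
      · exact mul_nonneg (by linarith) (by linarith)
      · exact mul_nonneg_of_nonpos_of_nonpos (by linarith) (by linarith)
  have h' : (0 : ℝ) ≤ ((k : ℝ) - j) * ((N : ℝ) - k - j) := by exact_mod_cast h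
  have e : (k - (k : ℝ) ^ 2 / N) - ((j : ℝ) - (j : ℝ) ^ 2 / N) =
      ((k : ℝ) - j) * ((N : ℝ) - k - j) / N := by
    field_simp
    ring
  have := div_nonneg h' hN'.le
  linarith

lemma eq_of_sub_sq_div_le {N k j : ℕ} (hN : N = 2 * k ∨ N = 2 * k + 1) (hN0 : 0 < N)
    (h : (k : ℝ) - (k : ℝ) ^ 2 / N ≤ j - (j : ℝ) ^ 2 / N) : j = k ∨ j + k = N := by
  have hN' : (0 : ℝ) < N := by exact_mod_cast hN0
  have h1 := le_antisymm h (sub_sq_div_le hN hN0)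
  have h2 : ((k : ℝ) - j) * ((N : ℝ) - (j + k)) = 0 := by
    field_simp at h1
    linarith
  rcases mul_eq_zero.1 h2 with h3 | h3
  · left
    have : (j : ℝ) = k := by linarith
    exact_mod_cast this
  · right
    have : ((j + k : ℕ) : ℝ) = N := by push_cast; linarith
    exact_mod_cast this

/-- The points of maximal norm of the Voronoi cell of `A_n`. -/
lemma exists_shape_latticeA {N : ℕ} (hN : 2 ≤ N) {k : ℕ} (hk : N = 2 * k ∨ N = 2 * k + 1)
    {u : EuclideanSpace ℝ (Fin N)} (hu0 : ∑ i, u i = 0) (hu : ∀ i j, u i - u j ≤ 1)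
    (hR : (k : ℝ) - (k : ℝ) ^ 2 / N ≤ ‖u‖ ^ 2) :
    ∃ (S : Finset (Fin N)), (S.card = k ∨ S.card + k = N) ∧
      ∀ i, u i = (if i ∈ S then 1 else 0) - (S.card : ℝ) / N := by
  classical
  have : Nonempty (Fin N) := ⟨⟨0, by omega⟩⟩
  obtain ⟨i₀, hi₀⟩ := Finite.exists_min fun i => u i
  have hN0 : (0 : ℝ) < N := by exact_mod_cast (by omega : 0 < N)
  -- Subtracting the least coordinate puts v in the unit cube. Since u has sum zero, ‖u‖² is the
  -- squared norm of v projected orthogonally to the all-ones vector, so the cube estimate makes v a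
  -- vertex.
  let v : Fin N → ℝ := fun i => u i - u i₀
  have hv : ∀ i, 0 ≤ v i ∧ v i ≤ 1 := fun i => ⟨sub_nonneg.2 (hi₀ i), hu i i₀⟩
  have hvs : ∑ i, v i = -(N * u i₀) := by
    simp only [v, Finset.sum_sub_distrib, hu0]
    simp
  have hnorm : ‖u‖ ^ 2 = ∑ i, v i ^ 2 - (∑ i, v i) ^ 2 / N := by
    rw [EuclideanSpace.real_norm_sq_eq]
    have h1 : ∀ i, v i ^ 2 = u i ^ 2 - 2 * u i₀ * u i + u i₀ ^ 2 := fun i => by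
      simp only [v]; ring
    rw [hvs]
    simp only [h1, Finset.sum_add_distrib, Finset.sum_sub_distrib, ← Finset.mul_sum, hu0]
    simp only [Finset.sum_const, Finset.card_univ, Fintype.card_fin, nsmul_eq_mul]
    field_simp
    ring
  obtain ⟨-, hlt⟩ := cube_le_of_vertices (by omega)
    (fun j _ => sub_sq_div_le (j := j) hk (by omega)) hv
  have hvert : ∀ i, v i = 0 ∨ v i = 1 := by
    by_contra! h
    have := hlt h
    rw [← hnorm] at this
    linarith
  let S := Finset.univ.filter fun i => v i = 1
  have hvS : ∀ i, v i = if i ∈ S then 1 else 0 := fun i => by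
    rcases hvert i with h | h <;> simp [S, h]
  have hsS : ∑ i, v i = S.card := by
    simp only [hvS]
    simp
  have hsS2 : ∑ i, v i ^ 2 = S.card := by
    rw [← hsS]
    exact Finset.sum_congr rfl fun i _ => by rcases hvert i with h | h <;> simp [h]
  refine ⟨S, eq_of_sub_sq_div_le hk (by omega) ?_, fun i => ?_⟩
  · rwa [hnorm, hsS, hsS2] at hR
  · rw [← hvS, ← hsS, hvs, neg_div, sub_neg_eq_add, mul_div_cancel_left₀ _ hN0.ne']
    simp [v]

variable {E : Type*} [NormedAddCommGroup E] [InnerProductSpace ℝ E] {L : Submodule ℤ E}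
  {φ : E →ₗᵢ[ℝ] EuclideanSpace ℝ (Fin (n + 1))}

lemma sum_map_eq_zero [DiscreteTopology L] [IsZLattice ℝ L]
    (hφ : ∀ x, φ x ∈ latticeA n ↔ x ∈ L) (x : E) : ∑ i, φ x i = 0 := by
  have hx : x ∈ Submodule.span ℝ (L : Set E) := by
    rw [IsZLattice.span_top]; trivial
  induction hx using Submodule.span_induction with
  | mem x hx => exact ((hφ x).2 hx).2
  | zero => simp
  | add x y _ _ hx hy => simp [Finset.sum_add_distrib, hx, hy]
  | smul a x _ hx => simp [← Finset.mul_sum, hx]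

/-- The image of φ contains the roots eᵢ − e₀, hence the whole hyperplane of sum zero. -/
lemma exists_map_eq (hφ' : ∀ y ∈ latticeA n, ∃ x ∈ L, φ x = y)
    {y : EuclideanSpace ℝ (Fin (n + 1))} (hy : ∑ i, y i = 0) : ∃ x, φ x = y := by
  have h : ∀ i, ∃ x, φ x = stdVec i - stdVec 0 := fun i => by
    obtain ⟨x, -, hx⟩ := hφ' _ (stdVec_sub_mem_latticeA i 0)
    exact ⟨x, hx⟩
  choose b hb using h
  refine ⟨∑ i, y i • b i, ?_⟩
  rw [map_sum]
  simp only [map_smul, hb, smul_sub, Finset.sum_sub_distrib, ← Finset.sum_smul, hy, zero_smul,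
    sub_zero]
  exact sum_smul_stdVec y

/-- The vector with all coordinates `1 / (n + 1)`. -/
def centroid (n : ℕ) : EuclideanSpace ℝ (Fin (n + 1)) :=
  WithLp.toLp 2 fun _ => 1 / ((n + 1 : ℕ) : ℝ)

lemma centroid_apply (i : Fin (n + 1)) : centroid n i = 1 / ((n + 1 : ℕ) : ℝ) := rfl

lemma sum_centroid : ∑ i, centroid n i = 1 := by
  simp only [centroid_apply, Finset.sum_const, Finset.card_univ, Fintype.card_fin, nsmul_eq_mul]
  field_simp

lemma inner_centroid {x : EuclideanSpace ℝ (Fin (n + 1))} (hx : ∑ i, x i = 0) :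
    ⟪x, centroid n⟫_ℝ = 0 := by
  rw [inner_eq_sum]
  simp only [centroid_apply, ← Finset.sum_mul, hx, zero_mul]

/-- The vertices of the simplex formed by the shortest vectors of a generating class of the
discriminant group of `A_n`. -/
lemma exists_simplex (hφ' : ∀ y ∈ latticeA n, ∃ x ∈ L, φ x = y) :
    ∃ p : Fin (n + 1) → E, ∀ i, φ (p i) = stdVec i - centroid n := by
  have h : ∀ i, ∃ x, φ x = stdVec i - centroid n := fun i => exists_map_eq hφ' (by
    simp only [PiLp.sub_apply, Finset.sum_sub_distrib, sum_stdVec, sum_centroid]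
    simp)
  choose p hp using h
  exact ⟨p, hp⟩

/-- The centroid is orthogonal to the roots, so the reflection in p_x − p_y swaps these two vertices
and fixes the others. -/
lemma exists_weylGroup_simplex (hφ : ∀ x, φ x ∈ latticeA n ↔ x ∈ L) {p : Fin (n + 1) → E}
    (hp : ∀ i, φ (p i) = stdVec i - centroid n) (σ : Equiv.Perm (Fin (n + 1))) :
    ∃ w ∈ weylGroup L, ∀ i, w (p i) = p (σ i) := by
  induction σ using Equiv.Perm.swap_induction_on with
  | one => exact ⟨1, one_mem _, fun i => rfl⟩
  | swap_mul f x y hxy ih =>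
    obtain ⟨w, hw, hwe⟩ := ih
    have hr : φ (p x - p y) = stdVec x - stdVec y := by rw [map_sub, hp, hp]; abel
    have hrL : p x - p y ∈ L := by
      rw [← hφ, hr]; exact stdVec_sub_mem_latticeA x y
    have hr2 : ‖p x - p y‖ ^ 2 = 2 := by rw [← φ.norm_map, hr, norm_stdVec_sub hxy]
    refine ⟨_ * w, mul_mem (reflection_mem_weylGroup hrL hr2) hw, fun i => ?_⟩
    change (ℝ ∙ (p x - p y))ᗮ.reflection (w (p i)) = _
    rw [hwe]
    apply φ.injective
    rw [reflection_root_apply hr2, map_sub, map_smul, ← φ.inner_map_map, hr, hp, hp,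
      inner_sub_right, inner_centroid (stdVec_sub_mem_latticeA x y).2, sub_zero,
      Equiv.Perm.mul_apply, ← reflection_sub_stdVec hxy, reflection_root_apply (norm_stdVec_sub hxy)]
    abel

variable [DiscreteTopology L] [IsZLattice ℝ L]

/-- An isometry that fixes a generating class of the discriminant group of `A_n` is in the Weyl
group. -/
lemma mem_weylGroup_of_simplex (hφ : ∀ x, φ x ∈ latticeA n ↔ x ∈ L) {p : Fin (n + 1) → E}
    (hp : ∀ i, φ (p i) = stdVec i - centroid n) {g : E ≃ₗᵢ[ℝ] E}
    (hg : g ∈ linearStabilizer L (p 0)) : g ∈ weylGroup L := by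
  -- Adding the centroid back to φ (g pᵢ) gives an integral vector of norm one and coordinate sum
  -- one, that is, a standard unit vector.
  have hσ : ∀ i, ∃ j, g (p i) = p j := by
    intro i
    have hpi : p i - p 0 ∈ L := by
      rw [← hφ, map_sub, hp, hp, sub_sub_sub_cancel_right]
      exact stdVec_sub_mem_latticeA i 0
    have h1 := add_mem ((hg.1 _).2 hpi) hg.2
    rw [map_sub, sub_add_sub_cancel, ← hφ, map_sub, hp] at h1
    have hnorm : ∀ x, ‖φ x + centroid n‖ ^ 2 = ‖x‖ ^ 2 + ‖centroid n‖ ^ 2 := fun x => by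
      rw [norm_add_sq_real, inner_centroid (sum_map_eq_zero hφ x), φ.norm_map]
      ring
    have h2 : ‖φ (g (p i)) + centroid n‖ = 1 := by
      rw [← sq_eq_sq₀ (norm_nonneg _) zero_le_one, hnorm, g.norm_map, ← hnorm, hp,
        sub_add_cancel]
      simp
    have h3 : ∀ l, ∃ k : ℤ, (φ (g (p i)) + centroid n) l = k := fun l => by
      obtain ⟨a, ha⟩ := h1.1 l
      obtain ⟨b, hb⟩ := stdVec_int (0 : Fin (n + 1)) l
      refine ⟨a + b, ?_⟩
      simp only [PiLp.sub_apply] at ha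
      rw [PiLp.add_apply]
      push_cast
      linarith
    have h4 : ∑ l, (φ (g (p i)) + centroid n) l = 1 := by
      simp only [PiLp.add_apply, Finset.sum_add_distrib, sum_centroid, sum_map_eq_zero hφ, zero_add]
    obtain ⟨j, h | h⟩ := eq_stdVec_of_norm_one h3 h2
    · refine ⟨j, φ.injective ?_⟩
      rw [hp, ← h, add_sub_cancel_right]
    · rw [h] at h4
      simp only [PiLp.neg_apply, Finset.sum_neg_distrib, sum_stdVec] at h4
      norm_num at h4
  choose σ hσ using hσ
  have hinj : Function.Injective σ := by
    intro i j hij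
    by_contra hne
    have h1 : p i = p j := g.injective (by rw [hσ, hσ, hij])
    have h2 := hp i
    rw [h1, hp, sub_left_inj] at h2
    have h3 := inner_stdVec_stdVec hne
    rw [← h2, inner_stdVec_self] at h3
    norm_num at h3
  obtain ⟨w, hw, hwe⟩ := exists_weylGroup_simplex hφ hp
    (Equiv.ofBijective σ (Finite.injective_iff_bijective.1 hinj))
  have hgw : g = w := by
    refine LinearIsometryEquiv.ext fun x => ?_
    have hx : x = ∑ i, φ x i • p i := by
      apply φ.injective
      rw [map_sum]
      simp only [map_smul, hp, smul_sub, Finset.sum_sub_distrib, ← Finset.sum_smul,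
        sum_map_eq_zero hφ, zero_smul, sub_zero]
      exact (sum_smul_stdVec _).symm
    rw [hx, map_sum, map_sum]
    refine Finset.sum_congr rfl fun i _ => ?_
    rw [map_smul, map_smul, hσ, hwe]
    rfl
  exact hgw ▸ hw

/-- Up to translation, the deep holes of `A_n` are the classes of `⌊(n + 1) / 2⌋` and
`⌈(n + 1) / 2⌉` in the discriminant group. -/
lemma IsDeepHole.exists_shape [FiniteDimensional ℝ E] (hn : 1 ≤ n) {k : ℕ}
    (hk : n + 1 = 2 * k ∨ n + 1 = 2 * k + 1)
    (hφ : ∀ x, φ x ∈ latticeA n ↔ x ∈ L) (hφ' : ∀ y ∈ latticeA n, ∃ x ∈ L, φ x = y)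
    {c : E} (hc : IsDeepHole L c) :
    ∃ z, c - z ∈ L ∧ ∃ (S : Finset (Fin (n + 1))), (S.card = k ∨ S.card + k = n + 1) ∧
      ∀ i, φ z i = (if i ∈ S then 1 else 0) - (S.card : ℝ) / (n + 1 : ℕ) := by
  classical
  obtain ⟨T, -, hT⟩ := Finset.exists_subset_card_eq (s := (Finset.univ : Finset (Fin (n + 1))))
    (n := k) (by simp; omega)
  -- The test point: the indicator of a k-set projected to the hyperplane of sum zero.
  let y : EuclideanSpace ℝ (Fin (n + 1)) :=
    WithLp.toLp 2 fun i => (if i ∈ T then 1 else 0) - (k : ℝ) / (n + 1 : ℕ)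
  have hy : ∀ i, y i = (if i ∈ T then 1 else 0) - (k : ℝ) / (n + 1 : ℕ) := fun i => rfl
  have hN0 : (0 : ℝ) < (n + 1 : ℕ) := by positivity
  obtain ⟨c₀, hc₀⟩ := exists_map_eq hφ' (y := y) (by
    simp only [hy, Finset.sum_sub_distrib, Finset.sum_const, Finset.card_univ, Fintype.card_fin,
      nsmul_eq_mul]
    rw [mul_div_cancel₀ _ hN0.ne']
    simp [hT])
  obtain ⟨t, ht, hR, hr⟩ := hc.exists_translate (c₀ := c₀)
    (R := (k : ℝ) - (k : ℝ) ^ 2 / (n + 1 : ℕ)) fun x hx => by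
      obtain ⟨hxi, hx0⟩ := (hφ x).2 hx
      choose a ha using hxi
      rw [← φ.norm_map, map_sub, hc₀, EuclideanSpace.real_norm_sq_eq]
      -- With d the integer xᵢ minus the indicator of T, this is d² ≥ −d inserted into (d + k/N)²,
      -- where N = n + 1. Summing, ∑ xᵢ = 0 leaves k − k²/N.
      have h1 : ∀ i, ((if i ∈ T then 1 else 0) - φ x i) +
          2 * ((k : ℝ) / (n + 1 : ℕ)) * (φ x i - (if i ∈ T then 1 else 0)) +
          ((k : ℝ) / (n + 1 : ℕ)) ^ 2 ≤ (φ x - y) i ^ 2 := fun i => by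
        rw [PiLp.sub_apply, hy, ha]
        have h2 : ∀ b : ℤ, (0 : ℝ) ≤ b * (b + 1) := fun b => by
          have : 0 ≤ b * (b + 1) := by rcases le_or_gt 0 b with h | h <;> nlinarith
          exact_mod_cast this
        split_ifs
        · have := h2 (a i - 1)
          push_cast at this
          nlinarith
        · have := h2 (a i)
          nlinarith
      refine le_trans (le_of_eq ?_) (Finset.sum_le_sum fun i _ => h1 i)
      rw [Finset.sum_add_distrib, Finset.sum_add_distrib, ← Finset.mul_sum,
        Finset.sum_sub_distrib, Finset.sum_sub_distrib, hx0]
      simp only [Finset.sum_const, Finset.card_univ, Fintype.card_fin, nsmul_eq_mul]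
      have h3 : ∑ i : Fin (n + 1), (if i ∈ T then (1 : ℝ) else 0) = k := by simp [hT]
      rw [h3]
      field_simp
      ring
  refine ⟨c - t, by rwa [sub_sub_cancel], exists_shape_latticeA (by omega) hk (sum_map_eq_zero hφ _)
    (fun i j => ?_) (by rwa [φ.norm_map])⟩
  by_cases hij : i = j
  · subst hij; simp
  obtain ⟨r, hrL, hrφ⟩ := hφ' _ (stdVec_sub_mem_latticeA i j)
  have := hr r hrL (by rw [← φ.norm_map, hrφ, norm_stdVec_sub hij])
  rwa [← φ.inner_map_map, hrφ, inner_sub_right, inner_stdVec_right, inner_stdVec_right] at this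

variable [FiniteDimensional ℝ E]

/-- Here n + 1 = 2k, so every deep hole is congruent to a vector with all coordinates ±1/2, and any
two of these differ by an element of A_n. As g c is again a deep hole, every g fixes the class. -/
lemma stabilizer_typeA_odd (hn : Odd n) {c : E} (hc : IsDeepHole L c)
    (h : Isometric L (latticeA n)) : Nonempty (affineStabilizer L c ≃* orthogonalGroup L) := by
  obtain ⟨φ, hφ, hφ'⟩ := h.exists_linearIsometry
  obtain ⟨l, hl⟩ := hn
  have key : ∀ c : E, IsDeepHole L c → ∃ z, c - z ∈ L ∧ IsHalfVec (φ z) := by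
    intro c hc
    obtain ⟨z, hz, S, hS, hSz⟩ := hc.exists_shape (k := l + 1) (by omega) (by omega) hφ hφ'
    have hS' : S.card = l + 1 := by omega
    refine ⟨z, hz, fun i => ?_⟩
    have e : ((l + 1 : ℕ) : ℝ) / (n + 1 : ℕ) = 1 / 2 := by
      rw [hl]
      push_cast
      field_simp
      ring
    rw [hSz, hS', e]
    split_ifs
    · left; norm_num
    · right; norm_num
  have heq : linearStabilizer L c = orthogonalGroup L := by
    refine le_antisymm (fun g hg => hg.1) fun g hg => ⟨hg, ?_⟩
    obtain ⟨z, hz, hzh⟩ := key c hc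
    obtain ⟨z', hz', hzh'⟩ := key (g c) (hc.map_orthogonal hg)
    have h1 : z' - z ∈ L := by
      rw [← hφ]
      refine ⟨fun i => by rw [map_sub]; exact int_sub_of_isHalfVec hzh' hzh i, sum_map_eq_zero hφ _⟩
    have := sub_mem (add_mem hz' h1) hz
    convert this using 1
    abel
  rw [← heq]
  exact nonempty_affineStabilizer_mulEquiv L c

lemma stabilizer_typeA_even (hL : IsRootLattice L) (hn1 : 1 ≤ n) (hn : Even n) {c : E}
    (hc : IsDeepHole L c) (h : Isometric L (latticeA n)) :
    Nonempty (affineStabilizer L c ≃* weylGroup L) := by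
  obtain ⟨φ, hφ, hφ'⟩ := h.exists_linearIsometry
  obtain ⟨k, hk⟩ := hn
  obtain ⟨z, hz, S, hS, hSz⟩ := hc.exists_shape (k := k) hn1 (by omega) hφ hφ'
  obtain ⟨p, hp⟩ := exists_simplex hφ'
  have hN0 : ((n + 1 : ℕ) : ℝ) ≠ 0 := by positivity
  -- With n + 1 = 2k + 1, twice the class of z is minus or plus the generating class of p₀,
  -- according as |S| is k or k + 1. Hence fixing the class of z fixes that of p₀.
  have hpz : z + z + p 0 ∈ L ∨ z + z - p 0 ∈ L := by
    rcases hS with hS | hS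
    · left
      rw [← hφ]
      refine ⟨fun i => ?_, sum_map_eq_zero hφ _⟩
      obtain ⟨b, hb⟩ := stdVec_int (0 : Fin (n + 1)) i
      refine ⟨2 * (if i ∈ S then 1 else 0) + b - 1, ?_⟩
      have e : ((n + 1 : ℕ) : ℝ) = 2 * k + 1 := by rw [hk]; push_cast; ring
      simp only [map_add, PiLp.add_apply, hSz, hS, hp, PiLp.sub_apply, hb, centroid_apply, e]
      rw [e] at hN0
      push_cast
      field_simp
      ring
    · right
      rw [← hφ]
      refine ⟨fun i => ?_, sum_map_eq_zero hφ _⟩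
      obtain ⟨b, hb⟩ := stdVec_int (0 : Fin (n + 1)) i
      refine ⟨2 * (if i ∈ S then 1 else 0) - b - 1, ?_⟩
      have hS' : S.card = k + 1 := by omega
      have e : ((n + 1 : ℕ) : ℝ) = 2 * k + 1 := by rw [hk]; push_cast; ring
      simp only [map_add, map_sub, PiLp.add_apply, hSz, hS', hp, PiLp.sub_apply, hb,
        centroid_apply, e]
      rw [e] at hN0
      push_cast
      field_simp
      ring
  have hW : linearStabilizer L z = weylGroup L := by
    refine le_antisymm (fun g hg => mem_weylGroup_of_simplex hφ hp ⟨hg.1, ?_⟩)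
      (weylGroup_le_linearStabilizer hL.integral fun r hr => ?_)
    · rcases hpz with hd | hd
      · have h1 := sub_mem (sub_mem (sub_mem ((hg.1 _).2 hd) hd) hg.2) hg.2
        convert h1 using 1
        simp only [map_add]
        abel
      · have h1 := add_mem (sub_mem hd ((hg.1 _).2 hd)) (add_mem hg.2 hg.2)
        convert h1 using 1
        simp only [map_add, map_sub]
        abel
    · obtain ⟨hri, hr0⟩ := (hφ r).2 hr
      choose a ha using hri
      refine ⟨∑ i ∈ S, a i, ?_⟩
      rw [← φ.inner_map_map, inner_eq_sum]
      simp only [hSz, mul_sub, Finset.sum_sub_distrib, ← Finset.sum_mul, hr0, zero_mul, sub_zero]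
      simp [ha]
  rw [← hW, ← linearStabilizer_congr hz]
  exact nonempty_affineStabilizer_mulEquiv L c

end TypeA

/-! ### Norm maximization on the fundamental alcoves of E_6, E_7, E_8 -/

/-- The vertices of maximal norm of the fundamental alcove of `E_6`, in the coordinates given by the
simple roots. -/
lemma alcove_E6 {a0 a1 a2 a3 a4 a5 : ℝ} (h0 : 0 ≤ a0) (h1 : 0 ≤ a1) (h2 : 0 ≤ a2) (h3 : 0 ≤ a3) (h4 : 0 ≤ a4) (h5 : 0 ≤ a5)
    (hS : a0 + 2 * a1 + 3 * a2 + 2 * a3 + a4 + 2 * a5 ≤ 1)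
    (hR : 4 / 3 ≤ (-1 / 2 * a0 - a1 - 3 / 2 * a2 - a3 - 1 / 2 * a4 - a5) ^ 2 + (5 / 6 * a0 + 2 / 3 * a1 + 1 / 2
    * a2 + 1 / 3 * a3 + 1 / 6 * a4) ^ 2 + (-1 / 6 * a0 + 2 / 3 * a1 + 1 / 2 * a2 + 1 / 3 * a3 + 1
    / 6 * a4) ^ 2 + (-1 / 6 * a0 - 1 / 3 * a1 + 1 / 2 * a2 + 1 / 3 * a3 + 1 / 6 * a4) ^ 2 + (-1 /
    6 * a0 - 1 / 3 * a1 - 1 / 2 * a2 + 1 / 3 * a3 + 1 / 6 * a4) ^ 2 + (-1 / 6 * a0 - 1 / 3 * a1 -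
    1 / 2 * a2 - 2 / 3 * a3 + 1 / 6 * a4) ^ 2 + (-1 / 6 * a0 - 1 / 3 * a1 - 1 / 2 * a2 - 2 / 3 *
    a3 - 5 / 6 * a4) ^ 2 + (1 / 2 * a0 + a1 + 3 / 2 * a2 + a3 + 1 / 2 * a4 + a5) ^ 2) :
    a1 = 0 ∧ a2 = 0 ∧ a3 = 0 ∧ a5 = 0 ∧ (a0 = 1 ∧ a4 = 0 ∨ a0 = 0 ∧ a4 = 1) := by
  have hS2 : (a0 + 2 * a1 + 3 * a2 + 2 * a3 + a4 + 2 * a5) ^ 2 ≤ 1 := by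
    refine pow_le_one₀ ?_ hS
    positivity
  have hz : ∀ x : ℝ, x ^ 2 ≤ 0 → x = 0 := fun x hx => pow_eq_zero_iff two_ne_zero |>.1
    (le_antisymm hx (sq_nonneg x))
  have hq : ∀ x : ℝ, 0 ≤ x ^ 2 := fun x => sq_nonneg x
  -- In `hS` stand the coefficients of the highest root, in `hR` the squared norm of ∑ aᵢωᵢ. The
  -- form 4/3 · (left side of `hS`)² minus this squared norm has no negative coefficient and
  -- dominates the expression below coefficientwise; only a0² and a4² drop out.
  have key : a1 ^ 2 + a2 ^ 2 + a3 ^ 2 + a5 ^ 2 + a0 * a4 ≤ 0 := by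
    linarith
      [mul_nonneg h0 h1, mul_nonneg h0 h2, mul_nonneg h0 h3, mul_nonneg h0 h4, mul_nonneg h0 h5,
      mul_nonneg h1 h2, mul_nonneg h1 h3, mul_nonneg h1 h4, mul_nonneg h1 h5, mul_nonneg h2 h3,
      mul_nonneg h2 h4, mul_nonneg h2 h5, mul_nonneg h3 h4, mul_nonneg h3 h5, mul_nonneg h4 h5, hq
      a0, hq a1, hq a2, hq a3, hq a4, hq a5]
  have e1 : a1 = 0 := hz _ (by linarith [hq a0, hq a1, hq a2, hq a3, hq a4, hq a5, mul_nonneg h0 h4])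
  have e2 : a2 = 0 := hz _ (by linarith [hq a0, hq a1, hq a2, hq a3, hq a4, hq a5, mul_nonneg h0 h4])
  have e3 : a3 = 0 := hz _ (by linarith [hq a0, hq a1, hq a2, hq a3, hq a4, hq a5, mul_nonneg h0 h4])
  have e5 : a5 = 0 := hz _ (by linarith [hq a0, hq a1, hq a2, hq a3, hq a4, hq a5, mul_nonneg h0 h4])
  subst e1 e2 e3 e5
  have h04 : a0 * a4 = 0 := le_antisymm (by linarith) (mul_nonneg h0 h4)
  refine ⟨rfl, rfl, rfl, rfl, ?_⟩
  rcases mul_eq_zero.1 h04 with h | h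
  · subst h
    have h : 1 ≤ a4 ^ 2 := by linarith
    have h' : a4 ≤ 1 := by linarith
    exact Or.inr ⟨rfl, by nlinarith only [h, h', h4]⟩
  · subst h
    have h : 1 ≤ a0 ^ 2 := by linarith
    have h' : a0 ≤ 1 := by linarith
    exact Or.inl ⟨by nlinarith only [h, h', h0], rfl⟩

/-- The vertices of maximal norm of the fundamental alcove of `E_7`, in the coordinates given by the
simple roots. -/
lemma alcove_E7 {a0 a1 a2 a3 a4 a5 a6 : ℝ} (h0 : 0 ≤ a0) (h1 : 0 ≤ a1) (h2 : 0 ≤ a2) (h3 : 0 ≤ a3) (h4 : 0 ≤ a4) (h5 : 0 ≤ a5) (h6 : 0 ≤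
    a6)
    (hS : 2 * a0 + 3 * a1 + 4 * a2 + 3 * a3 + 2 * a4 + a5 + 2 * a6 ≤ 1)
    (hR : 3 / 2 ≤ (-a0 - 2 * a1 - 3 * a2 - 9 / 4 * a3 - 3 / 2 * a4 - 3 / 4 * a5 - 7 / 4 * a6) ^ 2 + (a0 + a1 +
    a2 + 3 / 4 * a3 + 1 / 2 * a4 + 1 / 4 * a5 + 1 / 4 * a6) ^ 2 + (a1 + a2 + 3 / 4 * a3 + 1 / 2 *
    a4 + 1 / 4 * a5 + 1 / 4 * a6) ^ 2 + (a2 + 3 / 4 * a3 + 1 / 2 * a4 + 1 / 4 * a5 + 1 / 4 * a6) ^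
    2 + (3 / 4 * a3 + 1 / 2 * a4 + 1 / 4 * a5 + 1 / 4 * a6) ^ 2 + (-1 / 4 * a3 + 1 / 2 * a4 + 1 /
    4 * a5 + 1 / 4 * a6) ^ 2 + (-1 / 4 * a3 - 1 / 2 * a4 + 1 / 4 * a5 + 1 / 4 * a6) ^ 2 + (-1 / 4
    * a3 - 1 / 2 * a4 - 3 / 4 * a5 + 1 / 4 * a6) ^ 2) :
    a0 = 0 ∧ a1 = 0 ∧ a2 = 0 ∧ a3 = 0 ∧ a4 = 0 ∧ a6 = 0 ∧ a5 = 1 := by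
  have hS2 : (2 * a0 + 3 * a1 + 4 * a2 + 3 * a3 + 2 * a4 + a5 + 2 * a6) ^ 2 ≤ 1 := by
    refine pow_le_one₀ ?_ hS
    positivity
  have hz : ∀ x : ℝ, x ^ 2 ≤ 0 → x = 0 := fun x hx => pow_eq_zero_iff two_ne_zero |>.1
    (le_antisymm hx (sq_nonneg x))
  have hq : ∀ x : ℝ, 0 ≤ x ^ 2 := fun x => sq_nonneg x
  -- The same comparison with the factor 3/2; only the square of the variable of the end node with
  -- mark 1 escapes.
  have key : a0 ^ 2 + a1 ^ 2 + a2 ^ 2 + a3 ^ 2 + a4 ^ 2 + a6 ^ 2 ≤ 0 := by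
    linarith
      [mul_nonneg h0 h1, mul_nonneg h0 h2, mul_nonneg h0 h3, mul_nonneg h0 h4, mul_nonneg h0 h5,
      mul_nonneg h0 h6, mul_nonneg h1 h2, mul_nonneg h1 h3, mul_nonneg h1 h4, mul_nonneg h1 h5,
      mul_nonneg h1 h6, mul_nonneg h2 h3, mul_nonneg h2 h4, mul_nonneg h2 h5, mul_nonneg h2 h6,
      mul_nonneg h3 h4, mul_nonneg h3 h5, mul_nonneg h3 h6, mul_nonneg h4 h5, mul_nonneg h4 h6,
      mul_nonneg h5 h6, hq a0, hq a1, hq a2, hq a3, hq a4, hq a5, hq a6]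
  have e0 : a0 = 0 := hz _ (by linarith [hq a0, hq a1, hq a2, hq a3, hq a4, hq a5, hq a6])
  have e1 : a1 = 0 := hz _ (by linarith [hq a0, hq a1, hq a2, hq a3, hq a4, hq a5, hq a6])
  have e2 : a2 = 0 := hz _ (by linarith [hq a0, hq a1, hq a2, hq a3, hq a4, hq a5, hq a6])
  have e3 : a3 = 0 := hz _ (by linarith [hq a0, hq a1, hq a2, hq a3, hq a4, hq a5, hq a6])
  have e4 : a4 = 0 := hz _ (by linarith [hq a0, hq a1, hq a2, hq a3, hq a4, hq a5, hq a6])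
  have e6 : a6 = 0 := hz _ (by linarith [hq a0, hq a1, hq a2, hq a3, hq a4, hq a5, hq a6])
  subst e0 e1 e2 e3 e4 e6
  have h : 1 ≤ a5 ^ 2 := by linarith
  have h' : a5 ≤ 1 := by linarith
  have : a5 = 1 := by nlinarith only [h, h', h5]
  simp [this]

/-- The vertices of maximal norm of the fundamental alcove of `E_8`, in the coordinates given by the
simple roots. -/
lemma alcove_E8 {a0 a1 a2 a3 a4 a5 a6 a7 : ℝ} (h0 : 0 ≤ a0) (h1 : 0 ≤ a1) (h2 : 0 ≤ a2) (h3 : 0 ≤ a3) (h4 : 0 ≤ a4) (h5 : 0 ≤ a5) (h6 : 0 ≤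
    a6) (h7 : 0 ≤ a7)
    (hS : 2 * a0 + 3 * a1 + 4 * a2 + 6 * a3 + 5 * a4 + 4 * a5 + 3 * a6 + 2 * a7 ≤ 1)
    (hR : 1 ≤ (1 / 2 * a1 - 1 / 2 * a2) ^ 2 + (1 / 2 * a1 + 1 / 2 * a2) ^ 2 + (1 / 2 * a1 + 1 / 2 * a2 + a3)
    ^ 2 + (1 / 2 * a1 + 1 / 2 * a2 + a3 + a4) ^ 2 + (1 / 2 * a1 + 1 / 2 * a2 + a3 + a4 + a5) ^ 2 +
    (1 / 2 * a1 + 1 / 2 * a2 + a3 + a4 + a5 + a6) ^ 2 + (1 / 2 * a1 + 1 / 2 * a2 + a3 + a4 + a5 +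
    a6 + a7) ^ 2 + (2 * a0 + 5 / 2 * a1 + 7 / 2 * a2 + 5 * a3 + 4 * a4 + 3 * a5 + 2 * a6 + a7) ^
    2) :
    a1 = 0 ∧ a2 = 0 ∧ a3 = 0 ∧ a4 = 0 ∧ a5 = 0 ∧ a6 = 0 ∧ a7 = 0 ∧ a0 = 1 / 2 := by
  have hS2 : (2 * a0 + 3 * a1 + 4 * a2 + 6 * a3 + 5 * a4 + 4 * a5 + 3 * a6 + 2 * a7) ^ 2 ≤ 1 := by
    refine pow_le_one₀ ?_ hS
    positivity
  have hz : ∀ x : ℝ, x ^ 2 ≤ 0 → x = 0 := fun x hx => pow_eq_zero_iff two_ne_zero |>.1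
    (le_antisymm hx (sq_nonneg x))
  have hq : ∀ x : ℝ, 0 ≤ x ^ 2 := fun x => sq_nonneg x
  -- The same comparison with the factor 1. The remaining variable a0 has mark 2 in the highest
  -- root, so the vertex is half a fundamental weight.
  have key : a1 ^ 2 + a2 ^ 2 + a3 ^ 2 + a4 ^ 2 + a5 ^ 2 + a6 ^ 2 + a7 ^ 2 ≤ 0 := by
    linarith
      [mul_nonneg h0 h1, mul_nonneg h0 h2, mul_nonneg h0 h3, mul_nonneg h0 h4, mul_nonneg h0 h5,
      mul_nonneg h0 h6, mul_nonneg h0 h7, mul_nonneg h1 h2, mul_nonneg h1 h3, mul_nonneg h1 h4,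
      mul_nonneg h1 h5, mul_nonneg h1 h6, mul_nonneg h1 h7, mul_nonneg h2 h3, mul_nonneg h2 h4,
      mul_nonneg h2 h5, mul_nonneg h2 h6, mul_nonneg h2 h7, mul_nonneg h3 h4, mul_nonneg h3 h5,
      mul_nonneg h3 h6, mul_nonneg h3 h7, mul_nonneg h4 h5, mul_nonneg h4 h6, mul_nonneg h4 h7,
      mul_nonneg h5 h6, mul_nonneg h5 h7, mul_nonneg h6 h7, hq a0, hq a1, hq a2, hq a3, hq a4, hq
      a5, hq a6, hq a7]
  have e1 : a1 = 0 := hz _ (by linarith [hq a0, hq a1, hq a2, hq a3, hq a4, hq a5, hq a6, hq a7])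
  have e2 : a2 = 0 := hz _ (by linarith [hq a0, hq a1, hq a2, hq a3, hq a4, hq a5, hq a6, hq a7])
  have e3 : a3 = 0 := hz _ (by linarith [hq a0, hq a1, hq a2, hq a3, hq a4, hq a5, hq a6, hq a7])
  have e4 : a4 = 0 := hz _ (by linarith [hq a0, hq a1, hq a2, hq a3, hq a4, hq a5, hq a6, hq a7])
  have e5 : a5 = 0 := hz _ (by linarith [hq a0, hq a1, hq a2, hq a3, hq a4, hq a5, hq a6, hq a7])
  have e6 : a6 = 0 := hz _ (by linarith [hq a0, hq a1, hq a2, hq a3, hq a4, hq a5, hq a6, hq a7])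
  have e7 : a7 = 0 := hz _ (by linarith [hq a0, hq a1, hq a2, hq a3, hq a4, hq a5, hq a6, hq a7])
  subst e1 e2 e3 e4 e5 e6 e7
  have h : 1 ≤ 4 * a0 ^ 2 := by linarith
  have h' : a0 ≤ 1 / 2 := by linarith
  have : a0 = 1 / 2 := by nlinarith only [h, h', h0]
  simp [this]

/-! ### Integer models of the E-lattices, simple roots and diagram symmetries -/

section TypeE

/-- The vector `a / 2` for an integer vector `a`. -/
def ofInt (a : Fin 8 → ℤ) : EuclideanSpace ℝ (Fin 8) := WithLp.toLp 2 fun i => (a i : ℝ) / 2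

lemma ofInt_apply (a : Fin 8 → ℤ) (i : Fin 8) : ofInt a i = (a i : ℝ) / 2 := rfl

lemma inner_ofInt (a : Fin 8 → ℤ) (x : EuclideanSpace ℝ (Fin 8)) :
    ⟪ofInt a, x⟫_ℝ = ∑ i, (a i : ℝ) / 2 * x i := inner_eq_sum _ _

lemma inner_ofInt_ofInt (a b : Fin 8 → ℤ) :
    ⟪ofInt a, ofInt b⟫_ℝ = ((∑ i, a i * b i : ℤ) : ℝ) / 4 := by
  rw [inner_ofInt]
  push_cast
  rw [Finset.sum_div]
  exact Finset.sum_congr rfl fun i _ => by rw [ofInt_apply]; ring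

lemma norm_ofInt_sq (a : Fin 8 → ℤ) : ‖ofInt a‖ ^ 2 = ((∑ i, a i * a i : ℤ) : ℝ) / 4 := by
  rw [← real_inner_self_eq_norm_sq, inner_ofInt_ofInt]

lemma sum_ofInt (a : Fin 8 → ℤ) : ∑ i, ofInt a i = ((∑ i, a i : ℤ) : ℝ) / 2 := by
  push_cast
  rw [Finset.sum_div]
  rfl

/-- The integer vectors `a` with `a / 2` in `E_8`. -/
def IsE8Int (a : Fin 8 → ℤ) : Prop :=
  ((∀ i, a i % 2 = 0) ∨ ∀ i, a i % 2 = 1) ∧ (∑ i, a i) % 4 = 0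

instance (a : Fin 8 → ℤ) : Decidable (IsE8Int a) := by unfold IsE8Int; infer_instance

lemma halfOnes_apply (i : Fin 8) : halfOnes i = 1 / 2 := rfl

lemma mem_latticeE8_iff {x : EuclideanSpace ℝ (Fin 8)} :
    x ∈ latticeE8 ↔ ∃ a, x = ofInt a ∧ IsE8Int a := by
  constructor
  · rintro (⟨h, m, hm⟩ | ⟨h, m, hm⟩)
    · choose k hk using h
      have hs : ∑ i, k i = 2 * m := by
        simp only [hk] at hm
        exact_mod_cast hm
      refine ⟨fun i => 2 * k i, ?_, Or.inl fun i => by dsimp only; omega, ?_⟩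
      · ext i; rw [hk, ofInt_apply]; push_cast; ring
      · rw [← Finset.mul_sum, hs]; omega
    · choose k hk using h
      have hs : ∑ i, k i = 2 * m := by
        simp only [hk] at hm
        exact_mod_cast hm
      refine ⟨fun i => 2 * k i + 1, ?_, Or.inr fun i => by dsimp only; omega, ?_⟩
      · ext i
        have := hk i
        rw [PiLp.sub_apply, halfOnes_apply] at this
        rw [ofInt_apply]; push_cast; linarith
      · rw [Finset.sum_add_distrib, ← Finset.mul_sum, hs]
        simp; omega
  · rintro ⟨a, rfl, h | h, hs⟩
    · left
      refine ⟨fun i => ⟨a i / 2, ?_⟩, (∑ i, a i) / 4, ?_⟩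
      · rw [ofInt_apply]
        have : a i = 2 * (a i / 2) := by have := h i; omega
        rw [this]; push_cast; simp
      · rw [sum_ofInt]
        have : ∑ i, a i = 4 * ((∑ i, a i) / 4) := by omega
        rw [this]; push_cast
        rw [Int.mul_ediv_cancel_left _ (by norm_num)]
        ring
    · right
      refine ⟨fun i => ⟨a i / 2, ?_⟩, (∑ i, a i) / 4 - 2, ?_⟩
      · rw [PiLp.sub_apply, ofInt_apply, halfOnes_apply]
        have : a i = 2 * (a i / 2) + 1 := by have := h i; omega
        rw [this]; push_cast
        have e : (2 * (a i / 2) + 1) / 2 = a i / 2 := by omega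
        rw [e]; ring
      · simp only [PiLp.sub_apply, Finset.sum_sub_distrib, sum_ofInt, halfOnes_apply]
        have : ∑ i, a i = 4 * ((∑ i, a i) / 4) := by omega
        rw [this]; push_cast
        rw [Int.mul_ediv_cancel_left _ (by norm_num)]
        simp; ring

lemma mem_latticeE7_iff {x : EuclideanSpace ℝ (Fin 8)} :
    x ∈ latticeE7 ↔ ∃ a, x = ofInt a ∧ IsE8Int a ∧ ∑ i, a i = 0 := by
  constructor
  · rintro ⟨h, hs⟩
    obtain ⟨a, rfl, ha⟩ := mem_latticeE8_iff.1 h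
    refine ⟨a, rfl, ha, ?_⟩
    rw [sum_ofInt] at hs
    have : ((∑ i, a i : ℤ) : ℝ) = 0 := by linarith
    exact_mod_cast this
  · rintro ⟨a, rfl, ha, hs⟩
    exact ⟨mem_latticeE8_iff.2 ⟨a, rfl, ha⟩, by rw [sum_ofInt, hs]; simp⟩

lemma mem_latticeE6_iff {x : EuclideanSpace ℝ (Fin 8)} :
    x ∈ latticeE6 ↔ ∃ a, x = ofInt a ∧ IsE8Int a ∧ ∑ i, a i = 0 ∧ a 0 + a 7 = 0 := by
  constructor
  · rintro ⟨h, hs⟩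
    obtain ⟨a, rfl, ha, ha'⟩ := mem_latticeE7_iff.1 h
    refine ⟨a, rfl, ha, ha', ?_⟩
    rw [ofInt_apply, ofInt_apply] at hs
    have : ((a 0 + a 7 : ℤ) : ℝ) = 0 := by push_cast; linarith
    exact_mod_cast this
  · rintro ⟨a, rfl, ha, ha', hs⟩
    refine ⟨mem_latticeE7_iff.2 ⟨a, rfl, ha, ha'⟩, ?_⟩
    have : ((a 0 + a 7 : ℤ) : ℝ) = 0 := by rw [hs]; simp
    push_cast at this
    rw [ofInt_apply, ofInt_apply]
    linarith

/-- All coordinates of an element of `E_8` are congruent modulo `1`. -/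
lemma IsE8Int.exists_sub {a : Fin 8 → ℤ} (ha : IsE8Int a) : ∃ b : Fin 8 → ℤ,
    ∀ i, a i = a 0 + 2 * b i := by
  refine ⟨fun i => (a i - a 0) / 2, fun i => ?_⟩
  rcases ha.1 with h | h
  all_goals
    have h1 := h i
    have h2 := h 0
    dsimp only
    omega

/-- The simple roots of `E_6`, multiplied by `2`. -/
def simpleE6 : Fin 6 → Fin 8 → ℤ :=
  ![![0, 2, -2, 0, 0, 0, 0, 0], ![0, 0, 2, -2, 0, 0, 0, 0], ![0, 0, 0, 2, -2, 0, 0, 0],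
    ![0, 0, 0, 0, 2, -2, 0, 0], ![0, 0, 0, 0, 0, 2, -2, 0], ![-1, -1, -1, -1, 1, 1, 1, 1]]

/-- The simple roots of `E_7`, multiplied by `2`. -/
def simpleE7 : Fin 7 → Fin 8 → ℤ :=
  ![![0, 2, -2, 0, 0, 0, 0, 0], ![0, 0, 2, -2, 0, 0, 0, 0], ![0, 0, 0, 2, -2, 0, 0, 0],
    ![0, 0, 0, 0, 2, -2, 0, 0], ![0, 0, 0, 0, 0, 2, -2, 0], ![0, 0, 0, 0, 0, 0, 2, -2],
    ![-1, -1, -1, -1, 1, 1, 1, 1]]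

/-- The simple roots of `E_8`, multiplied by `2`. -/
def simpleE8 : Fin 8 → Fin 8 → ℤ :=
  ![![1, -1, -1, -1, -1, -1, -1, 1], ![2, 2, 0, 0, 0, 0, 0, 0], ![-2, 2, 0, 0, 0, 0, 0, 0],
    ![0, -2, 2, 0, 0, 0, 0, 0], ![0, 0, -2, 2, 0, 0, 0, 0], ![0, 0, 0, -2, 2, 0, 0, 0],
    ![0, 0, 0, 0, -2, 2, 0, 0], ![0, 0, 0, 0, 0, -2, 2, 0]]

/-- The entries of the Cartan matrix of type `E_6`. -/
def cartanE6 : Fin 6 → Fin 6 → ℤ :=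
  ![![2, -1, 0, 0, 0, 0], ![-1, 2, -1, 0, 0, 0], ![0, -1, 2, -1, 0, -1], ![0, 0, -1, 2, -1, 0],
    ![0, 0, 0, -1, 2, 0], ![0, 0, -1, 0, 0, 2]]

/-- The entries of the Cartan matrix of type `E_7`. -/
def cartanE7 : Fin 7 → Fin 7 → ℤ :=
  ![![2, -1, 0, 0, 0, 0, 0], ![-1, 2, -1, 0, 0, 0, 0], ![0, -1, 2, -1, 0, 0, -1],
    ![0, 0, -1, 2, -1, 0, 0], ![0, 0, 0, -1, 2, -1, 0], ![0, 0, 0, 0, -1, 2, 0],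
    ![0, 0, -1, 0, 0, 0, 2]]

set_option synthInstance.maxHeartbeats 400000 in
set_option synthInstance.maxSize 4096 in
-- The branch node is the only one with three mutually nonadjacent neighbours, and the arms grow
-- outwards from it. The hypotheses are interleaved with the quantifiers to prune the finite search;
-- only the identity and the flip survive.
lemma cartanE6_automorphism : ∀ s2 s1 : Fin 6, cartanE6 s2 s1 = -1 → ∀ s3, cartanE6 s2 s3 = -1 →
    cartanE6 s1 s3 = 0 → ∀ s5, cartanE6 s2 s5 = -1 → cartanE6 s1 s5 = 0 → cartanE6 s3 s5 = 0 →
    ∀ s0, cartanE6 s0 s1 = -1 → cartanE6 s0 s2 = 0 →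
    ∀ s4, cartanE6 s4 s3 = -1 → cartanE6 s4 s2 = 0 →
    s5 = 5 ∧ s2 = 2 ∧ (s0 = 0 ∧ s1 = 1 ∧ s3 = 3 ∧ s4 = 4 ∨ s0 = 4 ∧ s1 = 3 ∧ s3 = 1 ∧ s4 = 0) := by
  decide +kernel

set_option synthInstance.maxHeartbeats 400000 in
set_option synthInstance.maxSize 4096 in
-- The three arms at the branch node have different lengths, so nothing can be permuted.
lemma cartanE7_automorphism : ∀ s2 s1 : Fin 7, cartanE7 s2 s1 = -1 → ∀ s3, cartanE7 s2 s3 = -1 →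
    cartanE7 s1 s3 = 0 → ∀ s6, cartanE7 s2 s6 = -1 → cartanE7 s1 s6 = 0 → cartanE7 s3 s6 = 0 →
    ∀ s0, cartanE7 s0 s1 = -1 → cartanE7 s0 s2 = 0 →
    ∀ s4, cartanE7 s4 s3 = -1 → cartanE7 s4 s2 = 0 →
    ∀ s5, cartanE7 s5 s4 = -1 → cartanE7 s5 s3 = 0 →
    [s0, s1, s2, s3, s4, s5, s6] = [0, 1, 2, 3, 4, 5, 6] := by
  decide +kernel

lemma inner_simpleE6 : ∀ i j, ∑ k, simpleE6 i k * simpleE6 j k = 4 * cartanE6 i j := by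
  decide +kernel

lemma inner_simpleE7 : ∀ i j, ∑ k, simpleE7 i k * simpleE7 j k = 4 * cartanE7 i j := by
  decide +kernel

lemma span_simpleE6 (x : EuclideanSpace ℝ (Fin 8)) (hx : x ∈ latticeE6) :
    ∃ n : Fin 6 → ℤ, x = ∑ i, (n i : ℝ) • ofInt (simpleE6 i) := by
  obtain ⟨a, rfl, ha, hs, h7⟩ := mem_latticeE6_iff.1 hx
  obtain ⟨b, hb⟩ := ha.exists_sub
  -- Only the last simple root involves coordinate 0, which gives the coefficient −a 0. The others
  -- are then read off successively from coordinates 1, 2, … .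
  refine ⟨![b 1, b 1 + b 2, b 1 + b 2 + b 3, b 1 + b 2 + b 3 + b 4 + a 0,
    b 1 + b 2 + b 3 + b 4 + b 5 + 2 * a 0, -a 0], ?_⟩
  rw [Fin.sum_univ_eight] at hs
  have hs' : (a 0 + a 1 + a 2 + a 3 + a 4 + a 5 + a 6 + a 7 : ℝ) = 0 := by exact_mod_cast hs
  have h7' : (a 0 + a 7 : ℝ) = 0 := by exact_mod_cast h7
  have hb' : ∀ i, (a i : ℝ) = a 0 + 2 * b i := fun i => by exact_mod_cast hb i
  have := hb' 1; have := hb' 2; have := hb' 3; have := hb' 4; have := hb' 5; have := hb' 6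
  ext i
  fin_cases i <;> simp [Fin.sum_univ_succ, ofInt_apply, simpleE6] <;> linarith

lemma span_simpleE7 (x : EuclideanSpace ℝ (Fin 8)) (hx : x ∈ latticeE7) :
    ∃ n : Fin 7 → ℤ, x = ∑ i, (n i : ℝ) • ofInt (simpleE7 i) := by
  obtain ⟨a, rfl, ha, hs⟩ := mem_latticeE7_iff.1 hx
  obtain ⟨b, hb⟩ := ha.exists_sub
  refine ⟨![b 1, b 1 + b 2, b 1 + b 2 + b 3, b 1 + b 2 + b 3 + b 4 + a 0,
    b 1 + b 2 + b 3 + b 4 + b 5 + 2 * a 0, b 1 + b 2 + b 3 + b 4 + b 5 + b 6 + 3 * a 0, -a 0], ?_⟩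
  rw [Fin.sum_univ_eight] at hs
  have hs' : (a 0 + a 1 + a 2 + a 3 + a 4 + a 5 + a 6 + a 7 : ℝ) = 0 := by exact_mod_cast hs
  have hb' : ∀ i, (a i : ℝ) = a 0 + 2 * b i := fun i => by exact_mod_cast hb i
  have := hb' 1; have := hb' 2; have := hb' 3; have := hb' 4; have := hb' 5; have := hb' 6
  have := hb' 7
  ext i
  fin_cases i <;> simp [Fin.sum_univ_succ, ofInt_apply, simpleE7] <;> linarith

variable {E : Type*} [NormedAddCommGroup E] [InnerProductSpace ℝ E] {L : Submodule ℤ E}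
  {M : Submodule ℤ (EuclideanSpace ℝ (Fin 8))} {φ : E →ₗᵢ[ℝ] EuclideanSpace ℝ (Fin 8)}

/-- In doubled coordinates all conditions are decidable statements about integers. Inner products
are scaled by 4, so 8 stands for the value 2. -/
lemma isSimpleSystem_of_int {ι : Type*} [Fintype ι] {A : ι → Fin 8 → ℤ} {R : Fin 8 → ℤ}
    {C : ι → ℤ} (hφ : ∀ x, φ x ∈ M ↔ x ∈ L) {α : ι → E} {ρ : E} (hα : ∀ i, φ (α i) = ofInt (A i))
    (hρ : φ ρ = ofInt R) (hmem : ∀ i, ofInt (A i) ∈ M) (hR : ofInt R ∈ M)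
    (hnorm : ∀ i, ∑ k, A i k * A i k = 8) (hneg : ∀ i j, i ≠ j → ∑ k, A i k * A j k ≤ 0)
    (hAR : ∀ i, ∑ k, A i k * R k = 8) (hC : ∀ i, 0 ≤ C i) (hRC : ∀ k, R k = ∑ i, C i * A i k)
    (hspan : ∀ x ∈ M, ∃ n : ι → ℤ, x = ∑ i, (n i : ℝ) • ofInt (A i)) :
    IsSimpleSystem L α ρ where
  mem i := by rw [← hφ, hα]; exact hmem i
  norm_sq i := by rw [← φ.norm_map, hα, norm_ofInt_sq, hnorm]; norm_num
  inner_nonpos i j hij := by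
    rw [← φ.inner_map_map, hα, hα, inner_ofInt_ofInt]
    have : ((∑ k, A i k * A j k : ℤ) : ℝ) ≤ 0 := by exact_mod_cast hneg i j hij
    linarith
  rho_mem := by rw [← hφ, hρ]; exact hR
  inner_rho i := by rw [← φ.inner_map_map, hα, hρ, inner_ofInt_ofInt, hAR]; norm_num
  rho_eq := by
    refine ⟨fun i => C i, fun i => Int.cast_nonneg (hC i), φ.injective ?_⟩
    rw [hρ, map_sum]
    simp only [map_smul, hα]
    ext k
    simp only [ofInt_apply, hRC, WithLp.ofLp_sum, Finset.sum_apply, PiLp.smul_apply, smul_eq_mul]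
    push_cast
    rw [Finset.sum_div]
    exact Finset.sum_congr rfl fun i _ => by ring
  span x hx := by
    obtain ⟨n, hn⟩ := hspan _ ((hφ x).2 hx)
    refine ⟨n, φ.injective ?_⟩
    rw [hn, map_sum]
    simp only [map_smul, hα]

lemma inner_map_eq_zero [DiscreteTopology L] [IsZLattice ℝ L] (hφ : ∀ x, φ x ∈ M ↔ x ∈ L)
    {v : EuclideanSpace ℝ (Fin 8)} (hv : ∀ y ∈ M, ⟪v, y⟫_ℝ = 0) (x : E) : ⟪v, φ x⟫_ℝ = 0 := by
  have hx : x ∈ Submodule.span ℝ (L : Set E) := by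
    rw [IsZLattice.span_top]; trivial
  induction hx using Submodule.span_induction with
  | mem x hx => exact hv _ ((hφ x).2 hx)
  | zero => simp
  | add x y _ _ hx hy => rw [map_add, inner_add_right, hx, hy, add_zero]
  | smul a x _ hx => rw [map_smul, inner_smul_right, hx, mul_zero]

/-- Up to the action of the affine Weyl group, a deep hole lies in the fundamental alcove. -/
lemma IsDeepHole.exists_dominant [FiniteDimensional ℝ E] [DiscreteTopology L]
    (hL : IsRootLattice L) {c : E} (hc : IsDeepHole L c) {c₀ : E} {R : ℝ}
    (hR : ∀ x ∈ L, R ≤ ‖x - c₀‖ ^ 2) {ι : Type*} [Fintype ι] {α : ι → E} {ρ : E}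
    (hmem : ∀ i, α i ∈ L) (hnorm : ∀ i, ‖α i‖ ^ 2 = 2) (hρ : ρ ∈ L)
    (hαρ : ∀ i, 0 < ⟪α i, ρ⟫_ℝ) :
    ∃ z, Nonempty (linearStabilizer L c ≃* linearStabilizer L z) ∧ R ≤ ‖z‖ ^ 2 ∧
      (∀ i, 0 ≤ ⟪α i, z⟫_ℝ) ∧ ∀ r ∈ L, ‖r‖ ^ 2 = 2 → ⟪r, z⟫_ℝ ≤ 1 := by
  obtain ⟨t, ht, htR, htr⟩ := hc.exists_translate hR
  obtain ⟨w, hw, hdom⟩ := exists_weylGroup_dominant hL hmem hnorm hρ hαρ (c - t)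
  have hwL : ∀ x, w x ∈ L ↔ x ∈ L := weylGroup_le_orthogonalGroup hL.integral hw
  refine ⟨w (c - t), ?_, by rwa [w.norm_map], hdom, fun r hr hr2 => ?_⟩
  · rw [linearStabilizer_congr (c := c) (c' := c - t) (by rwa [sub_sub_cancel])]
    exact nonempty_linearStabilizer_mulEquiv w hwL _
  · have h1 := htr (w.symm r) (by rw [← hwL, w.apply_symm_apply]; exact hr)
      (by rwa [LinearIsometryEquiv.norm_map])
    rwa [← w.inner_map_map, w.apply_symm_apply, real_inner_comm] at h1

end TypeE

/-! ### Stabilizers for E_6 and E_7 -/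

section TypeE

variable {E : Type*} [NormedAddCommGroup E] [InnerProductSpace ℝ E] {L : Submodule ℤ E}
  {φ : E →ₗᵢ[ℝ] EuclideanSpace ℝ (Fin 8)}

lemma IsSimpleSystem.eq_one [DiscreteTopology L] [IsZLattice ℝ L] {ι : Type*} [Fintype ι]
    {α : ι → E} {ρ : E} (hα : IsSimpleSystem L α ρ) {g : E ≃ₗᵢ[ℝ] E}
    (hg : ∀ i, g (α i) = α i) : g = 1 := by
  refine LinearIsometryEquiv.ext fun x => ?_
  change g x = x
  have hx : x ∈ Submodule.span ℝ (L : Set E) := by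
    rw [IsZLattice.span_top]; trivial
  induction hx using Submodule.span_induction with
  | mem x hx =>
    obtain ⟨n, rfl⟩ := hα.span x hx
    rw [map_sum]
    simp only [map_smul, hg]
  | zero => simp
  | add x y _ _ hx hy => rw [map_add, hx, hy]
  | smul a x _ hx => rw [map_smul, hx]

lemma cartan_eq_of_permutes {ι : Type*} {A : ι → Fin 8 → ℤ} {C : ι → ι → ℤ}
    (hAC : ∀ i j, ∑ k, A i k * A j k = 4 * C i j) {α : ι → E}
    (hα : ∀ i, φ (α i) = ofInt (A i)) {g : E ≃ₗᵢ[ℝ] E} {σ : ι → ι}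
    (hσ : ∀ i, g (α i) = α (σ i)) (i j : ι) : C (σ i) (σ j) = C i j := by
  have h : ∀ i j, ⟪α i, α j⟫_ℝ = C i j := fun i j => by
    rw [← φ.inner_map_map, hα, hα, inner_ofInt_ofInt, hAC]
    push_cast
    ring
  have h1 := g.inner_map_map (α i) (α j)
  rw [hσ, hσ, h, h] at h1
  exact_mod_cast h1

lemma isSimpleSystem_E7 (hφ : ∀ x, φ x ∈ latticeE7 ↔ x ∈ L) {α : Fin 7 → E} {ρ : E}
    (hα : ∀ i, φ (α i) = ofInt (simpleE7 i)) (hρ : φ ρ = ofInt ![-49, 19, 15, 11, 7, 3, -1, -5]) :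
    IsSimpleSystem L α ρ :=
  -- C holds the coefficients of the sum of the positive roots in the simple roots.
  isSimpleSystem_of_int (C := ![34, 66, 96, 75, 52, 27, 49]) hφ hα hρ
    (fun i => mem_latticeE7_iff.2 ⟨_, rfl, by revert i; decide +kernel⟩)
    (mem_latticeE7_iff.2 ⟨_, rfl, by decide +kernel⟩) (by decide +kernel) (by decide +kernel)
    (by decide +kernel) (by decide +kernel) (by decide +kernel) span_simpleE7

lemma isSimpleSystem_E6 (hφ : ∀ x, φ x ∈ latticeE6 ↔ x ∈ L) {α : Fin 6 → E} {ρ : E}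
    (hα : ∀ i, φ (α i) = ofInt (simpleE6 i)) (hρ : φ ρ = ofInt ![-22, 10, 6, 2, -2, -6, -10, 22]) :
    IsSimpleSystem L α ρ :=
  isSimpleSystem_of_int (C := ![16, 30, 42, 30, 16, 22]) hφ hα hρ
    (fun i => mem_latticeE6_iff.2 ⟨_, rfl, by revert i; decide +kernel⟩)
    (mem_latticeE6_iff.2 ⟨_, rfl, by decide +kernel⟩) (by decide +kernel) (by decide +kernel)
    (by decide +kernel) (by decide +kernel) (by decide +kernel) span_simpleE6

lemma exists_simple {M : Submodule ℤ (EuclideanSpace ℝ (Fin 8))} {ι : Type*}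
    (hφ' : ∀ y ∈ M, ∃ x ∈ L, φ x = y) {A : ι → Fin 8 → ℤ} (hA : ∀ i, ofInt (A i) ∈ M) :
    ∃ α : ι → E, ∀ i, φ (α i) = ofInt (A i) := by
  have h : ∀ i, ∃ x, φ x = ofInt (A i) := fun i => by
    obtain ⟨x, -, hx⟩ := hφ' _ (hA i)
    exact ⟨x, hx⟩
  choose α hα using h
  exact ⟨α, hα⟩

lemma exists_simpleSystem_E7 (hφ : ∀ x, φ x ∈ latticeE7 ↔ x ∈ L)
    (hφ' : ∀ y ∈ latticeE7, ∃ x ∈ L, φ x = y) :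
    ∃ (α : Fin 7 → E) (ρ : E), (∀ i, φ (α i) = ofInt (simpleE7 i)) ∧ IsSimpleSystem L α ρ := by
  obtain ⟨α, hα⟩ := exists_simple hφ' (A := simpleE7) fun i =>
    mem_latticeE7_iff.2 ⟨_, rfl, by revert i; decide +kernel⟩
  obtain ⟨ρ, -, hρ⟩ := hφ' (ofInt ![-49, 19, 15, 11, 7, 3, -1, -5])
    (mem_latticeE7_iff.2 ⟨_, rfl, by decide +kernel⟩)
  exact ⟨α, ρ, hα, isSimpleSystem_E7 hφ hα hρ⟩

lemma exists_simpleSystem_E6 (hφ : ∀ x, φ x ∈ latticeE6 ↔ x ∈ L)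
    (hφ' : ∀ y ∈ latticeE6, ∃ x ∈ L, φ x = y) :
    ∃ (α : Fin 6 → E) (ρ : E), (∀ i, φ (α i) = ofInt (simpleE6 i)) ∧ IsSimpleSystem L α ρ := by
  obtain ⟨α, hα⟩ := exists_simple hφ' (A := simpleE6) fun i =>
    mem_latticeE6_iff.2 ⟨_, rfl, by revert i; decide +kernel⟩
  obtain ⟨ρ, -, hρ⟩ := hφ' (ofInt ![-22, 10, 6, 2, -2, -6, -10, 22])
    (mem_latticeE6_iff.2 ⟨_, rfl, by decide +kernel⟩)
  exact ⟨α, ρ, hα, isSimpleSystem_E6 hφ hα hρ⟩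

lemma norm_ofInt_root {a : Fin 8 → ℤ} (ha : ∑ i, a i * a i = 8) : ‖ofInt a‖ ^ 2 = 2 := by
  rw [norm_ofInt_sq, ha]
  norm_num

variable [FiniteDimensional ℝ E] [DiscreteTopology L] [IsZLattice ℝ L]

/-- Modulo the Weyl group an isometry permutes the simple roots compatibly with the Cartan matrix;
for E_7 this leaves only the identity. -/
lemma orthogonalGroup_eq_weylGroup_E7 (hL : IsRootLattice L) (h : Isometric L latticeE7) :
    orthogonalGroup L = weylGroup L := by
  obtain ⟨φ, hφ, hφ'⟩ := h.exists_linearIsometry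
  obtain ⟨α, ρ, hα, hS⟩ := exists_simpleSystem_E7 hφ hφ'
  refine le_antisymm (fun g hg => ?_) (weylGroup_le_orthogonalGroup hL.integral)
  obtain ⟨w, hw, σ, hσ⟩ := hS.exists_permutes hL hg
  have hC := cartan_eq_of_permutes inner_simpleE7 hα hσ
  have h1 := cartanE7_automorphism (σ 2) (σ 1) (hC 2 1) (σ 3) (hC 2 3) (hC 1 3) (σ 6) (hC 2 6)
    (hC 1 6) (hC 3 6) (σ 0) (hC 0 1) (hC 0 2) (σ 4) (hC 4 3) (hC 4 2) (σ 5) (hC 5 4) (hC 5 3)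
  simp only [List.cons.injEq, and_true] at h1
  obtain ⟨h0, h1, h2, h3, h4, h5, h6⟩ := h1
  have hfix : ∀ i, σ i = i := by
    intro i
    fin_cases i <;> assumption
  have := hS.eq_one fun i => (hσ i).trans (congrArg α (hfix i))
  rw [eq_inv_of_mul_eq_one_right this]
  exact inv_mem hw

/-- Products of consecutive integers are nonnegative, which bounds each squared coordinate
difference below by an affine function. The slopes agree within each of the integral and half-odd
cosets, so the zero coordinate sum turns the total into 3/2. -/
lemma norm_sq_ge_E7 {x : EuclideanSpace ℝ (Fin 8)} (hx : x ∈ latticeE7) :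
    3 / 2 ≤ ‖x - (1 / 2 : ℝ) • ofInt ![-3, 1, 1, 1, 1, 1, 1, -3]‖ ^ 2 := by
  obtain ⟨a, ha, hE, hs⟩ := mem_latticeE7_iff.1 hx
  rw [ha, EuclideanSpace.real_norm_sq_eq]
  have hmul : ∀ b : ℤ, (0 : ℝ) ≤ b * (b + 1) := fun b => by
    have : 0 ≤ b * (b + 1) := by rcases le_or_gt 0 b with h | h <;> nlinarith
    exact_mod_cast this
  rw [Fin.sum_univ_eight] at hs ⊢
  rcases hE.1 with h | h
  · have : ∀ i, ∃ m : ℤ, a i = 2 * m := fun i => ⟨a i / 2, by have := h i; omega⟩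
    choose m hm using this
    simp only [hm] at hs
    have hs' : (2 * m 0 + 2 * m 1 + 2 * m 2 + 2 * m 3 + 2 * m 4 + 2 * m 5 + 2 * m 6 +
      2 * m 7 : ℝ) = 0 := by exact_mod_cast hs
    simp [ofInt_apply, hm]
    have h0 := hmul (m 0)
    have h1 := hmul (m 1 - 1)
    have h2 := hmul (m 2 - 1)
    have h3 := hmul (m 3 - 1)
    have h4 := hmul (m 4 - 1)
    have h5 := hmul (m 5 - 1)
    have h6 := hmul (m 6 - 1)
    have h7 := hmul (m 7)
    push_cast at h0 h1 h2 h3 h4 h5 h6 h7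
    linarith
  · have : ∀ i, ∃ m : ℤ, a i = 2 * m + 1 := fun i => ⟨a i / 2, by have := h i; omega⟩
    choose m hm using this
    simp only [hm] at hs
    have hs' : (2 * m 0 + 1 + (2 * m 1 + 1) + (2 * m 2 + 1) + (2 * m 3 + 1) + (2 * m 4 + 1) +
      (2 * m 5 + 1) + (2 * m 6 + 1) + (2 * m 7 + 1) : ℝ) = 0 := by exact_mod_cast hs
    simp [ofInt_apply, hm]
    have h0 := hmul (m 0 + 1)
    have h1 := hmul (m 1)
    have h2 := hmul (m 2)
    have h3 := hmul (m 3)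
    have h4 := hmul (m 4)
    have h5 := hmul (m 5)
    have h6 := hmul (m 6)
    have h7 := hmul (m 7 + 1)
    push_cast at h0 h1 h2 h3 h4 h5 h6 h7
    linarith

/-- As for E_7, but the slopes agree only on the coordinates 1 to 6, whose sum vanishes separately
because those of index 0 and 7 cancel. -/
lemma norm_sq_ge_E6 {x : EuclideanSpace ℝ (Fin 8)} (hx : x ∈ latticeE6) :
    4 / 3 ≤ ‖x - (1 / 6 : ℝ) • ofInt ![-6, 10, -2, -2, -2, -2, -2, 6]‖ ^ 2 := by
  obtain ⟨a, ha, hE, hs, h07⟩ := mem_latticeE6_iff.1 hx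
  rw [ha, EuclideanSpace.real_norm_sq_eq]
  have hmul : ∀ b : ℤ, (0 : ℝ) ≤ b * (b + 1) := fun b => by
    have : 0 ≤ b * (b + 1) := by rcases le_or_gt 0 b with h | h <;> nlinarith
    exact_mod_cast this
  rw [Fin.sum_univ_eight] at hs ⊢
  rcases hE.1 with h | h
  · have : ∀ i, ∃ m : ℤ, a i = 2 * m := fun i => ⟨a i / 2, by have := h i; omega⟩
    choose m hm using this
    simp only [hm] at hs h07
    have hs' : (2 * m 0 + 2 * m 1 + 2 * m 2 + 2 * m 3 + 2 * m 4 + 2 * m 5 + 2 * m 6 +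
      2 * m 7 : ℝ) = 0 := by exact_mod_cast hs
    have h07' : (2 * m 0 + 2 * m 7 : ℝ) = 0 := by exact_mod_cast h07
    simp [ofInt_apply, hm]
    have h0 := hmul (m 0)
    have h1 := hmul (m 1 - 1)
    have h2 := hmul (m 2)
    have h3 := hmul (m 3)
    have h4 := hmul (m 4)
    have h5 := hmul (m 5)
    have h6 := hmul (m 6)
    have h7 := hmul (m 7 - 1)
    push_cast at h0 h1 h2 h3 h4 h5 h6 h7
    linarith
  · have : ∀ i, ∃ m : ℤ, a i = 2 * m + 1 := fun i => ⟨a i / 2, by have := h i; omega⟩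
    choose m hm using this
    simp only [hm] at hs h07
    have hs' : (2 * m 0 + 1 + (2 * m 1 + 1) + (2 * m 2 + 1) + (2 * m 3 + 1) + (2 * m 4 + 1) +
      (2 * m 5 + 1) + (2 * m 6 + 1) + (2 * m 7 + 1) : ℝ) = 0 := by exact_mod_cast hs
    have h07' : (2 * m 0 + 1 + (2 * m 7 + 1) : ℝ) = 0 := by exact_mod_cast h07
    simp [ofInt_apply, hm]
    have h0 := sq_nonneg ((m 0 : ℝ) + 1)
    have h1 := hmul (m 1 - 1)
    have h2 := hmul (m 2)
    have h3 := hmul (m 3)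
    have h4 := hmul (m 4)
    have h5 := hmul (m 5)
    have h6 := hmul (m 6)
    have h7 := sq_nonneg (m 7 : ℝ)
    push_cast at h0 h1 h2 h3 h4 h5 h6 h7
    linarith

/-- Modulo the Weyl group only the diagram flip could be added. It exchanges the two end weights,
whose difference does not lie in E_6. -/
lemma linearStabilizer_E6 (hL : IsRootLattice L) (hφ : ∀ x, φ x ∈ latticeE6 ↔ x ∈ L)
    {α : Fin 6 → E} {ρ : E} (hα : ∀ i, φ (α i) = ofInt (simpleE6 i)) (hS : IsSimpleSystem L α ρ)
    {z : E} {a : Fin 6 → ℝ} (ha : ∀ i, ⟪α i, z⟫_ℝ = a i) (z1 : a 1 = 0) (z2 : a 2 = 0)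
    (z3 : a 3 = 0) (z04 : a 0 = 1 ∧ a 4 = 0 ∨ a 0 = 0 ∧ a 4 = 1)
    (hWz : weylGroup L ≤ linearStabilizer L z) : linearStabilizer L z = weylGroup L := by
  refine le_antisymm (fun g hg => ?_) hWz
  obtain ⟨w, hw, σ, hσ⟩ := hS.exists_permutes hL hg.1
  have hwg : w * g ∈ linearStabilizer L z := mul_mem (hWz hw) hg
  have hC := cartan_eq_of_permutes inner_simpleE6 hα hσ
  obtain ⟨s5, s2, ⟨s0, s1, s3, s4⟩ | ⟨s0, s1, s3, s4⟩⟩ := cartanE6_automorphism (σ 2) (σ 1)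
    (hC 2 1) (σ 3) (hC 2 3) (hC 1 3) (σ 5) (hC 2 5) (hC 1 5) (hC 3 5) (σ 0) (hC 0 1) (hC 0 2)
    (σ 4) (hC 4 3) (hC 4 2)
  · have hfix : ∀ i, σ i = i := by
      intro i
      fin_cases i <;> assumption
    have := hS.eq_one fun i => (hσ i).trans (congrArg α (hfix i))
    rw [eq_inv_of_mul_eq_one_right this]
    exact inv_mem hw
  · exfalso
    obtain ⟨b, hb, hE, hs, h07⟩ := mem_latticeE6_iff.1 ((hφ _).2 hwg.2)
    -- If the flip fixed the class, (w g) z − z would be a lattice vector with these prescribed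
    -- pairings. Solving for its coordinates gives 3 b₂ = ±2.
    have hpair : ∀ i, ⟪α (σ i), (w * g) z - z⟫_ℝ = a i - a (σ i) := fun i => by
      rw [inner_sub_right, ha, ← hσ, LinearIsometryEquiv.inner_map_map, ha]
    simp only [← φ.inner_map_map (α _) (_ - _), hα, inner_ofInt, hb, ofInt_apply] at hpair
    have p0 := hpair 0
    have p1 := hpair 1
    have p2 := hpair 2
    have p3 := hpair 3
    have p4 := hpair 4
    simp [Fin.sum_univ_eight, simpleE6, s0, s1, s2, s3, s4, z1, z2, z3] at p0 p1 p2 p3 p4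
    rw [Fin.sum_univ_eight] at hs
    have hs' : (b 0 + b 1 + b 2 + b 3 + b 4 + b 5 + b 6 + b 7 : ℝ) = 0 := by exact_mod_cast hs
    have h07' : (b 0 + b 7 : ℝ) = 0 := by exact_mod_cast h07
    rcases z04 with ⟨z0, z4⟩ | ⟨z0, z4⟩
    · rw [z0, z4] at p0 p4
      have : ((3 * b 2 : ℤ) : ℝ) = 2 := by push_cast; linarith
      have : 3 * b 2 = 2 := by exact_mod_cast this
      omega
    · rw [z0, z4] at p0 p4
      have : ((3 * b 2 : ℤ) : ℝ) = -2 := by push_cast; linarith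
      have : 3 * b 2 = -2 := by exact_mod_cast this
      omega

lemma stabilizer_typeE7 (hL : IsRootLattice L) {c : E} (hc : IsDeepHole L c)
    (h : Isometric L latticeE7) : Nonempty (affineStabilizer L c ≃* weylGroup L) := by
  obtain ⟨φ, hφ, hφ'⟩ := h.exists_linearIsometry
  obtain ⟨α, ρ, hα, hS⟩ := exists_simpleSystem_E7 hφ hφ'
  obtain ⟨d, -, hd⟩ := hφ' (ofInt ![-3, 1, 1, 1, 1, 1, 1, -3])
    (mem_latticeE7_iff.2 ⟨_, rfl, by decide +kernel⟩)
  -- θ is the highest root for the chosen simple system; its pairing with z is the linear form of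
  -- `alcove_E7`.
  obtain ⟨θ, hθL, hθ⟩ := hφ' (ofInt ![-2, 2, 0, 0, 0, 0, 0, 0])
    (mem_latticeE7_iff.2 ⟨_, rfl, by decide +kernel⟩)
  have hsum : ∀ x, ∑ i, φ x i = 0 := fun x => by
    have := inner_map_eq_zero hφ (v := ofInt fun _ => 2) (fun y hy => by
      rw [inner_ofInt]
      simpa using hy.2) x
    rw [inner_ofInt] at this
    simpa using this
  obtain ⟨z, ⟨e⟩, hR, hdom, hroot⟩ := hc.exists_dominant hL (c₀ := (1 / 2 : ℝ) • d) (R := 3 / 2)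
    (fun x hx => by
      have := norm_sq_ge_E7 ((hφ x).2 hx)
      rwa [← hd, ← map_smul, ← map_sub, φ.norm_map] at this)
    hS.mem hS.norm_sq hS.rho_mem (fun i => by rw [hS.inner_rho]; norm_num)
  have hθ1 := hroot θ hθL (by rw [← φ.norm_map, hθ, norm_ofInt_root (by decide +kernel)])
  have hin : ∀ i, ⟪α i, z⟫_ℝ = ∑ j, (simpleE7 i j : ℝ) / 2 * φ z j := fun i => by
    rw [← φ.inner_map_map, hα, inner_ofInt]
  rw [← φ.inner_map_map, hθ, inner_ofInt] at hθ1
  rw [← φ.norm_map, EuclideanSpace.real_norm_sq_eq] at hR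
  have hz := hsum z
  obtain ⟨a, ha⟩ : ∃ a : Fin 7 → ℝ, ∀ i, ⟪α i, z⟫_ℝ = a i := ⟨_, fun i => rfl⟩
  simp only [ha] at hin hdom
  have e0 := hin 0
  have e1 := hin 1
  have e2 := hin 2
  have e3 := hin 3
  have e4 := hin 4
  have e5 := hin 5
  have e6 := hin 6
  simp [Fin.sum_univ_eight, simpleE7] at e0 e1 e2 e3 e4 e5 e6 hθ1 hz hR
  -- Inverting the pairings with the simple roots: the coefficients of aᵢ are the coordinates of the
  -- i-th fundamental weight.
  have u0 : φ z 0 = -a 0 - 2 * a 1 - 3 * a 2 - 9 / 4 * a 3 - 3 / 2 * a 4 - 3 / 4 * a 5 -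
    7 / 4 * a 6 := by linarith
  have u1 : φ z 1 = a 0 + a 1 + a 2 + 3 / 4 * a 3 + 1 / 2 * a 4 + 1 / 4 * a 5 + 1 / 4 * a 6 := by
    linarith
  have u2 : φ z 2 = a 1 + a 2 + 3 / 4 * a 3 + 1 / 2 * a 4 + 1 / 4 * a 5 + 1 / 4 * a 6 := by
    linarith
  have u3 : φ z 3 = a 2 + 3 / 4 * a 3 + 1 / 2 * a 4 + 1 / 4 * a 5 + 1 / 4 * a 6 := by linarith
  have u4 : φ z 4 = 3 / 4 * a 3 + 1 / 2 * a 4 + 1 / 4 * a 5 + 1 / 4 * a 6 := by linarith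
  have u5 : φ z 5 = -1 / 4 * a 3 + 1 / 2 * a 4 + 1 / 4 * a 5 + 1 / 4 * a 6 := by linarith
  have u6 : φ z 6 = -1 / 4 * a 3 - 1 / 2 * a 4 + 1 / 4 * a 5 + 1 / 4 * a 6 := by linarith
  have u7 : φ z 7 = -1 / 4 * a 3 - 1 / 2 * a 4 - 3 / 4 * a 5 + 1 / 4 * a 6 := by linarith
  rw [u0, u1, u2, u3, u4, u5, u6, u7] at hR
  obtain ⟨z0, z1, z2, z3, z4, z6, z5⟩ := alcove_E7 (hdom 0) (hdom 1) (hdom 2) (hdom 3) (hdom 4)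
    (hdom 5) (hdom 6) (by linarith) hR
  simp only [z0, z1, z2, z3, z4, z5, z6] at u0 u1 u2 u3 u4 u5 u6 u7
  have hW : linearStabilizer L z = weylGroup L := by
    refine le_antisymm (fun g hg => orthogonalGroup_eq_weylGroup_E7 hL h ▸ hg.1)
      (weylGroup_le_linearStabilizer hL.integral fun r hr => ?_)
    obtain ⟨b, hb, hE, hs⟩ := mem_latticeE7_iff.1 ((hφ r).2 hr)
    rw [Fin.sum_univ_eight] at hs
    have hs' : (b 0 + b 1 + b 2 + b 3 + b 4 + b 5 + b 6 + b 7 : ℝ) = 0 := by exact_mod_cast hs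
    have hpar : ∃ k, b 0 + b 7 = 2 * k := by
      refine ⟨(b 0 + b 7) / 2, ?_⟩
      rcases hE.1 with h | h <;> have h0 := h 0 <;> have h7 := h 7 <;> omega
    obtain ⟨k, hk⟩ := hpar
    have hk' : (b 0 + b 7 : ℝ) = 2 * k := by exact_mod_cast hk
    -- Now φ z is (−3/4, 1/4, …, 1/4, −3/4). With ∑ bᵢ = 0 the pairing collapses to −(b₀ + b₇)/2, an
    -- integer because all bᵢ have the same parity.
    refine ⟨-k, ?_⟩
    rw [← φ.inner_map_map, hb, inner_ofInt, Fin.sum_univ_eight, u0, u1, u2, u3, u4, u5, u6, u7]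
    push_cast
    linarith
  rw [hW] at e
  obtain ⟨e'⟩ := nonempty_affineStabilizer_mulEquiv L c
  exact ⟨e'.trans e⟩

lemma stabilizer_typeE6 (hL : IsRootLattice L) {c : E} (hc : IsDeepHole L c)
    (h : Isometric L latticeE6) : Nonempty (affineStabilizer L c ≃* weylGroup L) := by
  obtain ⟨φ, hφ, hφ'⟩ := h.exists_linearIsometry
  obtain ⟨α, ρ, hα, hS⟩ := exists_simpleSystem_E6 hφ hφ'
  obtain ⟨d, -, hd⟩ := hφ' (ofInt ![-6, 10, -2, -2, -2, -2, -2, 6])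
    (mem_latticeE6_iff.2 ⟨_, rfl, by decide +kernel⟩)
  -- The highest root of E_6 for the chosen simple system.
  obtain ⟨θ, hθL, hθ⟩ := hφ' (ofInt ![-2, 0, 0, 0, 0, 0, 0, 2])
    (mem_latticeE6_iff.2 ⟨_, rfl, by decide +kernel⟩)
  have hsum : ∀ x, ∑ i, φ x i = 0 := fun x => by
    have := inner_map_eq_zero hφ (v := ofInt fun _ => 2) (fun y hy => by
      rw [inner_ofInt]
      simpa using hy.1.2) x
    rw [inner_ofInt] at this
    simpa using this
  have hsum7 : ∀ x, φ x 0 + φ x 7 = 0 := fun x => by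
    have := inner_map_eq_zero hφ (v := ofInt ![2, 0, 0, 0, 0, 0, 0, 2]) (fun y hy => by
      rw [inner_ofInt, Fin.sum_univ_eight]
      simpa using hy.2) x
    rw [inner_ofInt, Fin.sum_univ_eight] at this
    simpa using this
  obtain ⟨z, ⟨e⟩, hR, hdom, hroot⟩ := hc.exists_dominant hL (c₀ := (1 / 6 : ℝ) • d) (R := 4 / 3)
    (fun x hx => by
      have := norm_sq_ge_E6 ((hφ x).2 hx)
      rwa [← hd, ← map_smul, ← map_sub, φ.norm_map] at this)
    hS.mem hS.norm_sq hS.rho_mem (fun i => by rw [hS.inner_rho]; norm_num)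
  have hθ1 := hroot θ hθL (by rw [← φ.norm_map, hθ, norm_ofInt_root (by decide +kernel)])
  have hin : ∀ x i, ⟪α i, x⟫_ℝ = ∑ j, (simpleE6 i j : ℝ) / 2 * φ x j := fun x i => by
    rw [← φ.inner_map_map, hα, inner_ofInt]
  rw [← φ.inner_map_map, hθ, inner_ofInt] at hθ1
  rw [← φ.norm_map, EuclideanSpace.real_norm_sq_eq] at hR
  have hz := hsum z
  have hz7 := hsum7 z
  obtain ⟨a, ha⟩ : ∃ a : Fin 6 → ℝ, ∀ i, ⟪α i, z⟫_ℝ = a i := ⟨_, fun i => rfl⟩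
  have hinz := hin z
  simp only [ha] at hinz hdom
  have e0 := hinz 0
  have e1 := hinz 1
  have e2 := hinz 2
  have e3 := hinz 3
  have e4 := hinz 4
  have e5 := hinz 5
  simp [Fin.sum_univ_eight, simpleE6] at e0 e1 e2 e3 e4 e5 hθ1 hz hR
  have u0 : φ z 0 = -1 / 2 * a 0 - a 1 - 3 / 2 * a 2 - a 3 - 1 / 2 * a 4 - a 5 := by linarith
  have u1 : φ z 1 = 5 / 6 * a 0 + 2 / 3 * a 1 + 1 / 2 * a 2 + 1 / 3 * a 3 + 1 / 6 * a 4 := by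
    linarith
  have u2 : φ z 2 = -1 / 6 * a 0 + 2 / 3 * a 1 + 1 / 2 * a 2 + 1 / 3 * a 3 + 1 / 6 * a 4 := by
    linarith
  have u3 : φ z 3 = -1 / 6 * a 0 - 1 / 3 * a 1 + 1 / 2 * a 2 + 1 / 3 * a 3 + 1 / 6 * a 4 := by
    linarith
  have u4 : φ z 4 = -1 / 6 * a 0 - 1 / 3 * a 1 - 1 / 2 * a 2 + 1 / 3 * a 3 + 1 / 6 * a 4 := by
    linarith
  have u5 : φ z 5 = -1 / 6 * a 0 - 1 / 3 * a 1 - 1 / 2 * a 2 - 2 / 3 * a 3 + 1 / 6 * a 4 := by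
    linarith
  have u6 : φ z 6 = -1 / 6 * a 0 - 1 / 3 * a 1 - 1 / 2 * a 2 - 2 / 3 * a 3 - 5 / 6 * a 4 := by
    linarith
  have u7 : φ z 7 = 1 / 2 * a 0 + a 1 + 3 / 2 * a 2 + a 3 + 1 / 2 * a 4 + a 5 := by linarith
  rw [u0, u1, u2, u3, u4, u5, u6, u7] at hR
  obtain ⟨z1, z2, z3, z5, z04⟩ := alcove_E6 (hdom 0) (hdom 1) (hdom 2) (hdom 3) (hdom 4)
    (hdom 5) (by linarith) hR
  simp only [z1, z2, z3, z5] at u0 u1 u2 u3 u4 u5 u6 u7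
  have hW : linearStabilizer L z = weylGroup L := by
    -- z is one of the two end fundamental weights, and these pair integrally with L.
    have hWz : weylGroup L ≤ linearStabilizer L z := by
      refine weylGroup_le_linearStabilizer hL.integral fun r hr => ?_
      obtain ⟨b, hb, hE, hs, h07⟩ := mem_latticeE6_iff.1 ((hφ r).2 hr)
      rw [Fin.sum_univ_eight] at hs
      have hs' : (b 0 + b 1 + b 2 + b 3 + b 4 + b 5 + b 6 + b 7 : ℝ) = 0 := by exact_mod_cast hs
      have h07' : (b 0 + b 7 : ℝ) = 0 := by exact_mod_cast h07
      obtain ⟨m, hm⟩ := hE.exists_sub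
      have hm' : ∀ i, (b i : ℝ) = b 0 + 2 * m i := fun i => by exact_mod_cast hm i
      have hm1 := hm' 1
      have hm6 := hm' 6
      rcases z04 with ⟨z0, z4⟩ | ⟨z0, z4⟩
      · simp only [z0, z4] at u0 u1 u2 u3 u4 u5 u6 u7
        refine ⟨m 1, ?_⟩
        rw [← φ.inner_map_map, hb, inner_ofInt, Fin.sum_univ_eight, u0, u1, u2, u3, u4, u5, u6, u7]
        linarith
      · simp only [z0, z4] at u0 u1 u2 u3 u4 u5 u6 u7
        refine ⟨-b 0 - m 6, ?_⟩
        rw [← φ.inner_map_map, hb, inner_ofInt, Fin.sum_univ_eight, u0, u1, u2, u3, u4, u5, u6, u7]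
        push_cast
        linarith
    exact linearStabilizer_E6 hL hφ hα hS ha z1 z2 z3 z04 hWz
  rw [hW] at e
  obtain ⟨e'⟩ := nonempty_affineStabilizer_mulEquiv L c
  exact ⟨e'.trans e⟩

end TypeE

/-! ### Type E_8: the hole at a unit vector and W(D_8) -/

section TypeE8

lemma latticeD_le_latticeE8 {x : EuclideanSpace ℝ (Fin 8)} (hx : x ∈ latticeD 8) :
    x ∈ latticeE8 := Or.inl hx

/-- All eight coordinates are half-odd, contributing at least 1/4 each; so the half-odd coset
contains no unit vectors. -/
lemma norm_sq_ge_of_odd {a : Fin 8 → ℤ} (ha : ∀ i, a i % 2 = 1) {v : EuclideanSpace ℝ (Fin 8)}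
    (hv : ∀ i, ∃ k : ℤ, v i = k) : 2 ≤ ‖ofInt a + v‖ ^ 2 := by
  rw [EuclideanSpace.real_norm_sq_eq]
  have : ∑ _i : Fin 8, (1 / 4 : ℝ) ≤ ∑ i, (ofInt a + v) i ^ 2 := by
    refine Finset.sum_le_sum fun i _ => ?_
    obtain ⟨k, hk⟩ := hv i
    obtain ⟨m, hm⟩ : ∃ m, a i = 2 * m + 1 := ⟨a i / 2, by have := ha i; omega⟩
    rw [PiLp.add_apply, hk, ofInt_apply, hm]
    have : 0 ≤ (m + k) * (m + k + 1) := by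
      rcases le_or_gt 0 (m + k) with h | h <;> nlinarith
    have : (0 : ℝ) ≤ (m + k) * (m + k + 1) := by exact_mod_cast this
    push_cast
    nlinarith
  simp only [Finset.sum_const, Finset.card_univ, Fintype.card_fin, nsmul_eq_mul,
    Nat.cast_ofNat] at this
  linarith

lemma neg_stdVec_int (i j : Fin 8) : ∃ k : ℤ, (-stdVec i : EuclideanSpace ℝ (Fin 8)) j = k := by
  obtain ⟨k, hk⟩ := stdVec_int i j
  exact ⟨-k, by rw [PiLp.neg_apply, hk]; simp⟩

/-- On the integral part of E_8 the coordinate sum is even, so x never equals the unit vector and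
the difference is a nonzero integer vector; the half-odd part is at squared distance at least 2. -/
lemma norm_sq_ge_E8 {x : EuclideanSpace ℝ (Fin 8)} (hx : x ∈ latticeE8) :
    1 ≤ ‖x - stdVec 7‖ ^ 2 := by
  obtain ⟨a, rfl, h | h, hs⟩ := mem_latticeE8_iff.1 hx
  · have : ∀ i, ∃ m : ℤ, a i = 2 * m := fun i => ⟨a i / 2, by have := h i; omega⟩
    choose m hm using this
    have hint : ∀ i, (ofInt a - stdVec (7 : Fin 8)) i = ((m i - if i = 7 then 1 else 0 : ℤ) : ℝ) := by
      intro i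
      rw [PiLp.sub_apply, ofInt_apply, hm]
      push_cast
      simp
    rw [EuclideanSpace.real_norm_sq_eq]
    simp only [hint]
    have hpos : 0 < ∑ i, (m i - if i = 7 then 1 else 0) ^ 2 := by
      by_contra hle
      have h0 := le_antisymm (not_lt.1 hle) (Finset.sum_nonneg fun i _ => sq_nonneg _)
      rw [Finset.sum_eq_zero_iff_of_nonneg fun i _ => sq_nonneg _] at h0
      have h1 : ∀ i, m i = if i = 7 then 1 else 0 := fun i => by
        have := h0 i (Finset.mem_univ i)
        rw [pow_eq_zero_iff two_ne_zero] at this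
        linarith
      simp only [hm, h1] at hs
      revert hs
      decide +kernel
    exact_mod_cast hpos
  · have := norm_sq_ge_of_odd h (neg_stdVec_int 7)
    rw [sub_eq_add_neg]
    linarith

lemma halfOnes_mem : halfOnes ∈ latticeE8 := by
  right
  rw [sub_self]
  exact zero_mem _

lemma isHalfVec_halfOnes : IsHalfVec halfOnes := fun _ => Or.inl rfl

/-- The stabilizer of the class of half a vector of norm four of `E_8`. -/
lemma linearStabilizer_latticeE8_eq
    (hint : ∀ x ∈ latticeE8, ∀ y ∈ latticeE8, ∃ k : ℤ, ⟪x, y⟫_ℝ = k) :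
    linearStabilizer latticeE8 (stdVec 7) = weylGroup (latticeD 8) := by
  -- g eᵢ is a unit vector congruent to e₇ modulo E_8. The half-odd part of that coset is too long,
  -- so g eᵢ is integral, hence ±eⱼ.
  have hsigned : ∀ g ∈ linearStabilizer latticeE8 (stdVec 7),
      ∀ i, ∃ j, g (stdVec i) = stdVec j ∨ g (stdVec i) = -stdVec j := by
    intro g hg i
    have h := add_mem ((hg.1 _).2 (latticeD_le_latticeE8 (stdVec_sub_mem i 7))) hg.2
    rw [map_sub, sub_add_sub_cancel] at h
    obtain ⟨a, ha, h | h, hs⟩ := mem_latticeE8_iff.1 h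
    · refine eq_stdVec_of_norm_one (fun l => ?_) (by simp)
      obtain ⟨m, hm⟩ : ∃ m, a l = 2 * m := ⟨a l / 2, by have := h l; omega⟩
      obtain ⟨b, hb⟩ := stdVec_int (7 : Fin 8) l
      refine ⟨m + b, ?_⟩
      have e : g (stdVec i) = ofInt a + stdVec 7 := by rw [← ha]; abel
      rw [e, PiLp.add_apply, ofInt_apply, hm, hb]
      push_cast
      ring
    · have h2 := norm_sq_ge_of_odd h (stdVec_int 7)
      rw [← ha, sub_add_cancel, g.norm_map] at h2
      norm_num at h2
  refine le_antisymm (fun g hg => ?_) ?_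
  · refine mem_weylGroup_of_signed isHalfVec_halfOnes (hsigned g hg) ?_
    -- A signed permutation keeps the coordinates ±1/2, so g maps the all-halves vector into the
    -- nontrivial coset of D_8 in E_8; this is the spinor-class condition.
    refine ((hg.1 _).2 halfOnes_mem).resolve_left fun h => ?_
    obtain ⟨k, hk⟩ := h.1 0
    have hhalf := isHalfVec_map isHalfVec_halfOnes (hsigned _ (inv_mem hg)) 0
    change g halfOnes 0 = _ ∨ g halfOnes 0 = _ at hhalf
    rw [hk] at hhalf
    rcases hhalf with h | h
    · have : (2 * k : ℤ) = 1 := by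
        have : (2 * k : ℝ) = 1 := by linarith
        exact_mod_cast this
      omega
    · have : (2 * k : ℤ) = -1 := by
        have : (2 * k : ℝ) = -1 := by linarith
        exact_mod_cast this
      omega
  · rw [weylGroup, Subgroup.closure_le]
    rintro _ ⟨r, hr, hr2, rfl⟩
    refine ⟨reflection_root_mem hint (latticeD_le_latticeE8 hr) hr2, ?_⟩
    -- The unit vector is not in the dual of E_8, but roots of D_8 are integral and pair integrally
    -- with it.
    obtain ⟨k, hk⟩ := inner_stdVec_int 7 r hr
    rw [reflection_root_apply hr2, hk, Int.cast_smul_eq_zsmul, sub_sub_cancel_left]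
    exact latticeD_le_latticeE8 (neg_mem ((latticeD 8).smul_mem k hr))

variable {E : Type*} [NormedAddCommGroup E] [InnerProductSpace ℝ E] {L : Submodule ℤ E}
  [FiniteDimensional ℝ E] [DiscreteTopology L] [IsZLattice ℝ L]

lemma stabilizer_typeE8 (hL : IsRootLattice L) {c : E} (hc : IsDeepHole L c)
    (h : Isometric L latticeE8) :
    Nonempty (affineStabilizer L c ≃* weylGroup (latticeD 8)) := by
  obtain ⟨φ₀, hφ₀, hφ₀'⟩ := h.exists_linearIsometry
  let φ := LinearIsometryEquiv.ofSurjective φ₀ (surjective_of_stdVec φ₀ hφ₀'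
    fun i => latticeD_le_latticeE8 (two_stdVec_mem i))
  have hφ : ∀ x, φ x ∈ latticeE8 ↔ x ∈ L := hφ₀
  have hsymm : ∀ y, φ.symm y ∈ L ↔ y ∈ latticeE8 := fun y => by
    rw [← hφ, φ.apply_symm_apply]
  have hint : ∀ x ∈ latticeE8, ∀ y ∈ latticeE8, ∃ k : ℤ, ⟪x, y⟫_ℝ = k := fun x hx y hy => by
    rw [← φ.symm.inner_map_map]
    exact hL.integral _ ((hsymm x).2 hx) _ ((hsymm y).2 hy)
  have hin : ∀ (b : Fin 8 → ℤ) x, ⟪φ.symm (ofInt b), x⟫_ℝ = ∑ j, (b j : ℝ) / 2 * φ x j :=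
    fun b x => by
      rw [← φ.inner_map_map, φ.apply_symm_apply, inner_ofInt]
  obtain ⟨z, ⟨e⟩, hR, hdom, hroot⟩ := hc.exists_dominant hL (c₀ := φ.symm (stdVec 7)) (R := 1)
    (fun x hx => by
      have := norm_sq_ge_E8 ((hφ x).2 hx)
      rwa [← φ.norm_map, map_sub, φ.apply_symm_apply])
    (α := fun i => φ.symm (ofInt (simpleE8 i)))
    -- The doubled coordinates of the sum of the positive roots; only its positive pairing with the
    -- simple roots is needed.
    (ρ := φ.symm (ofInt ![0, 4, 8, 12, 16, 20, 24, 92]))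
    (fun i => (hsymm _).2 (mem_latticeE8_iff.2 ⟨_, rfl, by revert i; decide +kernel⟩))
    (fun i => by
      rw [φ.symm.norm_map, norm_ofInt_root]
      revert i
      decide +kernel)
    ((hsymm _).2 (mem_latticeE8_iff.2 ⟨_, rfl, by decide +kernel⟩))
    (fun i => by
      have : ∀ i, ∑ k, simpleE8 i k * ![0, 4, 8, 12, 16, 20, 24, 92] k = 8 := by decide +kernel
      rw [φ.symm.inner_map_map, inner_ofInt_ofInt, this]
      norm_num)
  have hθ1 := hroot (φ.symm (ofInt ![0, 0, 0, 0, 0, 0, 2, 2]))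
    ((hsymm _).2 (mem_latticeE8_iff.2 ⟨_, rfl, by decide +kernel⟩))
    (by rw [φ.symm.norm_map, norm_ofInt_root (by decide +kernel)])
  rw [← φ.norm_map, EuclideanSpace.real_norm_sq_eq] at hR
  rw [hin] at hθ1
  obtain ⟨a, ha⟩ : ∃ a : Fin 8 → ℝ, ∀ i, ⟪φ.symm (ofInt (simpleE8 i)), z⟫_ℝ = a i :=
    ⟨_, fun i => rfl⟩
  have hinz := fun i => hin (simpleE8 i) z
  simp only [ha] at hinz hdom
  have e0 := hinz 0
  have e1 := hinz 1
  have e2 := hinz 2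
  have e3 := hinz 3
  have e4 := hinz 4
  have e5 := hinz 5
  have e6 := hinz 6
  have e7 := hinz 7
  simp [Fin.sum_univ_eight, simpleE8] at e0 e1 e2 e3 e4 e5 e6 e7 hθ1 hR
  have u0 : φ z 0 = 1 / 2 * a 1 - 1 / 2 * a 2 := by linarith
  have u1 : φ z 1 = 1 / 2 * a 1 + 1 / 2 * a 2 := by linarith
  have u2 : φ z 2 = 1 / 2 * a 1 + 1 / 2 * a 2 + a 3 := by linarith
  have u3 : φ z 3 = 1 / 2 * a 1 + 1 / 2 * a 2 + a 3 + a 4 := by linarith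
  have u4 : φ z 4 = 1 / 2 * a 1 + 1 / 2 * a 2 + a 3 + a 4 + a 5 := by linarith
  have u5 : φ z 5 = 1 / 2 * a 1 + 1 / 2 * a 2 + a 3 + a 4 + a 5 + a 6 := by linarith
  have u6 : φ z 6 = 1 / 2 * a 1 + 1 / 2 * a 2 + a 3 + a 4 + a 5 + a 6 + a 7 := by linarith
  have u7 : φ z 7 = 2 * a 0 + 5 / 2 * a 1 + 7 / 2 * a 2 + 5 * a 3 + 4 * a 4 + 3 * a 5 + 2 * a 6 +
    a 7 := by linarith
  rw [u0, u1, u2, u3, u4, u5, u6, u7] at hR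
  obtain ⟨z1, z2, z3, z4, z5, z6, z7, z0⟩ := alcove_E8 (hdom 0) (hdom 1) (hdom 2) (hdom 3)
    (hdom 4) (hdom 5) (hdom 6) (hdom 7) (by linarith) hR
  simp only [z0, z1, z2, z3, z4, z5, z6, z7] at u0 u1 u2 u3 u4 u5 u6 u7
  -- The vertex a0 = 1/2 is half a lattice vector of squared norm 4.
  have hz : φ z = stdVec 7 := by
    ext i
    fin_cases i <;> simp [u0, u1, u2, u3, u4, u5, u6, u7]
  obtain ⟨e₁⟩ := nonempty_affineStabilizer_mulEquiv L c
  obtain ⟨e₂⟩ := nonempty_linearStabilizer_mulEquiv φ hφ z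
  rw [hz, linearStabilizer_latticeE8_eq hint] at e₂
  exact ⟨(e₁.trans e).trans e₂⟩

end TypeE8

end RootLattice

end

theorem lemma3p6 {E : Type*} [NormedAddCommGroup E] [InnerProductSpace ℝ E]
    [FiniteDimensional ℝ E] (L : Submodule ℤ E) [DiscreteTopology L] [IsZLattice ℝ L]
    (hroot : RootLattice.IsRootLattice L) (hind : RootLattice.IsIndecomposable L)
    (c : E) (hc : RootLattice.IsDeepHole L c) :
    -- type A
    (∀ n : ℕ, 1 ≤ n → RootLattice.Isometric L (RootLattice.latticeA n) →
      (Even n →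
        Nonempty (RootLattice.affineStabilizer L c ≃* RootLattice.weylGroup L)) ∧
      (Odd n →
        Nonempty (RootLattice.affineStabilizer L c ≃* RootLattice.orthogonalGroup L))) ∧
    -- type D
    (RootLattice.Isometric L (RootLattice.latticeD 4) →
      Nonempty (RootLattice.affineStabilizer L c ≃* RootLattice.orthogonalGroupD4')) ∧
    (RootLattice.weylGroup (RootLattice.latticeD 4) ≤ RootLattice.orthogonalGroupD4' ∧
      RootLattice.orthogonalGroupD4' ≤
        RootLattice.orthogonalGroup (RootLattice.latticeD 4) ∧
      (RootLattice.weylGroup (RootLattice.latticeD 4)).relIndex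
        RootLattice.orthogonalGroupD4' = 2 ∧
      RootLattice.orthogonalGroupD4'.relIndex
        (RootLattice.orthogonalGroup (RootLattice.latticeD 4)) = 3) ∧
    (∀ n : ℕ, 5 ≤ n → RootLattice.Isometric L (RootLattice.latticeD n) →
      Nonempty (RootLattice.affineStabilizer L c ≃* RootLattice.weylGroup L)) ∧
    -- type E
    (RootLattice.Isometric L RootLattice.latticeE6 →
      Nonempty (RootLattice.affineStabilizer L c ≃* RootLattice.weylGroup L)) ∧
    (RootLattice.Isometric L RootLattice.latticeE7 →
      Nonempty (RootLattice.affineStabilizer L c ≃* RootLattice.weylGroup L) ∧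
      Nonempty (RootLattice.orthogonalGroup L ≃* RootLattice.weylGroup L)) ∧
    (RootLattice.Isometric L RootLattice.latticeE8 →
      Nonempty (RootLattice.affineStabilizer L c ≃*
        RootLattice.weylGroup (RootLattice.latticeD 8))) := by
  open RootLattice in
  exact ⟨fun n hn h => ⟨fun he => stabilizer_typeA_even hroot hn he hc h,
      fun ho => stabilizer_typeA_odd ho hc h⟩,
    fun h => stabilizer_typeD_four hc h,
    ⟨le_sup_left, orthogonalGroupD4'_eq ▸ fun g hg => hg.1, relIndex_weylGroup_D4,
      relIndex_orthogonalGroupD4'⟩,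
    fun n hn h => stabilizer_typeD hn hc h,
    fun h => stabilizer_typeE6 hroot hc h,
    fun h => ⟨stabilizer_typeE7 hroot hc h,
      by rw [orthogonalGroup_eq_weylGroup_E7 hroot h]; exact ⟨MulEquiv.refl _⟩⟩,
    fun h => stabilizer_typeE8 hroot hc h⟩
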